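/- Consider real-valued solutions of the focusing cubic wave equation $$\partial_t^2 u-\Delta u=u^3,\qquad x\in\mathbb R^3. \tag{NLW}$$ Write $\boldsymbol u(t)=(u(t),\partial_t u(t))$, and let $H^s=H^s(\mathbb R^3)$ be the usual inhomogeneous $L^2$-based Sobolev space. A solution on $[0,T)$, $T>0$, is a function $u\in C([0,T);H^3)\cap C^1([0,T);H^2)$ that satisfies (NLW), the time derivative of $\partial_t u$ being taken in $L^2(\mathbb R^3)$. For $(X,Y)\in\mathbb R^2$ let $u=u_{X,Y}$ be the solution with initial data $$\boldsymbol u(0,x)=\left(\frac{2X}{1+|x|^2},\ \frac{4Y}{(1+|x|^2)^2}\right),$$ and let $t_+=t_+(X,Y)\in(0,\infty]$ be its maximal forward time of existence. Suppose that $u$ is a blow-up solution, that is, $t_+<\infty$. Then for every $\eta>0$ there is $\varepsilon=\varepsilon(u,\eta)>0$ such that the following holds. Let $(v_0,v_1)$ be any pair of radial functions with $\|\boldsymbol u(0)-(v_0,v_1)\|_{H^3\times H^2}<\varepsilon$. Then there is a time $t_+'$ with $0<t_+'<t_++\eta$ such that (NLW) has a solution $v$ on $[0,t_+')$ with $\boldsymbol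 v(0)=(v_0,v_1)$ and $$\|\boldsymbol v(t)\|_{H^3\times H^2}\to\infty\quad\text{as } t\nearrow t_+',$$ and every solution on an interval $[0,T)$ with the same data satisfies $T\le t_+'$ and is the restriction of $v$ to $[0,T)$. -/

import Mathlib

open MeasureTheory Filter Topology Set
open scoped ENNReal SchwartzMap FourierTransform

/-- The space `ℝ³` with the Euclidean norm. -/
abbrev R3 : Type := EuclideanSpace ℝ (Fin 3)

/-- The real Hilbert space `L²(ℝ³; ℝ)`. -/
abbrev L2R3 : Type := Lp ℝ 2 (volume : Measure R3)

/-- A real `L²` function, seen as a complex-valued one. -/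
noncomputable def toComplexL2 (f : L2R3) : Lp ℂ 2 (volume : Measure R3) :=
  Complex.ofRealCLM.compLp f

/-- The inhomogeneous Sobolev norm
`‖f‖_{H^s} = ‖(1 - Δ)^{s/2} f‖_{L²} = ‖(1 + |2πξ|²)^{s/2} (𝓕 f)(ξ)‖_{L²}`, `s ≥ 0`, where `𝓕` is the
Fourier transform on `L²` in the normalisation `∫ exp(-2πi x·ξ) f(x) dx`.
It takes values in `[0, ∞]`, and `f` belongs to `H^s(ℝ³)` if and only if it is finite. -/
noncomputable def sobolevNorm (s : ℝ) (f : L2R3) : ℝ≥0∞ :=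
  eLpNorm (fun ξ : R3 =>
    (((1 + (2 * Real.pi * ‖ξ‖) ^ 2) ^ (s / 2) : ℝ) : ℂ) * (𝓕 (toComplexL2 f)) ξ) 2 volume

/-- The norm of a pair in `H³(ℝ³) × H²(ℝ³)`; it is finite if and only if the pair is in this
space. -/
noncomputable def pairNorm (f g : L2R3) : ℝ≥0∞ :=
  sobolevNorm 3 f + sobolevNorm 2 g

/-- `f` is radially symmetric. -/
def IsRadial (f : L2R3) : Prop :=
  ∃ g : ℝ → ℝ, ∀ᵐ x : R3, f x = g ‖x‖

/-- `a = Δ f + f³` in the sense of distributions on `ℝ³`. -/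
def IsLaplacianAddCube (f a : L2R3) : Prop :=
  ∀ φ : 𝓢(R3, ℝ),
    ∫ x, a x * φ x = (∫ x, f x * (Laplacian.laplacian φ) x) + ∫ x, (f x) ^ 3 * φ x

/-- `v` is a solution on the time interval `[0, T)` of `∂ₜ² v - Δ v = v³`, with
`v ∈ C([0,T); H³) ∩ C¹([0,T); H²)`, where `w = ∂ₜ v` and `(v, w)` has the value `(v₀, v₁)` at time
zero. The time derivatives are derivatives of `L²`-valued functions, one-sided at time zero;
since `w` is continuous with values in `H²` and `Δ v + v³` is continuous with values in `H¹`, they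
are also derivatives in `H²` and `H¹` respectively. -/
structure IsSolution (T : ℝ) (v₀ v₁ : L2R3) (v w : ℝ → L2R3) : Prop where
  init_fst : v 0 = v₀
  init_snd : w 0 = v₁
  finite : ∀ t ∈ Ico 0 T, pairNorm (v t) (w t) < ⊤
  continuous : ∀ t ∈ Ico 0 T,
    Tendsto (fun τ => pairNorm (v τ - v t) (w τ - w t)) (𝓝[Ico 0 T] t) (𝓝 0)
  deriv_fst : ∀ t ∈ Ico 0 T, HasDerivWithinAt v (w t) (Ico 0 T) t
  deriv_snd : ∀ t ∈ Ico 0 T, ∃ a : L2R3,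
    HasDerivWithinAt w a (Ico 0 T) t ∧ IsLaplacianAddCube (v t) a

/-- The maximal forward time of existence of the solution with data `(v₀, v₁)` is finite, and it is
equal to `T`. -/
def IsFiniteMaximalTime (v₀ v₁ : L2R3) (T : ℝ) : Prop :=
  IsLUB {τ : ℝ | 0 < τ ∧ ∃ v w : ℝ → L2R3, IsSolution τ v₀ v₁ v w} T

/-- The solution `v` with data `(v₀, v₁)` blows up in `H³ × H²` at time `T`: it is a solution on
`[0, T)`, its norm tends to infinity as `t ↗ T`, and it is the only one, that is, every solution
with the same data is a restriction of it. -/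
def BlowsUpAt (v₀ v₁ : L2R3) (T : ℝ) : Prop :=
  ∃ v w : ℝ → L2R3, IsSolution T v₀ v₁ v w ∧
    Tendsto (fun t => pairNorm (v t) (w t)) (𝓝[<] T) (𝓝 ⊤) ∧
    ∀ (τ : ℝ) (v' w' : ℝ → L2R3), 0 < τ → IsSolution τ v₀ v₁ v' w' →
      τ ≤ T ∧ ∀ t ∈ Ico 0 τ, v' t = v t ∧ w' t = w t

theorem memLp_inv_one_add_normSq_pow (c : ℝ) {k : ℕ} (hk : 1 ≤ k) :
    MemLp (fun x : R3 => c / (1 + ‖x‖ ^ 2) ^ k) 2 volume := by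
  have h1 : MemLp (fun x : R3 => 1 / (1 + ‖x‖ ^ 2)) 2 volume := by
    rw [memLp_two_iff_integrable_sq]
    · have h := integrable_rpow_neg_one_add_norm_sq (E := R3) (μ := volume) (r := 4)
        (by simp; norm_num)
      refine h.congr (Eventually.of_forall fun x => ?_)
      have hx : (0 : ℝ) < 1 + ‖x‖ ^ 2 := by positivity
      have e : (-4 / 2 : ℝ) = -((2 : ℕ) : ℝ) := by norm_num
      simp only [e, Real.rpow_neg hx.le, Real.rpow_natCast]
      simp
    · exact Measurable.aestronglyMeasurable (by fun_prop)
  refine (h1.const_mul c).mono (Measurable.aestronglyMeasurable (by fun_prop))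
    (Eventually.of_forall fun x => ?_)
  have hx : (1 : ℝ) ≤ 1 + ‖x‖ ^ 2 := by nlinarith [sq_nonneg ‖x‖]
  have hp : 1 + ‖x‖ ^ 2 ≤ (1 + ‖x‖ ^ 2) ^ k := by
    calc 1 + ‖x‖ ^ 2 = (1 + ‖x‖ ^ 2) ^ 1 := (pow_one _).symm
      _ ≤ _ := pow_le_pow_right₀ hx hk
  have h0 : (0 : ℝ) < 1 + ‖x‖ ^ 2 := by linarith
  have h0k : (0 : ℝ) < (1 + ‖x‖ ^ 2) ^ k := by positivity
  rw [norm_div, norm_mul, norm_div, Real.norm_of_nonneg h0.le, Real.norm_of_nonneg h0k.le,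
    div_eq_mul_inv, norm_one, one_div]
  gcongr

/-- The initial position `2X / (1 + |x|²)` of `u_{X,Y}`. -/
noncomputable def initPosition (X : ℝ) : L2R3 :=
  MemLp.toLp (fun x : R3 => 2 * X / (1 + ‖x‖ ^ 2))
    (by simpa using memLp_inv_one_add_normSq_pow (2 * X) (k := 1) le_rfl)

/-- The initial velocity `4Y / (1 + |x|²)²` of `u_{X,Y}`. -/
noncomputable def initVelocity (Y : ℝ) : L2R3 :=
  MemLp.toLp (fun x : R3 => 4 * Y / (1 + ‖x‖ ^ 2) ^ 2)
    (memLp_inv_one_add_normSq_pow (4 * Y) one_le_two)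

open scoped BoundedContinuousFunction InnerProductSpace

/-- The complex Hilbert space `L²(ℝ³; ℂ)`. -/
abbrev CL2 : Type := Lp ℂ 2 (volume : Measure R3)

theorem Lp_fourier_ae_eq (f : CL2) (hf : Integrable f) :
    ((𝓕 f : CL2) : R3 → ℂ) =ᵐ[volume] 𝓕 (f : R3 → ℂ) := by
  refine ae_eq_of_integral_contDiff_smul_eq
    ((Lp.memLp (𝓕 f : CL2)).locallyIntegrable (by norm_num)) ?_ fun g hg hgs => ?_
  · exact (VectorFourier.fourierIntegral_continuous Real.continuous_fourierChar
      (by exact continuous_inner) hf).locallyIntegrable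
  · have hgc : ContDiff ℝ (⊤ : ℕ∞) (fun x => (g x : ℂ)) := Complex.ofRealCLM.contDiff.comp hg
    have hgcs : HasCompactSupport (fun x => (g x : ℂ)) := hgs.comp_left Complex.ofReal_zero
    let φ : 𝓢(R3, ℂ) := hgcs.toSchwartzMap hgc
    have hφ : ∀ x, φ x = (g x : ℂ) := fun x => rfl
    have h1 := Lp.toTemperedDistribution_apply (𝓕 f : CL2) φ
    rw [← Lp.fourier_toTemperedDistribution_eq, TemperedDistribution.fourier_apply,
      Lp.toTemperedDistribution_apply] at h1
    have h2 := VectorFourier.integral_fourierIntegral_smul_eq_flip (L := innerₗ R3)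
      (μ := volume) (ν := volume) Real.continuous_fourierChar continuous_inner
      φ.integrable hf
    rw [flip_innerₗ] at h2
    have h3 : ∫ x, φ x • (𝓕 f : CL2) x = ∫ x, φ x • 𝓕 (f : R3 → ℂ) x := by
      rw [← h1]; exact h2
    simpa [hφ] using h3

theorem Lp_fourierInv_ae_eq (f : CL2) (hf : Integrable f) :
    ((𝓕⁻ f : CL2) : R3 → ℂ) =ᵐ[volume] 𝓕⁻ (f : R3 → ℂ) := by
  refine ae_eq_of_integral_contDiff_smul_eq
    ((Lp.memLp (𝓕⁻ f : CL2)).locallyIntegrable (by norm_num)) ?_ fun g hg hgs => ?_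
  · have : 𝓕⁻ (f : R3 → ℂ) = fun x => 𝓕 (f : R3 → ℂ) (-x) := by
      ext x; exact Real.fourierInv_eq_fourier_neg _ _
    rw [this]
    exact ((VectorFourier.fourierIntegral_continuous Real.continuous_fourierChar
      (by exact continuous_inner) hf).comp continuous_neg).locallyIntegrable
  · have hgc : ContDiff ℝ (⊤ : ℕ∞) (fun x => (g x : ℂ)) := Complex.ofRealCLM.contDiff.comp hg
    have hgcs : HasCompactSupport (fun x => (g x : ℂ)) := hgs.comp_left Complex.ofReal_zero
    let φ : 𝓢(R3, ℂ) := hgcs.toSchwartzMap hgc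
    have hφ : ∀ x, φ x = (g x : ℂ) := fun x => rfl
    have h1 := Lp.toTemperedDistribution_apply (𝓕⁻ f : CL2) φ
    rw [← Lp.fourierInv_toTemperedDistribution_eq, TemperedDistribution.fourierInv_apply,
      Lp.toTemperedDistribution_apply] at h1
    have h2 := VectorFourier.integral_fourierIntegral_smul_eq_flip (L := -innerₗ R3)
      (μ := volume) (ν := volume) Real.continuous_fourierChar continuous_inner.neg
      φ.integrable hf
    have h4 : (-innerₗ R3).flip = -innerₗ R3 := by
      ext x y; simp [real_inner_comm]
    rw [h4] at h2
    have h3 : ∫ x, φ x • (𝓕⁻ f : CL2) x = ∫ x, φ x • 𝓕⁻ (f : R3 → ℂ) x := by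
      rw [← h1, SchwartzMap.fourierInv_coe]; exact h2
    simpa [hφ] using h3

theorem continuous_fourierInv_of_integrable {f : R3 → ℂ} (hf : Integrable f) :
    Continuous (𝓕⁻ f) := by
  have : 𝓕⁻ f = fun x => 𝓕 f (-x) := by
    ext x; exact Real.fourierInv_eq_fourier_neg _ _
  rw [this]
  exact (VectorFourier.fourierIntegral_continuous Real.continuous_fourierChar
      (by exact continuous_inner) hf).comp continuous_neg

/-- Pointwise complex conjugation on `L²`. -/
noncomputable def conjL : CL2 →L[ℝ] CL2 :=
  (Complex.conjCLE : ℂ →L[ℝ] ℂ).compLpL 2 volume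

/-- Composition with a linear isometry on `L²`. -/
noncomputable def compIso {E : Type*} [NormedAddCommGroup E] [NormedSpace ℝ E] (R : R3 ≃ₗᵢ[ℝ] R3) :
    Lp E 2 (volume : Measure R3) →L[ℝ] Lp E 2 (volume : Measure R3) :=
  (Lp.compMeasurePreservingₗᵢ ℝ R R.measurePreserving).toContinuousLinearMap

theorem compIso_ae {E : Type*} [NormedAddCommGroup E] [NormedSpace ℝ E] (R : R3 ≃ₗᵢ[ℝ] R3)
    (f : Lp E 2 (volume : Measure R3)) : ⇑(compIso R f) =ᵐ[volume] f ∘ R :=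
  Lp.coeFn_compMeasurePreserving _ R.measurePreserving

theorem conjL_ae (f : CL2) :
    ⇑(conjL f) =ᵐ[volume] fun x => (starRingEnd ℂ) (f x) :=
  ContinuousLinearMap.coeFn_compLpL _ f

theorem Lp_induction_schwartz {p : CL2 → Prop}
    (hc : IsClosed {f | p f}) (h : ∀ f : CL2, Integrable f → p f)
    (f : CL2) : p f := by
  refine DenseRange.induction_on (p := p)
    (SchwartzMap.denseRange_toLpCLM (F := ℂ) (E := R3) (μ := volume) (p := 2)
      ENNReal.ofNat_ne_top) f hc fun φ => h _ ?_
  exact φ.integrable.congr (φ.coeFn_toLp 2 volume).symm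

theorem fourier_compIso (R : R3 ≃ₗᵢ[ℝ] R3) (f : CL2) :
    𝓕 (compIso R f) = compIso R (𝓕 f) := by
  refine Lp_induction_schwartz (p := fun f => 𝓕 (compIso R f) = compIso R (𝓕 f)) ?_ ?_ f
  · have h1 : Continuous (𝓕 : CL2 → CL2) :=
      (Lp.fourierTransformₗᵢ R3 ℂ).continuous
    exact isClosed_eq (h1.comp (compIso R).continuous) ((compIso R).continuous.comp h1)
  · intro f hf
    have hi : Integrable (compIso R f) :=
      (R.measurePreserving.integrable_comp_of_integrable hf).congr (compIso_ae R f).symm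
    apply Lp.ext
    filter_upwards [Lp_fourier_ae_eq _ hi, compIso_ae R (𝓕 f),
      R.measurePreserving.quasiMeasurePreserving.ae (Lp_fourier_ae_eq f hf)] with ξ h1 h2 h3
    rw [h1, h2, Function.comp_apply, h3, ← Real.fourier_comp_linearIsometry]
    exact congrFun (VectorFourier.fourierIntegral_congr_ae _ _ _ (compIso_ae R f)) ξ

theorem fourier_conjL (f : CL2) :
    𝓕 (conjL f) = conjL (compIso (LinearIsometryEquiv.neg ℝ) (𝓕 f)) := by
  refine Lp_induction_schwartz
    (p := fun f => 𝓕 (conjL f) = conjL (compIso (LinearIsometryEquiv.neg ℝ) (𝓕 f))) ?_ ?_ f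
  · have h1 : Continuous (𝓕 : CL2 → CL2) :=
      (Lp.fourierTransformₗᵢ R3 ℂ).continuous
    exact isClosed_eq (h1.comp conjL.continuous)
      (conjL.continuous.comp ((compIso _).continuous.comp h1))
  · intro f hf
    have hi : Integrable (conjL f) :=
      ((Complex.conjCLE : ℂ →L[ℝ] ℂ).integrable_comp hf).congr (conjL_ae f).symm
    apply Lp.ext
    filter_upwards [Lp_fourier_ae_eq _ hi, conjL_ae (compIso (LinearIsometryEquiv.neg ℝ) (𝓕 f)),
      compIso_ae (LinearIsometryEquiv.neg ℝ) (𝓕 f),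
      (LinearIsometryEquiv.neg ℝ (E := R3)).measurePreserving.quasiMeasurePreserving.ae
        (Lp_fourier_ae_eq f hf)] with ξ h1 h2 h3 h4
    rw [h1, h2, h3, Function.comp_apply, h4, Real.fourier_eq, Real.fourier_eq, ← integral_conj]
    refine integral_congr_ae ?_
    filter_upwards [conjL_ae f] with x hx
    rw [hx]
    simp [Circle.smul_def, ← Circle.coe_inv_eq_conj, ← AddChar.map_neg_eq_inv]

theorem norm_symbol_le (m : ℝ →ᵇ ℝ) (ξ : R3) :
    ‖((m (2 * Real.pi * ‖ξ‖) : ℝ) : ℂ)‖ ≤ ‖m‖ := by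
  rw [Complex.norm_real]; exact m.norm_coe_le_norm _

theorem measurable_symbol (m : ℝ →ᵇ ℝ) :
    Continuous fun ξ : R3 => ((m (2 * Real.pi * ‖ξ‖) : ℝ) : ℂ) :=
  Complex.continuous_ofReal.comp (m.continuous.comp (by fun_prop))

theorem memLp_symbol_mul (m : ℝ →ᵇ ℝ) (f : CL2) :
    MemLp (fun ξ : R3 => ((m (2 * Real.pi * ‖ξ‖) : ℝ) : ℂ) * f ξ) 2 volume :=
  (Lp.memLp f).of_le_mul (c := ‖m‖)
    ((measurable_symbol m).aestronglyMeasurable.mul (Lp.aestronglyMeasurable f))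
    (Eventually.of_forall fun ξ => by
      rw [norm_mul]; gcongr; exact norm_symbol_le m ξ)

/-- Multiplication on `L²` by the bounded radial function `m (2π|ξ|)`. -/
noncomputable def mulC (m : ℝ →ᵇ ℝ) : CL2 →L[ℂ] CL2 :=
  LinearMap.mkContinuous
    { toFun := fun f => (memLp_symbol_mul m f).toLp _
      map_add' := fun f g => by
        apply Lp.ext
        filter_upwards [(memLp_symbol_mul m (f + g)).coeFn_toLp, (memLp_symbol_mul m f).coeFn_toLp,
          (memLp_symbol_mul m g).coeFn_toLp, Lp.coeFn_add f g,
          Lp.coeFn_add ((memLp_symbol_mul m f).toLp _) ((memLp_symbol_mul m g).toLp _)]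
          with x h1 h2 h3 h4 h5
        rw [h1, h5, Pi.add_apply, h2, h3, h4, Pi.add_apply, mul_add]
      map_smul' := fun c f => by
        apply Lp.ext
        filter_upwards [(memLp_symbol_mul m (c • f)).coeFn_toLp, (memLp_symbol_mul m f).coeFn_toLp,
          Lp.coeFn_smul c f, Lp.coeFn_smul c ((memLp_symbol_mul m f).toLp _)]
          with x h1 h2 h3 h4
        rw [h1, RingHom.id_apply, h4, Pi.smul_apply, h2, h3, Pi.smul_apply, smul_eq_mul,
          smul_eq_mul]
        ring }
    ‖m‖ fun f => by
      refine Lp.norm_le_mul_norm_of_ae_le_mul ?_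
      filter_upwards [(memLp_symbol_mul m f).coeFn_toLp] with x h1
      simp only [LinearMap.coe_mk, AddHom.coe_mk]
      rw [h1, norm_mul]; gcongr; exact norm_symbol_le m x

theorem mulC_ae (m : ℝ →ᵇ ℝ) (f : CL2) :
    ⇑(mulC m f) =ᵐ[volume] fun ξ => ((m (2 * Real.pi * ‖ξ‖) : ℝ) : ℂ) * f ξ :=
  (memLp_symbol_mul m f).coeFn_toLp

theorem norm_mulC_le (m : ℝ →ᵇ ℝ) (f : CL2) : ‖mulC m f‖ ≤ ‖m‖ * ‖f‖ :=
  (mulC m).le_of_opNorm_le (LinearMap.mkContinuous_norm_le _ (norm_nonneg m) _) f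

theorem mulC_mul (m n : ℝ →ᵇ ℝ) (f : CL2) : mulC (m * n) f = mulC m (mulC n f) := by
  apply Lp.ext
  filter_upwards [mulC_ae (m * n) f, mulC_ae m (mulC n f), mulC_ae n f] with x h1 h2 h3
  rw [h1, h2, h3, BoundedContinuousFunction.coe_mul, Pi.mul_apply]; push_cast; ring

theorem mulC_one (f : CL2) : mulC 1 f = f := by
  apply Lp.ext
  filter_upwards [mulC_ae 1 f] with x h1
  rw [h1]; simp

theorem mulC_add (m n : ℝ →ᵇ ℝ) (f : CL2) : mulC (m + n) f = mulC m f + mulC n f := by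
  apply Lp.ext
  filter_upwards [mulC_ae (m + n) f, mulC_ae m f, mulC_ae n f, Lp.coeFn_add (mulC m f) (mulC n f)]
    with x h1 h2 h3 h4
  rw [h1, h4, Pi.add_apply, h2, h3, BoundedContinuousFunction.coe_add, Pi.add_apply]
  push_cast; ring

theorem mulC_smul (c : ℝ) (m : ℝ →ᵇ ℝ) (f : CL2) : mulC (c • m) f = c • mulC m f := by
  apply Lp.ext
  filter_upwards [mulC_ae (c • m) f, mulC_ae m f, Lp.coeFn_smul c (mulC m f)] with x h1 h2 h4
  rw [h1, h4, Pi.smul_apply, h2]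
  simp [mul_assoc]

theorem mulC_conjL (m : ℝ →ᵇ ℝ) (f : CL2) : mulC m (conjL f) = conjL (mulC m f) := by
  apply Lp.ext
  filter_upwards [mulC_ae m (conjL f), conjL_ae (mulC m f), mulC_ae m f, conjL_ae f]
    with x h1 h2 h3 h4
  rw [h1, h2, h3, h4, map_mul (starRingEnd ℂ), Complex.conj_ofReal]

theorem mulC_compIso (m : ℝ →ᵇ ℝ) (R : R3 ≃ₗᵢ[ℝ] R3) (f : CL2) :
    mulC m (compIso R f) = compIso R (mulC m f) := by
  apply Lp.ext
  filter_upwards [mulC_ae m (compIso R f), compIso_ae R (mulC m f),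
    R.measurePreserving.quasiMeasurePreserving.ae (mulC_ae m f), compIso_ae R f]
    with x h1 h2 h3 h4
  rw [h1, h2, Function.comp_apply, h3, h4, Function.comp_apply, R.norm_map]

/-- The complex Fourier multiplier with symbol `m (2π|ξ|)`. -/
noncomputable def multC (m : ℝ →ᵇ ℝ) (f : CL2) : CL2 := 𝓕⁻ (mulC m (𝓕 f))

theorem fourier_multC (m : ℝ →ᵇ ℝ) (f : CL2) : 𝓕 (multC m f) = mulC m (𝓕 f) :=
  FourierTransform.fourier_fourierInv_eq _

theorem fourier_injective_L2 {f g : CL2} (h : 𝓕 f = 𝓕 g) : f = g :=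
  (Lp.fourierTransformₗᵢ R3 ℂ).injective h

theorem multC_compIso (m : ℝ →ᵇ ℝ) (R : R3 ≃ₗᵢ[ℝ] R3) (f : CL2) :
    multC m (compIso R f) = compIso R (multC m f) := by
  apply fourier_injective_L2
  rw [fourier_multC, fourier_compIso, fourier_compIso, fourier_multC, mulC_compIso]

theorem multC_conjL (m : ℝ →ᵇ ℝ) (f : CL2) : multC m (conjL f) = conjL (multC m f) := by
  apply fourier_injective_L2
  rw [fourier_multC, fourier_conjL, fourier_conjL, fourier_multC, mulC_conjL, mulC_compIso]

/-- The inclusion of real functions into complex functions. -/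
noncomputable def ofRealL : L2R3 →L[ℝ] CL2 := Complex.ofRealCLM.compLpL 2 volume

/-- The real part of a complex function. -/
noncomputable def reL : CL2 →L[ℝ] L2R3 := Complex.reCLM.compLpL 2 volume

theorem ofRealL_ae (f : L2R3) : ⇑(ofRealL f) =ᵐ[volume] fun x => (f x : ℂ) :=
  ContinuousLinearMap.coeFn_compLpL _ f

theorem reL_ae (f : CL2) : ⇑(reL f) =ᵐ[volume] fun x => (f x).re :=
  ContinuousLinearMap.coeFn_compLpL _ f

theorem reL_ofRealL (f : L2R3) : reL (ofRealL f) = f := by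
  apply Lp.ext
  filter_upwards [reL_ae (ofRealL f), ofRealL_ae f] with x h1 h2
  rw [h1, h2, Complex.ofReal_re]

theorem ofRealL_reL (f : CL2) : ofRealL (reL f) = (2⁻¹ : ℝ) • (f + conjL f) := by
  apply Lp.ext
  filter_upwards [ofRealL_ae (reL f), reL_ae f, Lp.coeFn_smul (2⁻¹ : ℝ) (f + conjL f),
    Lp.coeFn_add f (conjL f), conjL_ae f] with x h1 h2 h3 h4 h5
  rw [h1, h2, h3, Pi.smul_apply, h4, Pi.add_apply, h5, Complex.add_conj, Complex.real_smul]
  push_cast; ring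

theorem conjL_ofRealL (f : L2R3) : conjL (ofRealL f) = ofRealL f := by
  apply Lp.ext
  filter_upwards [conjL_ae (ofRealL f), ofRealL_ae f] with x h1 h2
  rw [h1, h2, Complex.conj_ofReal]

theorem norm_ofRealL (f : L2R3) : ‖ofRealL f‖ = ‖f‖ := by
  have h : ∀ᵐ x ∂(volume : Measure R3), ‖ofRealL f x‖ = ‖f x‖ := by
    filter_upwards [ofRealL_ae f] with x h
    rw [h, Complex.norm_real]
  exact le_antisymm (Lp.norm_le_norm_of_ae_le (h.mono fun x hx => hx.le))
    (Lp.norm_le_norm_of_ae_le (h.mono fun x hx => hx.ge))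

theorem norm_reL_le (f : CL2) : ‖reL f‖ ≤ ‖f‖ := by
  refine Lp.norm_le_norm_of_ae_le ?_
  filter_upwards [reL_ae f] with x h
  rw [h]; exact Complex.abs_re_le_norm _

theorem compIso_ofRealL (R : R3 ≃ₗᵢ[ℝ] R3) (f : L2R3) :
    ofRealL (compIso R f) = compIso R (ofRealL f) := by
  apply Lp.ext
  filter_upwards [ofRealL_ae (compIso R f), compIso_ae R f, compIso_ae R (ofRealL f),
    R.measurePreserving.quasiMeasurePreserving.ae (ofRealL_ae f)] with x h1 h2 h3 h4
  rw [h1, h2, h3, Function.comp_apply, Function.comp_apply, h4]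

theorem compIso_reL (R : R3 ≃ₗᵢ[ℝ] R3) (f : CL2) :
    reL (compIso R f) = compIso R (reL f) := by
  apply Lp.ext
  filter_upwards [reL_ae (compIso R f), compIso_ae R f, compIso_ae R (reL f),
    R.measurePreserving.quasiMeasurePreserving.ae (reL_ae f)] with x h1 h2 h3 h4
  rw [h1, h2, h3, Function.comp_apply, Function.comp_apply, h4]

/-- The Fourier transform of a real `L²` function. -/
noncomputable def ftL : L2R3 →L[ℝ] CL2 :=
  ((Lp.fourierTransformₗᵢ R3 ℂ).toContinuousLinearEquiv.toContinuousLinearMap.restrictScalars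
    ℝ).comp ofRealL

theorem ftL_apply (f : L2R3) : ftL f = 𝓕 (ofRealL f) := rfl

theorem norm_ftL (f : L2R3) : ‖ftL f‖ = ‖f‖ := by
  rw [ftL_apply, Lp.norm_fourier_eq, norm_ofRealL]

theorem ftL_injective : Function.Injective ftL := fun f g h => by
  rw [← reL_ofRealL f, ← reL_ofRealL g,
    fourier_injective_L2 (f := ofRealL f) (g := ofRealL g) h]

/-- The real-valued inverse Fourier transform. -/
noncomputable def iftL : CL2 →L[ℝ] L2R3 :=
  reL.comp ((Lp.fourierTransformₗᵢ R3 ℂ).symm.toContinuousLinearEquiv.toContinuousLinearMap.restrictScalars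
    ℝ)

theorem iftL_apply (f : CL2) : iftL f = reL (𝓕⁻ f) := rfl

theorem norm_iftL_le (f : CL2) : ‖iftL f‖ ≤ ‖f‖ := by
  rw [iftL_apply]
  exact (norm_reL_le _).trans ((Lp.fourierTransformₗᵢ R3 ℂ).symm.norm_map f).le

theorem norm_iftL_mulC_le (m : ℝ →ᵇ ℝ) (f : L2R3) : ‖iftL (mulC m (ftL f))‖ ≤ ‖m‖ * ‖f‖ :=
  (norm_iftL_le _).trans ((norm_mulC_le m _).trans (by rw [norm_ftL]))

/-- The Fourier multiplier on real `L²` functions with symbol `m (2π|ξ|)`. -/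
noncomputable def mult : (ℝ →ᵇ ℝ) →L[ℝ] (L2R3 →L[ℝ] L2R3) :=
  LinearMap.mkContinuous
    { toFun := fun m => iftL.comp (((mulC m).restrictScalars ℝ).comp ftL)
      map_add' := fun m n => by
        ext1 f
        simp [mulC_add]
      map_smul' := fun c m => by
        ext1 f
        simp [mulC_smul] }
    1 fun m => by
      rw [one_mul]
      exact ContinuousLinearMap.opNorm_le_bound _ (norm_nonneg _) (norm_iftL_mulC_le m)

theorem mult_apply (m : ℝ →ᵇ ℝ) (f : L2R3) : mult m f = reL (multC m (ofRealL f)) := rfl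

theorem norm_mult_le (m : ℝ →ᵇ ℝ) (f : L2R3) : ‖mult m f‖ ≤ ‖m‖ * ‖f‖ := norm_iftL_mulC_le m f

theorem reL_multC (m : ℝ →ᵇ ℝ) (f : CL2) : reL (multC m f) = mult m (reL f) := by
  have hadd : ∀ f g : CL2, multC m (f + g) = multC m f + multC m g := fun f g => by
    simp only [multC, FourierTransform.fourier_add, map_add, FourierTransform.fourierInv_add]
  have hsm : ∀ (c : ℝ) (f : CL2), multC m (c • f) = c • multC m f := fun c f => by
    have h1 := FourierTransform.fourier_smul (c : ℂ) f
    have h2 := FourierTransform.fourierInv_smul (c : ℂ) (mulC m (𝓕 f))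
    have h3 : ∀ g : CL2, (c : ℂ) • g = c • g := fun g => Complex.coe_smul c g
    simp only [h3] at h1 h2
    have h4 : mulC m (c • 𝓕 f) = c • mulC m (𝓕 f) := by
      rw [← h3, ← h3, map_smul]
    simp only [multC, h1, h4, h2]
  rw [mult_apply, ofRealL_reL, hsm, hadd, multC_conjL]
  have h1 : reL (conjL (multC m f)) = reL (multC m f) := by
    apply Lp.ext
    filter_upwards [reL_ae (conjL (multC m f)), reL_ae (multC m f), conjL_ae (multC m f)]
      with x h1 h2 h3
    rw [h1, h2, h3, Complex.conj_re]
  rw [map_smul, map_add, h1, ← two_smul ℝ, smul_smul]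
  norm_num

theorem ofRealL_mult (m : ℝ →ᵇ ℝ) (f : L2R3) : ofRealL (mult m f) = multC m (ofRealL f) := by
  rw [mult_apply, ofRealL_reL, ← multC_conjL, conjL_ofRealL, ← two_smul ℝ, smul_smul]
  norm_num

theorem ftL_mult (m : ℝ →ᵇ ℝ) (f : L2R3) : ftL (mult m f) = mulC m (ftL f) := by
  rw [ftL_apply, ofRealL_mult, fourier_multC]; rfl

theorem mult_mul (m n : ℝ →ᵇ ℝ) (f : L2R3) : mult (m * n) f = mult m (mult n f) :=
  ftL_injective (by rw [ftL_mult, ftL_mult, ftL_mult, mulC_mul])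

theorem mult_one (f : L2R3) : mult 1 f = f :=
  ftL_injective (by rw [ftL_mult, mulC_one])

theorem mult_compIso (m : ℝ →ᵇ ℝ) (R : R3 ≃ₗᵢ[ℝ] R3) (f : L2R3) :
    mult m (compIso R f) = compIso R (mult m f) := by
  rw [mult_apply, mult_apply, compIso_ofRealL, multC_compIso, compIso_reL]

theorem mult_injective {m : ℝ →ᵇ ℝ} (hm : ∀ x, m x ≠ 0) : Function.Injective (mult m) := by
  intro f g h
  apply ftL_injective
  have h1 : mulC m (ftL f) = mulC m (ftL g) := by rw [← ftL_mult, ← ftL_mult, h]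
  apply Lp.ext
  filter_upwards [mulC_ae m (ftL f), mulC_ae m (ftL g)] with x h2 h3
  rw [h1, h3] at h2
  exact (mul_left_cancel₀ (Complex.ofReal_ne_zero.2 (hm _)) h2).symm

theorem inner_ofRealL (f g : L2R3) : ⟪ofRealL f, ofRealL g⟫_ℂ = ((⟪f, g⟫_ℝ : ℝ) : ℂ) := by
  rw [L2.inner_def, L2.inner_def, ← integral_complex_ofReal]
  refine integral_congr_ae ?_
  filter_upwards [ofRealL_ae f, ofRealL_ae g] with x h1 h2
  rw [h1, h2]
  simp

theorem mult_symm (m : ℝ →ᵇ ℝ) (f g : L2R3) : ⟪mult m f, g⟫_ℝ = ⟪f, mult m g⟫_ℝ := by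
  have h : ⟪ftL (mult m f), ftL g⟫_ℂ = ⟪ftL f, ftL (mult m g)⟫_ℂ := by
    rw [ftL_mult, ftL_mult, L2.inner_def, L2.inner_def]
    refine integral_congr_ae ?_
    filter_upwards [mulC_ae m (ftL f), mulC_ae m (ftL g)] with x h1 h2
    rw [h1, h2]
    simp only [RCLike.inner_apply, map_mul (starRingEnd ℂ), Complex.conj_ofReal]
    ring
  rw [ftL_apply, ftL_apply, ftL_apply, ftL_apply, Lp.inner_fourier_eq, Lp.inner_fourier_eq,
    inner_ofRealL, inner_ofRealL] at h
  exact_mod_cast h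

theorem continuousWithinAt_mult_apply {m : ℝ → ℝ →ᵇ ℝ} {s : Set ℝ} {t : ℝ} {C : ℝ}
    (hC : ∀ τ ∈ s, ‖m τ‖ ≤ C) (ht : t ∈ s)
    (hm : ∀ x, ContinuousWithinAt (fun τ => m τ x) s t) (f : L2R3) :
    ContinuousWithinAt (fun τ => mult (m τ) f) s t := by
  have key : ∀ τ, ‖mult (m τ) f - mult (m t) f‖ ^ 2 =
      ∫ ξ : R3, (m τ (2 * Real.pi * ‖ξ‖) - m t (2 * Real.pi * ‖ξ‖)) ^ 2 * ‖ftL f ξ‖ ^ 2 := by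
    intro τ
    have h1 : mult (m τ) f - mult (m t) f = mult (m τ - m t) f := by
      rw [map_sub]; rfl
    rw [h1, ← norm_ftL, ftL_mult, ← Complex.ofReal_inj]
    have h2 := inner_self_eq_norm_sq_to_K (𝕜 := ℂ) (mulC (m τ - m t) (ftL f))
    rw [Complex.ofReal_pow]
    refine h2.symm.trans ?_
    rw [L2.inner_def, ← integral_complex_ofReal]
    refine integral_congr_ae ?_
    filter_upwards [mulC_ae (m τ - m t) (ftL f)] with ξ h3
    simp only [h3]
    rw [inner_self_eq_norm_sq_to_K]
    norm_cast
    simp [mul_pow]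
    norm_cast
    simp
  have h2 : Tendsto (fun τ => ‖mult (m τ) f - mult (m t) f‖ ^ 2) (𝓝[s] t) (𝓝 0) := by
    simp_rw [key]
    have h0 : (0 : ℝ) = ∫ ξ : R3, (0 : ℝ) := by simp
    rw [h0]
    refine tendsto_integral_filter_of_dominated_convergence
      (fun ξ : R3 => (2 * C) ^ 2 * ‖ftL f ξ‖ ^ 2) ?_ ?_ ?_ ?_
    · refine Eventually.of_forall fun τ => ?_
      refine (Continuous.aestronglyMeasurable ?_).mul
        ((Lp.aestronglyMeasurable (ftL f)).norm.pow 2)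
      have := (m τ).continuous
      have := (m t).continuous
      fun_prop
    · filter_upwards [self_mem_nhdsWithin] with τ hτ
      refine Eventually.of_forall fun ξ => ?_
      rw [Real.norm_of_nonneg (by positivity), ← sq_abs (m τ _ - m t _)]
      gcongr
      have h3 := ((m τ).norm_coe_le_norm (2 * Real.pi * ‖ξ‖)).trans (hC τ hτ)
      have h4 := ((m t).norm_coe_le_norm (2 * Real.pi * ‖ξ‖)).trans (hC t ht)
      rw [Real.norm_eq_abs] at h3 h4
      exact (abs_sub _ _).trans (by linarith)
    · exact ((Lp.memLp (ftL f)).integrable_norm_pow (by norm_num)).const_mul _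
    · refine Eventually.of_forall fun ξ => ?_
      have h5 := ((hm (2 * Real.pi * ‖ξ‖)).sub_const (m t (2 * Real.pi * ‖ξ‖))).pow 2
      have h6 := h5.mul_const (‖ftL f ξ‖ ^ 2)
      simpa [ContinuousWithinAt] using h6
  rw [ContinuousWithinAt, tendsto_iff_norm_sub_tendsto_zero]
  have h3 := (Real.continuous_sqrt.tendsto 0).comp h2
  simpa [Function.comp_def] using h3

/-- The symbol `(1 + λ²)^{-1/2}`. -/
noncomputable def ji : ℝ →ᵇ ℝ :=
  BoundedContinuousFunction.ofNormedAddCommGroup (fun x => (√(1 + x ^ 2))⁻¹)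
    (Continuous.inv₀ (by fun_prop) fun x => by positivity) 1 fun x => by
      rw [Real.norm_of_nonneg (by positivity)]
      refine inv_le_one_of_one_le₀ ?_
      rw [Real.one_le_sqrt]; nlinarith [sq_nonneg x]

/-- The symbol `cos (λ t)`. -/
noncomputable def cS (t : ℝ) : ℝ →ᵇ ℝ :=
  BoundedContinuousFunction.ofNormedAddCommGroup (fun x => Real.cos (x * t)) (by fun_prop) 1
    fun x => Real.abs_cos_le_one _

/-- The function `sin (λ t) / λ`. -/
noncomputable def sig (t x : ℝ) : ℝ := t * Real.sinc (x * t)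

theorem mul_sig (t x : ℝ) : x * sig t x = Real.sin (x * t) := by
  unfold sig
  by_cases h : x * t = 0
  · rw [← mul_assoc, h]; simp
  · rw [Real.sinc_of_ne_zero h]; field_simp [left_ne_zero_of_mul h, right_ne_zero_of_mul h]

theorem sig_of_ne {x : ℝ} (hx : x ≠ 0) (t : ℝ) : sig t x = Real.sin (x * t) / x := by
  rw [← mul_sig]; field_simp

theorem sig_zero_right (t : ℝ) : sig t 0 = t := by simp [sig]

theorem abs_sig_le (t x : ℝ) : |sig t x| ≤ |t| := by
  rw [sig, abs_mul]
  exact mul_le_of_le_one_right (abs_nonneg t) (Real.abs_sinc_le_one _)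

theorem sig_add (a b x : ℝ) :
    sig (a + b) x = sig a x * Real.cos (x * b) + Real.cos (x * a) * sig b x := by
  by_cases hx : x = 0
  · subst hx; simp [sig_zero_right]
  · simp only [sig_of_ne hx, mul_add, Real.sin_add]; field_simp

theorem sig_neg (a x : ℝ) : sig (-a) x = -sig a x := by simp [sig, Real.sinc_neg]

theorem hasDerivAt_sig (t x : ℝ) : HasDerivAt (fun t => sig t x) (Real.cos (x * t)) t := by
  by_cases hx : x = 0
  · subst hx; simpa [sig_zero_right] using hasDerivAt_id' t
  · have h := (((hasDerivAt_id t).const_mul x).sin).div_const x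
    simp only [id, mul_one] at h
    rw [show (fun t => sig t x) = fun s => Real.sin (x * s) / x from
      funext fun s => sig_of_ne hx s]
    exact h.congr_deriv (by field_simp)

theorem hasDerivAt_cos_mul (t x : ℝ) :
    HasDerivAt (fun t => Real.cos (x * t)) (-(x ^ 2 * sig t x)) t := by
  have h := ((hasDerivAt_id t).const_mul x).cos
  simp only [id, mul_one] at h
  refine h.congr_deriv ?_
  rw [← mul_sig]; ring

theorem abs_jsig_le (t x : ℝ) : |√(1 + x ^ 2) * sig t x| ≤ 1 + |t| := by
  have h1 : √(1 + x ^ 2) ≤ 1 + |x| := by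
    rw [Real.sqrt_le_left (by positivity)]
    nlinarith [abs_nonneg x, sq_abs x]
  have h2 : |x| * |sig t x| ≤ 1 := by
    rw [← abs_mul, mul_sig]; exact Real.abs_sin_le_one _
  rw [abs_mul, abs_of_nonneg (Real.sqrt_nonneg _)]
  nlinarith [abs_sig_le t x, abs_nonneg (sig t x)]

/-- The symbol `(1 + λ²)^{1/2} sin (λ t) / λ`. -/
noncomputable def kS (t : ℝ) : ℝ →ᵇ ℝ :=
  BoundedContinuousFunction.ofNormedAddCommGroup (fun x => √(1 + x ^ 2) * sig t x)
    (by
      have := Real.continuous_sinc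
      unfold sig
      fun_prop) (1 + |t|) fun x => abs_jsig_le t x

theorem ji_apply (x : ℝ) : ji x = (√(1 + x ^ 2))⁻¹ := rfl
theorem cS_apply (t x : ℝ) : cS t x = Real.cos (x * t) := rfl
theorem kS_apply (t x : ℝ) : kS t x = √(1 + x ^ 2) * sig t x := rfl

theorem ji_pos (x : ℝ) : 0 < ji x := by rw [ji_apply]; positivity

theorem ji_sq (x : ℝ) : ji x ^ 2 = (1 + x ^ 2)⁻¹ := by
  rw [ji_apply, inv_pow, Real.sq_sqrt (by positivity)]

theorem ji_le_one (x : ℝ) : ji x ≤ 1 := by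
  have := ji_sq x
  have h : (1 + x ^ 2)⁻¹ ≤ 1 := inv_le_one_of_one_le₀ (by nlinarith [sq_nonneg x])
  nlinarith [ji_pos x]

theorem norm_ji_le : ‖ji‖ ≤ 1 :=
  (BoundedContinuousFunction.norm_le zero_le_one).2 fun x => by
    rw [Real.norm_of_nonneg (ji_pos x).le]; exact ji_le_one x

theorem norm_cS_le (t : ℝ) : ‖cS t‖ ≤ 1 :=
  (BoundedContinuousFunction.norm_le zero_le_one).2 fun _ => Real.abs_cos_le_one _

theorem norm_kS_le (t : ℝ) : ‖kS t‖ ≤ 1 + |t| :=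
  (BoundedContinuousFunction.norm_le (by positivity)).2 fun x => abs_jsig_le t x

theorem ji_mul_kS_apply (t x : ℝ) : ji x * kS t x = sig t x := by
  rw [ji_apply, kS_apply]
  have : √(1 + x ^ 2) ≠ 0 := by positivity
  field_simp

theorem cS_zero : cS 0 = 1 := by ext x; simp [cS_apply]
theorem kS_zero : kS 0 = 0 := by ext x; simp [kS_apply, sig]
theorem cS_neg (t : ℝ) : cS (-t) = cS t := by ext x; simp [cS_apply]
theorem kS_neg (t : ℝ) : kS (-t) = -kS t := by ext x; simp [kS_apply, sig_neg]

theorem one_sub_ji_sq (x : ℝ) : 1 - ji x ^ 2 = x ^ 2 * ji x ^ 2 := by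
  rw [ji_sq]; field_simp; ring

theorem one_sub_mul_kS_mul_kS (a b x : ℝ) :
    (1 - ji x ^ 2) * (kS a x * kS b x) = Real.sin (x * a) * Real.sin (x * b) := by
  rw [one_sub_ji_sq, ← mul_sig, ← mul_sig, ← ji_mul_kS_apply, ← ji_mul_kS_apply]; ring

theorem cS_add (a b : ℝ) : cS (a + b) = cS a * cS b - (1 - ji ^ 2) * (kS a * kS b) := by
  ext x
  have h := one_sub_mul_kS_mul_kS a b x
  simp only [BoundedContinuousFunction.coe_sub, BoundedContinuousFunction.coe_mul, Pi.sub_apply,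
    Pi.mul_apply, BoundedContinuousFunction.coe_one, Pi.one_apply,
    BoundedContinuousFunction.coe_pow, Pi.pow_apply]
  rw [h, cS_apply, cS_apply, cS_apply, mul_add, Real.cos_add]

theorem kS_add (a b : ℝ) : kS (a + b) = kS a * cS b + cS a * kS b := by
  ext x
  simp only [BoundedContinuousFunction.coe_add, BoundedContinuousFunction.coe_mul, Pi.add_apply,
    Pi.mul_apply, cS_apply, kS_apply, sig_add]
  ring

theorem cS_sq_add (t : ℝ) : cS t * cS t + (1 - ji ^ 2) * (kS t * kS t) = 1 := by
  have h := cS_add t (-t)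
  rw [add_neg_cancel, cS_zero, cS_neg, kS_neg] at h
  refine Eq.trans ?_ h.symm
  ring

theorem hasDerivAt_symbol {m m' : ℝ → ℝ →ᵇ ℝ} {m'' : ℝ → ℝ → ℝ} {t₀ C : ℝ}
    (h1 : ∀ t x, HasDerivAt (fun t => m t x) (m' t x) t)
    (h2 : ∀ t x, HasDerivAt (fun t => m' t x) (m'' t x) t)
    (hC : ∀ t ∈ Icc (t₀ - 1) (t₀ + 1), ∀ x, |m'' t x| ≤ C) :
    HasDerivAt m (m' t₀) t₀ := by
  have hC0 : 0 ≤ C := (abs_nonneg _).trans (hC t₀ ⟨by linarith, by linarith⟩ 0)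
  have lip : ∀ t ∈ Icc (t₀ - 1) (t₀ + 1), ∀ x, |m' t x - m' t₀ x| ≤ C * |t - t₀| := by
    intro t ht x
    exact (convex_Icc (t₀ - 1) (t₀ + 1)).norm_image_sub_le_of_norm_hasDerivWithin_le
      (fun s _ => (h2 s x).hasDerivWithinAt) (fun s hs => hC s hs x)
      ⟨by linarith, by linarith⟩ ht
  have key : ∀ t ∈ Icc (t₀ - 1) (t₀ + 1),
      ‖m t - m t₀ - (t - t₀) • m' t₀‖ ≤ C * |t - t₀| * |t - t₀| := by
    intro t ht
    refine (BoundedContinuousFunction.norm_le (by positivity)).2 fun x => ?_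
    have hsub : uIcc t₀ t ⊆ Icc (t₀ - 1) (t₀ + 1) :=
      (convex_Icc (t₀ - 1) (t₀ + 1)).ordConnected.uIcc_subset ⟨by linarith, by linarith⟩ ht
    have h := (convex_uIcc t₀ t).norm_image_sub_le_of_norm_hasDerivWithin_le
      (f := fun s => m s x - s * m' t₀ x) (f' := fun s => m' s x - m' t₀ x) (C := C * |t - t₀|)
      (fun s _ => by
        have := ((h1 s x).sub ((hasDerivAt_id s).mul_const (m' t₀ x))).hasDerivWithinAt
          (s := uIcc t₀ t)
        simpa only [one_mul] using! this)
      (fun s hs => (lip s (hsub hs) x).trans (by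
        gcongr ?_ * ?_
        exact abs_sub_left_of_mem_uIcc hs)) left_mem_uIcc right_mem_uIcc
    simp only [BoundedContinuousFunction.coe_sub, BoundedContinuousFunction.coe_smul,
      Pi.sub_apply, smul_eq_mul]
    refine Eq.trans_le (congrArg _ ?_) h
    ring
  rw [hasDerivAt_iff_isLittleO]
  refine Asymptotics.IsBigO.trans_isLittleO (g := fun t => (t - t₀) * (t - t₀)) ?_ ?_
  · refine Asymptotics.IsBigO.of_bound C ?_
    filter_upwards [Icc_mem_nhds (show t₀ - 1 < t₀ by linarith) (show t₀ < t₀ + 1 by linarith)]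
      with t ht
    rw [norm_mul, Real.norm_eq_abs, ← mul_assoc]
    exact key t ht
  · have : (fun t : ℝ => t - t₀) =o[𝓝 t₀] fun _ => (1 : ℝ) := by
      rw [Asymptotics.isLittleO_one_iff]
      exact (continuous_id.sub continuous_const).tendsto' _ _ (by simp)
    simpa using this.mul_isBigO (Asymptotics.isBigO_refl (fun t : ℝ => t - t₀) (𝓝 t₀))

theorem abs_ji_sq_mul_sq_le (x : ℝ) : |ji x ^ 2 * x ^ 2| ≤ 1 := by
  rw [mul_comm, ← one_sub_ji_sq, abs_le]
  constructor <;> nlinarith [ji_pos x, ji_le_one x]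

theorem hasDerivAt_ji_sq_cS (t : ℝ) :
    HasDerivAt (fun t => ji ^ 2 * cS t) (-((1 - ji ^ 2) * (ji * kS t))) t := by
  refine hasDerivAt_symbol (m' := fun t => -((1 - ji ^ 2) * (ji * kS t)))
    (m'' := fun t x => -(ji x ^ 2 * x ^ 2 * Real.cos (x * t))) (C := 1) ?_ ?_ ?_
  · intro t x
    have h := (hasDerivAt_cos_mul t x).const_mul (ji x ^ 2)
    refine h.congr_deriv ?_
    simp only [BoundedContinuousFunction.coe_neg, BoundedContinuousFunction.coe_mul, Pi.neg_apply,
      Pi.mul_apply, BoundedContinuousFunction.coe_sub, Pi.sub_apply,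
      BoundedContinuousFunction.coe_one, Pi.one_apply, BoundedContinuousFunction.coe_pow,
      Pi.pow_apply, ji_mul_kS_apply]
    rw [one_sub_ji_sq]; ring
  · intro t x
    have h := ((hasDerivAt_sig t x).const_mul (1 - ji x ^ 2)).neg
    have e : (fun t => (-((1 - ji ^ 2) * (ji * kS t)) : ℝ →ᵇ ℝ) x) =
        -fun t => (1 - ji x ^ 2) * sig t x := by
      ext t
      simp only [BoundedContinuousFunction.coe_neg, BoundedContinuousFunction.coe_mul,
        Pi.neg_apply, Pi.mul_apply, BoundedContinuousFunction.coe_sub, Pi.sub_apply,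
        BoundedContinuousFunction.coe_one, Pi.one_apply, BoundedContinuousFunction.coe_pow,
        Pi.pow_apply, ji_mul_kS_apply]
    rw [e]
    refine h.congr_deriv ?_
    rw [one_sub_ji_sq]; ring
  · intro t _ x
    rw [abs_neg, abs_mul]
    exact mul_le_one₀ (abs_ji_sq_mul_sq_le x) (abs_nonneg _) (Real.abs_cos_le_one _)

theorem hasDerivAt_ji_sq_kS (t : ℝ) :
    HasDerivAt (fun t => ji ^ 2 * kS t) (ji * cS t) t := by
  refine hasDerivAt_symbol (m' := fun t => ji * cS t)
    (m'' := fun t x => -(ji x * x * Real.sin (x * t))) (C := 1) ?_ ?_ ?_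
  · intro t x
    have h := (hasDerivAt_sig t x).const_mul (ji x)
    have e : (fun t => (ji ^ 2 * kS t) x) = fun t => ji x * sig t x := by
      ext t
      simp only [BoundedContinuousFunction.coe_mul, Pi.mul_apply,
        BoundedContinuousFunction.coe_pow, Pi.pow_apply, ← ji_mul_kS_apply]
      ring
    rw [e]
    exact h
  · intro t x
    refine ((hasDerivAt_cos_mul t x).const_mul (ji x)).congr_deriv ?_
    rw [← mul_sig]; ring
  · intro t _ x
    rw [abs_neg, abs_mul]
    refine mul_le_one₀ ?_ (abs_nonneg _) (Real.abs_sin_le_one _)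
    rw [abs_le_one_iff_mul_self_le_one]
    have := (abs_le.1 (abs_ji_sq_mul_sq_le x)).2
    linarith [this]

theorem hasDerivAt_ji_sq_kS_mul_kS (c t : ℝ) :
    HasDerivAt (fun t => ji ^ 2 * (kS (c + t) * kS t))
      (ji * (cS (c + t) * kS t) + ji * (kS (c + t) * cS t)) t := by
  have hs : ∀ t x, HasDerivAt (fun t => sig (c + t) x) (Real.cos (x * (c + t))) t := fun t x => by
    simpa using (hasDerivAt_sig (c + t) x).comp_const_add c t
  have hc : ∀ t x, HasDerivAt (fun t => Real.cos (x * (c + t))) (-(x ^ 2 * sig (c + t) x)) t :=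
    fun t x => by simpa using (hasDerivAt_cos_mul (c + t) x).comp_const_add c t
  refine hasDerivAt_symbol
    (m' := fun t => ji * (cS (c + t) * kS t) + ji * (kS (c + t) * cS t))
    (m'' := fun t x => 2 * (Real.cos (x * (c + t)) * Real.cos (x * t))
      - 2 * (Real.sin (x * (c + t)) * Real.sin (x * t))) (C := 4) ?_ ?_ ?_
  · intro t x
    have e : (fun t => (ji ^ 2 * (kS (c + t) * kS t)) x) = fun t => sig (c + t) x * sig t x := by
      ext t
      simp only [BoundedContinuousFunction.coe_mul, Pi.mul_apply,
        BoundedContinuousFunction.coe_pow, Pi.pow_apply, ← ji_mul_kS_apply]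
      ring
    rw [e]
    refine ((hs t x).mul (hasDerivAt_sig t x)).congr_deriv ?_
    simp only [BoundedContinuousFunction.coe_add, BoundedContinuousFunction.coe_mul,
      Pi.add_apply, Pi.mul_apply, ← ji_mul_kS_apply, cS_apply]
    ring
  · intro t x
    have e : (fun t => (ji * (cS (c + t) * kS t) + ji * (kS (c + t) * cS t)) x) =
        fun t => Real.cos (x * (c + t)) * sig t x + sig (c + t) x * Real.cos (x * t) := by
      ext t
      simp only [BoundedContinuousFunction.coe_add, BoundedContinuousFunction.coe_mul,
        Pi.add_apply, Pi.mul_apply, ← ji_mul_kS_apply, cS_apply]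
      ring
    rw [e]
    refine (((hc t x).mul (hasDerivAt_sig t x)).add
      ((hs t x).mul (hasDerivAt_cos_mul t x))).congr_deriv ?_
    rw [← mul_sig, ← mul_sig]; ring
  · intro t _ x
    have b : ∀ p q : ℝ, |p| ≤ 1 → |q| ≤ 1 → |p * q| ≤ 1 := fun p q hp hq => by
      rw [abs_mul]; exact mul_le_one₀ hp (abs_nonneg _) hq
    have h1 := abs_le.1 (b _ _ (Real.abs_cos_le_one (x * (c + t))) (Real.abs_cos_le_one (x * t)))
    have h2 := abs_le.1 (b _ _ (Real.abs_sin_le_one (x * (c + t))) (Real.abs_sin_le_one (x * t)))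
    rw [abs_le]; constructor <;> linarith [h1.1, h1.2, h2.1, h2.2]

theorem memLp_ji_sq : MemLp (fun ξ : R3 => ji (2 * Real.pi * ‖ξ‖) ^ 2) 2 volume := by
  refine (memLp_inv_one_add_normSq_pow 1 (k := 1) le_rfl).mono
    (Continuous.aestronglyMeasurable ?_) (Eventually.of_forall fun ξ => ?_)
  · have := ji.continuous
    fun_prop
  · rw [ji_sq, pow_one, Real.norm_of_nonneg (by positivity), Real.norm_of_nonneg (by positivity),
      one_div]
    gcongr
    have h : 1 ≤ 2 * Real.pi := by linarith [Real.pi_gt_three]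
    nlinarith [norm_nonneg ξ]

/-- The norm of the embedding of `H²(ℝ³)` into bounded functions. -/
noncomputable def sobConst : ℝ := ‖(memLp_ji_sq.toLp _ : L2R3)‖

theorem sobConst_nonneg : 0 ≤ sobConst := norm_nonneg _

/-- The function `(1 + |2πξ|²)⁻¹ g(ξ)`. -/
noncomputable def sobFun (g : CL2) (ξ : R3) : ℂ := ((ji (2 * Real.pi * ‖ξ‖) ^ 2 : ℝ) : ℂ) * g ξ

theorem continuous_ji_sq : Continuous fun ξ : R3 => ji (2 * Real.pi * ‖ξ‖) ^ 2 := by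
  have := ji.continuous
  fun_prop

theorem stronglyMeasurable_sobFun (g : CL2) : StronglyMeasurable (sobFun g) :=
  (Complex.continuous_ofReal.comp continuous_ji_sq).stronglyMeasurable.mul
    (Lp.stronglyMeasurable g)

theorem mulC_ji_sq_ae (g : CL2) : ⇑(mulC (ji ^ 2) g) =ᵐ[volume] sobFun g := mulC_ae _ g

theorem integrable_sobFun (g : CL2) : Integrable (sobFun g) :=
  memLp_ji_sq.ofReal.integrable_mul (Lp.memLp g)

theorem integral_norm_sobFun_le (g : CL2) : ∫ ξ, ‖sobFun g ξ‖ ≤ sobConst * ‖g‖ := by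
  have h1 : ‖((Lp.memLp g).norm.toLp _ : L2R3)‖ = ‖g‖ := by
    rw [Lp.norm_toLp, eLpNorm_norm, Lp.norm_def]
  have h2 := real_inner_le_norm (memLp_ji_sq.toLp _ : L2R3) ((Lp.memLp g).norm.toLp _ : L2R3)
  rw [h1, L2.inner_def] at h2
  refine Eq.trans_le (integral_congr_ae ?_) h2
  filter_upwards [memLp_ji_sq.coeFn_toLp, (Lp.memLp g).norm.coeFn_toLp] with ξ h3 h4
  rw [h3, h4, sobFun, norm_mul, Complex.norm_real, Real.norm_of_nonneg (by positivity)]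
  simp [mul_comm]

/-- The pointwise value at `x` of `(1 - Δ)⁻¹ a`, as a complex number. -/
noncomputable def evC (x : R3) (a : L2R3) : ℂ := 𝓕⁻ (sobFun (ftL a)) x

theorem continuous_evC (a : L2R3) : Continuous fun x => evC x a :=
  continuous_fourierInv_of_integrable (integrable_sobFun _)

theorem fourierInv_congr_ae {f g : R3 → ℂ} (h : f =ᵐ[volume] g) : 𝓕⁻ f = 𝓕⁻ g := by
  ext x
  rw [Real.fourierInv_eq, Real.fourierInv_eq]
  refine integral_congr_ae ?_
  filter_upwards [h] with ξ hξ
  rw [hξ]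

theorem ofRealL_mult_ji_sq_ae (a : L2R3) :
    ⇑(ofRealL (mult (ji ^ 2) a)) =ᵐ[volume] fun x => evC x a := by
  have hi : Integrable (mulC (ji ^ 2) (ftL a)) :=
    (integrable_sobFun _).congr (mulC_ji_sq_ae _).symm
  have h := Lp_fourierInv_ae_eq _ hi
  rw [fourierInv_congr_ae (mulC_ji_sq_ae (ftL a))] at h
  rw [ofRealL_mult]
  exact h

theorem evC_im (x : R3) (a : L2R3) : (evC x a).im = 0 := by
  have h : (fun x => (evC x a).im) =ᵐ[volume] fun _ => (0 : ℝ) := by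
    filter_upwards [ofRealL_mult_ji_sq_ae a, ofRealL_ae (mult (ji ^ 2) a)] with x h1 h2
    rw [← h1, h2, Complex.ofReal_im]
  exact congrFun (Continuous.ae_eq_iff_eq volume (Complex.continuous_im.comp (continuous_evC a))
    continuous_const |>.1 h) x

theorem norm_evC_le (x : R3) (a : L2R3) : ‖evC x a‖ ≤ sobConst * ‖a‖ := by
  rw [evC, Real.fourierInv_eq]
  refine (norm_integral_le_integral_norm _).trans ?_
  simp only [Circle.norm_smul]
  exact (integral_norm_sobFun_le _).trans (by rw [norm_ftL])

theorem integrable_fourierInv_integrand (x : R3) (g : CL2) :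
    Integrable fun ξ => Real.fourierChar (inner ℝ ξ x) • sobFun g ξ := by
  refine (integrable_sobFun g).mono ?_ (Eventually.of_forall fun ξ => by rw [Circle.norm_smul])
  have h : Continuous fun ξ : R3 => ((Real.fourierChar (inner ℝ ξ x) : Circle) : ℂ) := by
    fun_prop
  exact h.aestronglyMeasurable.mul (integrable_sobFun g).aestronglyMeasurable

/-- The pointwise value at `x` of `(1 - Δ)⁻¹ a`. -/
noncomputable def ev (x : R3) : L2R3 →L[ℝ] ℝ :=
  LinearMap.mkContinuous
    { toFun := fun a => (evC x a).re
      map_add' := fun a b => by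
        rw [← Complex.add_re, evC, evC, evC, Real.fourierInv_eq, Real.fourierInv_eq,
          Real.fourierInv_eq, ← integral_add (integrable_fourierInv_integrand x _)
            (integrable_fourierInv_integrand x _)]
        congr 1
        refine integral_congr_ae ?_
        filter_upwards [Lp.coeFn_add (ftL a) (ftL b)] with ξ hξ
        rw [← smul_add, sobFun, sobFun, sobFun, map_add, hξ, Pi.add_apply, mul_add]
      map_smul' := fun c a => by
        rw [RingHom.id_apply, smul_eq_mul, ← Complex.re_ofReal_mul, evC, evC, Real.fourierInv_eq,
          Real.fourierInv_eq, ← integral_const_mul]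
        congr 1
        refine integral_congr_ae ?_
        filter_upwards [Lp.coeFn_smul c (ftL a)] with ξ hξ
        rw [sobFun, sobFun, map_smul, hξ, Pi.smul_apply, Circle.smul_def, Circle.smul_def]
        simp only [Complex.real_smul, smul_eq_mul]
        ring }
    sobConst fun a => by
      exact (Complex.abs_re_le_norm _).trans (norm_evC_le x a)

theorem evC_eq (x : R3) (a : L2R3) : evC x a = (ev x a : ℂ) :=
  Complex.ext rfl (evC_im x a)

theorem abs_ev_le (x : R3) (a : L2R3) : |ev x a| ≤ sobConst * ‖a‖ :=
  (Complex.abs_re_le_norm _).trans (norm_evC_le x a)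

theorem continuous_ev (a : L2R3) : Continuous fun x => ev x a :=
  Complex.continuous_re.comp (continuous_evC a)

theorem mult_ji_sq_ae (a : L2R3) : ⇑(mult (ji ^ 2) a) =ᵐ[volume] fun x => ev x a := by
  filter_upwards [ofRealL_mult_ji_sq_ae a, ofRealL_ae (mult (ji ^ 2) a)] with x h1 h2
  rw [evC_eq, h2] at h1
  exact_mod_cast h1

theorem ev_eq_of_ae {a : L2R3} {f : R3 → ℝ} (hf : Continuous f)
    (h : ⇑(mult (ji ^ 2) a) =ᵐ[volume] f) (x : R3) : ev x a = f x :=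
  congrFun ((Continuous.ae_eq_iff_eq volume (continuous_ev a) hf).1
    ((mult_ji_sq_ae a).symm.trans h)) x

theorem mult_ji_pow_injective (k : ℕ) : Function.Injective (mult (ji ^ k)) :=
  mult_injective fun x => by
    rw [BoundedContinuousFunction.coe_pow, Pi.pow_apply]
    exact pow_ne_zero _ (ji_pos x).ne'

theorem ev_injective {a b : L2R3} (h : ∀ x, ev x a = ev x b) : a = b := by
  refine mult_ji_pow_injective 2 (Lp.ext ?_)
  filter_upwards [mult_ji_sq_ae a, mult_ji_sq_ae b] with x h1 h2
  rw [h1, h2, h]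

theorem lintegral_conv_sq_le {f g : R3 → ℝ≥0∞} (hf : Measurable f) (hg : Measurable g) :
    ∫⁻ ξ, (∫⁻ η, f η * g (ξ - η)) ^ 2 ≤ (∫⁻ η, f η ^ 2) * (∫⁻ η, g η) ^ 2 := by
  have h1 : ∀ ξ, (∫⁻ η, f η * g (ξ - η)) ^ 2 ≤ (∫⁻ η, f η ^ 2 * g (ξ - η)) * ∫⁻ η, g η := by
    intro ξ
    have hgξ : Measurable fun η => g (ξ - η) := hg.comp (measurable_const.sub measurable_id)
    have h := ENNReal.lintegral_mul_le_Lp_mul_Lq (volume : Measure R3)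
      (Real.HolderConjugate.two_two) (f := fun η => f η * g (ξ - η) ^ (1 / 2 : ℝ))
      (g := fun η => g (ξ - η) ^ (1 / 2 : ℝ)) (hf.mul (hgξ.pow_const _)).aemeasurable
      (hgξ.pow_const _).aemeasurable
    have e0 : ∀ c : ℝ≥0∞, (c ^ (1 / 2 : ℝ)) ^ (2 : ℝ) = c := fun c => by
      rw [← ENNReal.rpow_mul]; norm_num
    have e1 : ∀ c : ℝ≥0∞, c ^ (1 / 2 : ℝ) * c ^ (1 / 2 : ℝ) = c := fun c => by
      rw [← ENNReal.rpow_add_of_nonneg _ _ (by norm_num) (by norm_num)]; norm_num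
    have e2 : ∀ c d : ℝ≥0∞, (c * d ^ (1 / 2 : ℝ)) ^ (2 : ℝ) = c ^ 2 * d := fun c d => by
      rw [ENNReal.mul_rpow_of_nonneg _ _ (by norm_num), e0]; norm_num
    simp only [Pi.mul_apply, mul_assoc, e0, e1, e2] at h
    rw [lintegral_sub_left_eq_self (fun η => g η) ξ] at h
    calc (∫⁻ η, f η * g (ξ - η)) ^ 2
        ≤ ((∫⁻ η, f η ^ 2 * g (ξ - η)) ^ (1 / 2 : ℝ) * (∫⁻ η, g η) ^ (1 / 2 : ℝ)) ^ 2 := by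
          gcongr
      _ = _ := by
          rw [← ENNReal.rpow_natCast, ENNReal.mul_rpow_of_nonneg _ _ (by norm_num)]
          simp only [Nat.cast_ofNat, e0]
  calc ∫⁻ ξ, (∫⁻ η, f η * g (ξ - η)) ^ 2
      ≤ ∫⁻ ξ, (∫⁻ η, f η ^ 2 * g (ξ - η)) * ∫⁻ η, g η := lintegral_mono h1
    _ = (∫⁻ ξ, ∫⁻ η, f η ^ 2 * g (ξ - η)) * ∫⁻ η, g η := by
        refine lintegral_mul_const _ ?_
        exact Measurable.lintegral_prod_right' (f := fun p : R3 × R3 => f p.2 ^ 2 * g (p.1 - p.2))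
          (((hf.comp measurable_snd).pow_const 2).mul
            (hg.comp (measurable_fst.sub measurable_snd)))
    _ = (∫⁻ η, ∫⁻ ξ, f η ^ 2 * g (ξ - η)) * ∫⁻ η, g η := by
        rw [lintegral_lintegral_swap]
        exact (((hf.comp measurable_snd).pow_const 2).mul
            (hg.comp (measurable_fst.sub measurable_snd))).aemeasurable
    _ = (∫⁻ η, f η ^ 2 * ∫⁻ ξ, g ξ) * ∫⁻ η, g η := by
        congr 2
        ext η
        rw [lintegral_const_mul _ (show Measurable fun ξ => g (ξ - η) from
            hg.comp (measurable_id.sub measurable_const)),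
          lintegral_sub_right_eq_self (fun η => g η) η]
    _ = _ := by rw [lintegral_mul_const _ (hf.pow_const 2), sq (∫⁻ η, g η), mul_assoc]

theorem lintegral_conv_sq_le' {f g : R3 → ℝ≥0∞} (hf : Measurable f) (hg : Measurable g) :
    ∫⁻ ξ, (∫⁻ η, g η * f (ξ - η)) ^ 2 ≤ (∫⁻ η, f η ^ 2) * (∫⁻ η, g η) ^ 2 := by
  refine Eq.trans_le (lintegral_congr fun ξ => ?_) (lintegral_conv_sq_le hf hg)
  congr 1
  rw [← lintegral_sub_left_eq_self (fun η => f η * g (ξ - η)) ξ]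
  refine lintegral_congr fun η => ?_
  rw [sub_sub_cancel, mul_comm]

open Convolution in
theorem enorm_weight_mul_conv_le (p q : CL2) (ξ : R3) :
    ‖(((ji (2 * Real.pi * ‖ξ‖) ^ 2)⁻¹ : ℝ) : ℂ) *
        (sobFun p ⋆[ContinuousLinearMap.mul ℂ ℂ] sobFun q) ξ‖ₑ ≤
      2 * ((∫⁻ η, ‖p η‖ₑ * ‖sobFun q (ξ - η)‖ₑ) + ∫⁻ η, ‖sobFun p η‖ₑ * ‖q (ξ - η)‖ₑ) := by
  have hw : ∀ ζ : R3, (ji (2 * Real.pi * ‖ζ‖) ^ 2)⁻¹ = 1 + (2 * Real.pi * ‖ζ‖) ^ 2 := fun ζ => by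
    rw [ji_sq, inv_inv]
  have hcancel : ∀ (g : CL2) (ζ : R3),
      (1 + (2 * Real.pi * ‖ζ‖) ^ 2) * ‖sobFun g ζ‖ = ‖g ζ‖ := fun g ζ => by
    rw [sobFun, norm_mul, Complex.norm_real, Real.norm_of_nonneg (by positivity), ← mul_assoc,
      ← hw, inv_mul_cancel₀ (pow_pos (ji_pos _) 2).ne', one_mul]
  rw [enorm_mul, convolution_def]
  have m1 : Measurable fun η => ‖p η‖ₑ * ‖sobFun q (ξ - η)‖ₑ :=
    (Lp.stronglyMeasurable p).measurable.enorm.mul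
      ((stronglyMeasurable_sobFun q).measurable.comp (measurable_const.sub measurable_id)).enorm
  calc _ ≤ ‖(((ji (2 * Real.pi * ‖ξ‖) ^ 2)⁻¹ : ℝ) : ℂ)‖ₑ *
        ∫⁻ η, ‖sobFun p η * sobFun q (ξ - η)‖ₑ := by
        gcongr
        exact enorm_integral_le_lintegral_enorm _
    _ = ∫⁻ η, ‖(((ji (2 * Real.pi * ‖ξ‖) ^ 2)⁻¹ : ℝ) : ℂ)‖ₑ * ‖sobFun p η * sobFun q (ξ - η)‖ₑ := by
        rw [lintegral_const_mul]
        exact ((stronglyMeasurable_sobFun p).measurable.mul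
          ((stronglyMeasurable_sobFun q).measurable.comp
            (measurable_const.sub measurable_id))).enorm
    _ ≤ ∫⁻ η, 2 * (‖p η‖ₑ * ‖sobFun q (ξ - η)‖ₑ + ‖sobFun p η‖ₑ * ‖q (ξ - η)‖ₑ) := by
        refine lintegral_mono fun η => ?_
        rw [← enorm_mul, ← enorm_mul, ← enorm_mul, ← ofReal_norm, ← ofReal_norm, ← ofReal_norm,
          ← ENNReal.ofReal_add (norm_nonneg _) (norm_nonneg _)]
        refine (ENNReal.ofReal_le_ofReal (q := 2 * (‖p η * sobFun q (ξ - η)‖ +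
          ‖sobFun p η * q (ξ - η)‖)) ?_).trans
          (by rw [ENNReal.ofReal_mul (by norm_num), ENNReal.ofReal_ofNat])
        rw [norm_mul, norm_mul, norm_mul, norm_mul, Complex.norm_real,
          Real.norm_of_nonneg (by positivity), hw, ← hcancel p η, ← hcancel q (ξ - η)]
        have h1 : ‖ξ‖ ≤ ‖η‖ + ‖ξ - η‖ := by
          simpa using norm_add_le η (ξ - η)
        have h2 : ‖ξ‖ ^ 2 ≤ 2 * ‖η‖ ^ 2 + 2 * ‖ξ - η‖ ^ 2 := by
          nlinarith [norm_nonneg ξ, sq_nonneg (‖η‖ - ‖ξ - η‖)]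
        have h3 : 1 + (2 * Real.pi * ‖ξ‖) ^ 2 ≤
            2 * ((1 + (2 * Real.pi * ‖η‖) ^ 2) + (1 + (2 * Real.pi * ‖ξ - η‖) ^ 2)) := by
          have := mul_le_mul_of_nonneg_left h2 (sq_nonneg (2 * Real.pi))
          nlinarith
        have h4 := mul_le_mul_of_nonneg_right h3
          (mul_nonneg (norm_nonneg (sobFun p η)) (norm_nonneg (sobFun q (ξ - η))))
        linarith
    _ = _ := by
        rw [lintegral_const_mul' _ _ (by simp), lintegral_add_left m1]

open Convolution in
theorem exists_memLp_weight_mul_conv (p q : CL2) :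
    ∃ h : MemLp (fun ξ => (((ji (2 * Real.pi * ‖ξ‖) ^ 2)⁻¹ : ℝ) : ℂ) *
        (sobFun p ⋆[ContinuousLinearMap.mul ℂ ℂ] sobFun q) ξ) 2 volume,
      ‖(h.toLp _ : CL2)‖ ≤ 4 * sobConst * (‖p‖ * ‖q‖) := by
  set F : R3 → ℂ := fun ξ => (((ji (2 * Real.pi * ‖ξ‖) ^ 2)⁻¹ : ℝ) : ℂ) *
        (sobFun p ⋆[ContinuousLinearMap.mul ℂ ℂ] sobFun q) ξ with hF
  have mF : AEStronglyMeasurable F volume := by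
    refine AEStronglyMeasurable.mul (Continuous.aestronglyMeasurable ?_)
      ((integrable_sobFun p).integrable_convolution _ (integrable_sobFun q)).aestronglyMeasurable
    exact Complex.continuous_ofReal.comp
      (continuous_ji_sq.inv₀ fun ξ => (pow_pos (ji_pos _) 2).ne')
  have l2 : ∀ g : CL2, ∫⁻ η, ‖g η‖ₑ ^ 2 = ENNReal.ofReal (‖g‖ ^ 2) := fun g => by
    have h := eLpNorm_eq_lintegral_rpow_enorm_toReal (f := (g : R3 → ℂ)) (μ := volume)
      (p := 2) two_ne_zero ENNReal.ofNat_ne_top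
    rw [← Lp.enorm_def] at h
    rw [ENNReal.ofReal_pow (norm_nonneg _), ofReal_norm, h, ← ENNReal.rpow_natCast,
      ← ENNReal.rpow_mul]
    norm_num
  have l1 : ∀ g : CL2, ∫⁻ η, ‖sobFun g η‖ₑ ≤ ENNReal.ofReal (sobConst * ‖g‖) := fun g => by
    rw [← ofReal_integral_norm_eq_lintegral_enorm (integrable_sobFun g)]
    exact ENNReal.ofReal_le_ofReal (integral_norm_sobFun_le g)
  have mm : ∀ g : CL2, Measurable fun η => ‖g η‖ₑ := fun g =>
    (Lp.stronglyMeasurable g).measurable.enorm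
  have ms : ∀ g : CL2, Measurable fun η => ‖sobFun g η‖ₑ := fun g =>
    (stronglyMeasurable_sobFun g).measurable.enorm
  set A : R3 → ℝ≥0∞ := fun ξ => ∫⁻ η, ‖p η‖ₑ * ‖sobFun q (ξ - η)‖ₑ with hA
  set B : R3 → ℝ≥0∞ := fun ξ => ∫⁻ η, ‖sobFun p η‖ₑ * ‖q (ξ - η)‖ₑ with hB
  have iA : ∫⁻ ξ, A ξ ^ 2 ≤ ENNReal.ofReal ((sobConst * (‖p‖ * ‖q‖)) ^ 2) := by
    refine (lintegral_conv_sq_le (mm p) (ms q)).trans ?_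
    calc _ ≤ ENNReal.ofReal (‖p‖ ^ 2) * ENNReal.ofReal (sobConst * ‖q‖) ^ 2 := by
          rw [l2]; gcongr; exact l1 q
      _ = _ := by
          rw [← ENNReal.ofReal_pow (mul_nonneg sobConst_nonneg (norm_nonneg _)),
            ← ENNReal.ofReal_mul (by positivity)]
          congr 1; ring
  have iB : ∫⁻ ξ, B ξ ^ 2 ≤ ENNReal.ofReal ((sobConst * (‖p‖ * ‖q‖)) ^ 2) := by
    refine (lintegral_conv_sq_le' (mm q) (ms p)).trans ?_
    calc _ ≤ ENNReal.ofReal (‖q‖ ^ 2) * ENNReal.ofReal (sobConst * ‖p‖) ^ 2 := by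
          rw [l2]; gcongr; exact l1 p
      _ = _ := by
          rw [← ENNReal.ofReal_pow (mul_nonneg sobConst_nonneg (norm_nonneg _)),
            ← ENNReal.ofReal_mul (by positivity)]
          congr 1; ring
  have mA : Measurable A := Measurable.lintegral_prod_right'
    (f := fun z : R3 × R3 => ‖p z.2‖ₑ * ‖sobFun q (z.1 - z.2)‖ₑ)
    (((mm p).comp measurable_snd).mul ((ms q).comp (measurable_fst.sub measurable_snd)))
  have sqle : ∀ a b : ℝ≥0∞, (2 * (a + b)) ^ 2 ≤ 8 * (a ^ 2 + b ^ 2) := fun a b => by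
    have h := ENNReal.rpow_add_le_mul_rpow_add_rpow a b (p := 2) (by norm_num)
    norm_num at h
    calc (2 * (a + b)) ^ 2 = 4 * (a + b) ^ 2 := by ring
      _ ≤ 4 * (2 * (a ^ 2 + b ^ 2)) := by gcongr
      _ = _ := by ring
  have key : ∫⁻ ξ, ‖F ξ‖ₑ ^ 2 ≤ ENNReal.ofReal ((4 * sobConst * (‖p‖ * ‖q‖)) ^ 2) := by
    calc ∫⁻ ξ, ‖F ξ‖ₑ ^ 2 ≤ ∫⁻ ξ, 8 * (A ξ ^ 2 + B ξ ^ 2) := by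
          refine lintegral_mono fun ξ => ?_
          refine le_trans ?_ (sqle (A ξ) (B ξ))
          gcongr
          exact enorm_weight_mul_conv_le p q ξ
      _ = 8 * ((∫⁻ ξ, A ξ ^ 2) + ∫⁻ ξ, B ξ ^ 2) := by
          rw [lintegral_const_mul' _ _ (by simp), lintegral_add_left (mA.pow_const 2)]
      _ ≤ 8 * (ENNReal.ofReal ((sobConst * (‖p‖ * ‖q‖)) ^ 2) +
            ENNReal.ofReal ((sobConst * (‖p‖ * ‖q‖)) ^ 2)) := by gcongr
      _ = _ := by
          rw [← ENNReal.ofReal_add (by positivity) (by positivity),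
            show (8 : ℝ≥0∞) = ENNReal.ofReal 8 by simp, ← ENNReal.ofReal_mul (by norm_num)]
          congr 1; ring
  have hnn : 0 ≤ 4 * sobConst * (‖p‖ * ‖q‖) := by have := sobConst_nonneg; positivity
  have key2 : eLpNorm F 2 volume ≤ ENNReal.ofReal (4 * sobConst * (‖p‖ * ‖q‖)) := by
    rw [eLpNorm_eq_lintegral_rpow_enorm_toReal two_ne_zero ENNReal.ofNat_ne_top]
    simp only [ENNReal.toReal_ofNat, ENNReal.rpow_ofNat]
    calc _ ≤ (ENNReal.ofReal ((4 * sobConst * (‖p‖ * ‖q‖)) ^ 2)) ^ (1 / 2 : ℝ) := by gcongr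
      _ = _ := by
        rw [ENNReal.ofReal_pow hnn, ← ENNReal.rpow_natCast, ← ENNReal.rpow_mul]
        norm_num
  have hmem : MemLp F 2 volume := ⟨mF, key2.trans_lt ENNReal.ofReal_lt_top⟩
  refine ⟨hmem, ?_⟩
  rw [Lp.norm_toLp]
  exact ENNReal.toReal_le_of_le_ofReal hnn key2

open Convolution in
theorem exists_ev_mul (a b : L2R3) :
    ∃ c : L2R3, ‖c‖ ≤ 4 * sobConst * (‖a‖ * ‖b‖) ∧ ∀ x, ev x c = ev x a * ev x b := by
  obtain ⟨h, hle⟩ := exists_memLp_weight_mul_conv (ftL a) (ftL b)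
  rw [norm_ftL, norm_ftL] at hle
  refine ⟨iftL (h.toLp _), (norm_iftL_le _).trans hle, ?_⟩
  refine ev_eq_of_ae ((continuous_ev a).mul (continuous_ev b)) ?_
  rw [iftL_apply, ← reL_multC]
  have hconv : ⇑(mulC (ji ^ 2) (h.toLp _ : CL2)) =ᵐ[volume]
      (sobFun (ftL a) ⋆[ContinuousLinearMap.mul ℂ ℂ] sobFun (ftL b)) := by
    filter_upwards [mulC_ji_sq_ae (h.toLp _ : CL2), h.coeFn_toLp] with ξ h1 h2
    rw [h1, sobFun, h2, ← mul_assoc, ← Complex.ofReal_mul,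
      mul_inv_cancel₀ (pow_pos (ji_pos _) 2).ne', Complex.ofReal_one, one_mul]
  have hi := (integrable_sobFun (ftL a)).integrable_convolution (ContinuousLinearMap.mul ℂ ℂ)
    (integrable_sobFun (ftL b))
  have e : multC (ji ^ 2) (𝓕⁻ (h.toLp _ : CL2)) = 𝓕⁻ (mulC (ji ^ 2) (h.toLp _ : CL2)) := by
    rw [multC, FourierTransform.fourier_fourierInv_eq]
  rw [e]
  filter_upwards [reL_ae (𝓕⁻ (mulC (ji ^ 2) (h.toLp _ : CL2))),
    Lp_fourierInv_ae_eq _ (hi.congr hconv.symm)] with x h1 h2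
  rw [h1, h2, fourierInv_congr_ae hconv, Real.fourierInv_eq_fourier_neg,
    Real.fourier_mul_convolution_eq (integrable_sobFun _) (integrable_sobFun _),
    ← Real.fourierInv_eq_fourier_neg, ← Real.fourierInv_eq_fourier_neg]
  change (evC x a * evC x b).re = _
  rw [evC_eq, evC_eq, ← Complex.ofReal_mul, Complex.ofReal_re]

/-- The bilinear map on `L²` that corresponds to the pointwise product on `H²`. -/
noncomputable def sobMul : L2R3 →L[ℝ] L2R3 →L[ℝ] L2R3 :=
  LinearMap.mkContinuous₂
    (LinearMap.mk₂ ℝ (fun a b => (exists_ev_mul a b).choose)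
      (fun a a' b => ev_injective fun x => by
        rw [map_add, (exists_ev_mul _ _).choose_spec.2, (exists_ev_mul _ _).choose_spec.2,
          (exists_ev_mul _ _).choose_spec.2, map_add, add_mul])
      (fun c a b => ev_injective fun x => by
        rw [map_smul, (exists_ev_mul _ _).choose_spec.2, (exists_ev_mul _ _).choose_spec.2,
          map_smul, smul_eq_mul, smul_eq_mul, mul_assoc])
      (fun a b b' => ev_injective fun x => by
        rw [map_add, (exists_ev_mul _ _).choose_spec.2, (exists_ev_mul _ _).choose_spec.2,
          (exists_ev_mul _ _).choose_spec.2, map_add, mul_add])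
      (fun c a b => ev_injective fun x => by
        rw [map_smul, (exists_ev_mul _ _).choose_spec.2, (exists_ev_mul _ _).choose_spec.2,
          map_smul, smul_eq_mul, smul_eq_mul, mul_left_comm]))
    (4 * sobConst) fun a b => by
      rw [mul_assoc]
      exact (exists_ev_mul a b).choose_spec.1

theorem ev_sobMul (x : R3) (a b : L2R3) : ev x (sobMul a b) = ev x a * ev x b :=
  (exists_ev_mul a b).choose_spec.2 x

/-- The uniform probability measure on the unit sphere of `ℝ³`, as a measure on `ℝ³`. -/
noncomputable def sphMeasure : Measure R3 :=
  (ProbabilityTheory.cond volume (Metric.ball (0 : R3) 1)).map fun x => ‖x‖⁻¹ • x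

theorem measurable_normalize : Measurable fun x : R3 => ‖x‖⁻¹ • x := by fun_prop

instance isProbabilityMeasure_cond_ball :
    IsProbabilityMeasure (ProbabilityTheory.cond volume (Metric.ball (0 : R3) 1)) :=
  ProbabilityTheory.cond_isProbabilityMeasure_of_finite
    (Metric.measure_ball_pos volume (0 : R3) one_pos).ne' measure_ball_lt_top.ne

instance isProbabilityMeasure_sphMeasure : IsProbabilityMeasure sphMeasure :=
  Measure.isProbabilityMeasure_map measurable_normalize.aemeasurable

theorem ae_sphMeasure_norm : ∀ᵐ ω ∂sphMeasure, ‖ω‖ = 1 := by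
  refine (ae_map_iff measurable_normalize.aemeasurable
    (measurableSet_eq_fun measurable_norm measurable_const)).2 ?_
  have h : ∀ᵐ x : R3 ∂volume, x ≠ 0 := by
    simp [ae_iff]
  filter_upwards [ProbabilityTheory.cond_absolutelyContinuous.ae_le h] with x hx
  rw [norm_smul, norm_inv, norm_norm, inv_mul_cancel₀ (norm_ne_zero_iff.2 hx)]

theorem map_sphMeasure (R : R3 ≃ₗᵢ[ℝ] R3) : sphMeasure.map R = sphMeasure := by
  have hR : Measurable R := R.continuous.measurable
  have h1 : (ProbabilityTheory.cond volume (Metric.ball (0 : R3) 1)).map R =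
      ProbabilityTheory.cond volume (Metric.ball (0 : R3) 1) := by
    have h2 := (R.measurePreserving.restrict_preimage
      (measurableSet_ball (x := (0 : R3)) (ε := 1))).map_eq
    have h3 : R ⁻¹' Metric.ball (0 : R3) 1 = Metric.ball 0 1 := by
      ext x; simp
    rw [h3] at h2
    rw [ProbabilityTheory.cond, Measure.map_smul, h2]
  conv_rhs => rw [sphMeasure, ← h1]
  rw [sphMeasure, Measure.map_map hR measurable_normalize,
    Measure.map_map measurable_normalize hR]
  congr 1
  ext x : 1
  simp

theorem integral_sphMeasure_comp (R : R3 ≃ₗᵢ[ℝ] R3) (f : R3 → ℂ) :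
    ∫ ω, f (R ω) ∂sphMeasure = ∫ ω, f ω ∂sphMeasure := by
  conv_rhs => rw [← map_sphMeasure R]
  exact (R.toHomeomorph.measurableEmbedding.integral_map _).symm

theorem exists_isometry_map {x y : R3} (h : ‖x‖ = ‖y‖) : ∃ R : R3 ≃ₗᵢ[ℝ] R3, R x = y :=
  ⟨_, Submodule.reflection_sub h⟩

/-- The rotation by the angle `θ` in the plane of the first two coordinates. -/
noncomputable def planeRotation (θ : ℝ) : R3 ≃ₗᵢ[ℝ] R3 :=
  LinearIsometry.toLinearIsometryEquiv
    { toFun := fun ω => !₂[Real.cos θ * ω 0 - Real.sin θ * ω 1,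
        Real.sin θ * ω 0 + Real.cos θ * ω 1, ω 2]
      map_add' := fun x y => by
        ext i; fin_cases i <;> simp <;> ring
      map_smul' := fun c x => by
        ext i; fin_cases i <;> simp <;> ring
      norm_map' := fun x => by
        simp only [EuclideanSpace.norm_eq, Fin.sum_univ_three, LinearMap.coe_mk, AddHom.coe_mk,
          Real.norm_eq_abs, sq_abs]
        congr 1
        simp
        linear_combination (x 0 ^ 2 + x 1 ^ 2) * Real.sin_sq_add_cos_sq θ } rfl

theorem planeRotation_apply (θ : ℝ) (ω : R3) :
    planeRotation θ ω = !₂[Real.cos θ * ω 0 - Real.sin θ * ω 1,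
        Real.sin θ * ω 0 + Real.cos θ * ω 1, ω 2] := rfl

theorem abs_coord_le {ω : R3} (h : ‖ω‖ = 1) (i : Fin 3) : |ω i| ≤ 1 := by
  rw [← h, ← Real.norm_eq_abs]; exact PiLp.norm_apply_le ω i

theorem integrable_sphMeasure_of_continuous {f : R3 → ℂ} (hf : Continuous f) :
    Integrable f sphMeasure := by
  obtain ⟨C, hC⟩ := (isCompact_sphere (0 : R3) 1).exists_bound_of_continuousOn hf.continuousOn
  refine Integrable.of_bound hf.aestronglyMeasurable C ?_
  filter_upwards [ae_sphMeasure_norm] with ω h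
  exact hC ω (by simpa using h)

theorem norm_cexp_I_mul (r : ℝ) : ‖Complex.exp (Complex.I * r)‖ = 1 := by
  rw [mul_comm]; exact Complex.norm_exp_ofReal_mul_I r

/-- Moments of the sphere measure weighted by `exp (i r ω₀)`. -/
noncomputable def sphChar (f : R3 → ℝ) (r : ℝ) : ℂ :=
  ∫ ω, (f ω : ℂ) * Complex.exp (Complex.I * (r * ω 0 : ℝ)) ∂sphMeasure

theorem hasDerivAt_sphChar {f : R3 → ℝ} (hf : Continuous f) (r : ℝ) :
    HasDerivAt (sphChar f) (Complex.I * sphChar (fun ω => f ω * ω 0) r) r := by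
  obtain ⟨C, hC⟩ := (isCompact_sphere (0 : R3) 1).exists_bound_of_continuousOn hf.continuousOn
  have h := (hasDerivAt_integral_of_dominated_loc_of_deriv_le (μ := sphMeasure)
    (F := fun r (ω : R3) => (f ω : ℂ) * Complex.exp (Complex.I * (r * ω 0 : ℝ)))
    (F' := fun r (ω : R3) => (f ω : ℂ) * (Complex.exp (Complex.I * (r * ω 0 : ℝ)) *
      (Complex.I * (ω 0 : ℝ)))) (x₀ := r) (bound := fun _ => C) (s := univ) univ_mem
    (Eventually.of_forall fun r => Continuous.aestronglyMeasurable (by fun_prop))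
    (integrable_sphMeasure_of_continuous (by fun_prop))
    (Continuous.aestronglyMeasurable (by fun_prop)) ?_ (integrable_const C) ?_).2
  · refine h.congr_deriv ?_
    rw [sphChar, ← integral_const_mul]
    refine integral_congr_ae (Eventually.of_forall fun ω => ?_)
    push_cast; ring
  · filter_upwards [ae_sphMeasure_norm] with ω hω s _
    rw [norm_mul, norm_mul, norm_mul, norm_cexp_I_mul, Complex.norm_I, one_mul, one_mul,
      Complex.norm_real, Complex.norm_real]
    exact (mul_le_of_le_one_right (norm_nonneg _) (abs_coord_le hω 0)).trans
      (hC ω (by simpa using hω))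
  · refine Eventually.of_forall fun ω s _ => ?_
    have h1 : HasDerivAt (fun s : ℝ => Complex.I * ((s * ω 0 : ℝ) : ℂ)) (Complex.I * (ω 0 : ℝ)) s := by
      have := (((hasDerivAt_id s).mul_const (ω 0)).ofReal_comp).const_mul Complex.I
      simpa using! this
    exact (h1.cexp).const_mul _

theorem sphChar_rotation (r : ℝ) :
    sphChar (fun ω => ω 0) r = Complex.I * r * sphChar (fun ω => ω 1 ^ 2) r := by
  set F : ℝ → R3 → ℂ := fun θ ω => ((Real.sin θ * ω 0 + Real.cos θ * ω 1 : ℝ) : ℂ) *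
    Complex.exp (Complex.I * (r * (Real.cos θ * ω 0 - Real.sin θ * ω 1) : ℝ)) with hF
  set F' : ℝ → R3 → ℂ := fun θ ω => ((Real.cos θ * ω 0 - Real.sin θ * ω 1 : ℝ) : ℂ) *
    Complex.exp (Complex.I * (r * (Real.cos θ * ω 0 - Real.sin θ * ω 1) : ℝ)) +
    ((Real.sin θ * ω 0 + Real.cos θ * ω 1 : ℝ) : ℂ) *
    (Complex.exp (Complex.I * (r * (Real.cos θ * ω 0 - Real.sin θ * ω 1) : ℝ)) *
      (Complex.I * (r * (-Real.sin θ * ω 0 - Real.cos θ * ω 1) : ℝ))) with hF'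
  have bd : ∀ (θ : ℝ) (ω : R3), ‖ω‖ = 1 → |Real.cos θ * ω 0| ≤ 1 ∧ |Real.sin θ * ω 0| ≤ 1 ∧
      |Real.cos θ * ω 1| ≤ 1 ∧ |Real.sin θ * ω 1| ≤ 1 := fun θ ω hω => by
    have hm : ∀ p q : ℝ, |p| ≤ 1 → |q| ≤ 1 → |p * q| ≤ 1 := fun p q hp hq => by
      rw [abs_mul]; exact mul_le_one₀ hp (abs_nonneg _) hq
    exact ⟨hm _ _ (Real.abs_cos_le_one _) (abs_coord_le hω _),
      hm _ _ (Real.abs_sin_le_one _) (abs_coord_le hω _),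
      hm _ _ (Real.abs_cos_le_one _) (abs_coord_le hω _),
      hm _ _ (Real.abs_sin_le_one _) (abs_coord_le hω _)⟩
  have h := (hasDerivAt_integral_of_dominated_loc_of_deriv_le (μ := sphMeasure)
    (F := F) (F' := F') (x₀ := 0) (bound := fun _ => 2 + 2 * (|r| * 2)) (s := univ) univ_mem
    (Eventually.of_forall fun θ => Continuous.aestronglyMeasurable (by fun_prop))
    (integrable_sphMeasure_of_continuous (by fun_prop))
    (Continuous.aestronglyMeasurable (by fun_prop)) ?_ (integrable_const _) ?_).2
  · have hconst : (fun θ => ∫ ω, F θ ω ∂sphMeasure) = fun _ => sphChar (fun ω => ω 1) r := by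
      ext θ
      refine Eq.trans ?_ (integral_sphMeasure_comp (planeRotation θ) _)
      refine integral_congr_ae (Eventually.of_forall fun ω => ?_)
      simp only [planeRotation_apply, hF]
      rfl
    rw [hconst] at h
    have h0 := h.unique (hasDerivAt_const (0 : ℝ) (sphChar (fun ω => ω 1) r))
    have h1 : ∫ ω, F' 0 ω ∂sphMeasure =
        sphChar (fun ω => ω 0) r - Complex.I * r * sphChar (fun ω => ω 1 ^ 2) r := by
      rw [sphChar, sphChar, ← integral_const_mul, ← integral_sub
        (integrable_sphMeasure_of_continuous (by fun_prop))
        (integrable_sphMeasure_of_continuous (by fun_prop))]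
      refine integral_congr_ae (Eventually.of_forall fun ω => ?_)
      simp only [hF', Real.cos_zero, Real.sin_zero, zero_mul, one_mul, sub_zero, zero_add, neg_zero,
        zero_sub]
      push_cast; ring
    rw [h1] at h0
    exact sub_eq_zero.1 h0
  · filter_upwards [ae_sphMeasure_norm] with ω hω θ _
    obtain ⟨b1, b2, b3, b4⟩ := bd θ ω hω
    have c1 : |Real.cos θ * ω 0 - Real.sin θ * ω 1| ≤ 2 := (abs_sub _ _).trans (by linarith)
    have c2 : |Real.sin θ * ω 0 + Real.cos θ * ω 1| ≤ 2 := (abs_add_le _ _).trans (by linarith)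
    have c3 : |-Real.sin θ * ω 0 - Real.cos θ * ω 1| ≤ 2 := by
      rw [neg_mul, ← neg_add', abs_neg]; exact c2
    simp only [hF']
    refine (norm_add_le _ _).trans ?_
    rw [norm_mul, norm_mul, norm_mul, norm_mul, norm_cexp_I_mul, Complex.norm_I, one_mul, one_mul,
      mul_one, Complex.norm_real, Complex.norm_real, Complex.norm_real, Real.norm_eq_abs,
      Real.norm_eq_abs, Real.norm_eq_abs, abs_mul r]
    gcongr
  · refine Eventually.of_forall fun ω θ _ => ?_
    have hs := Real.hasDerivAt_sin θ
    have hc := Real.hasDerivAt_cos θ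
    have h1 := ((hs.mul_const (ω 0)).add (hc.mul_const (ω 1))).ofReal_comp
    have h2 := ((((hc.mul_const (ω 0)).sub (hs.mul_const (ω 1))).const_mul r).ofReal_comp).const_mul
      Complex.I
    refine (h1.mul h2.cexp).congr_deriv ?_
    simp only [hF', Pi.add_apply, Pi.sub_apply]
    push_cast
    ring

theorem sphChar_swap (r : ℝ) :
    sphChar (fun ω => ω 2 ^ 2) r = sphChar (fun ω => ω 1 ^ 2) r := by
  rw [sphChar, ← integral_sphMeasure_comp
    (LinearIsometryEquiv.piLpCongrLeft 2 ℝ ℝ (Equiv.swap (1 : Fin 3) 2))]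
  refine integral_congr_ae (Eventually.of_forall fun ω => ?_)
  simp [LinearIsometryEquiv.piLpCongrLeft_apply, Equiv.piCongrLeft', Equiv.swap_apply_def]

theorem sphChar_sum (r : ℝ) :
    sphChar (fun ω => ω 0 * ω 0) r + 2 * sphChar (fun ω => ω 1 ^ 2) r = sphChar (fun _ => 1) r := by
  rw [two_mul]
  nth_rewrite 2 [← sphChar_swap]
  rw [sphChar, sphChar, sphChar, sphChar, ← integral_add
    (integrable_sphMeasure_of_continuous (by fun_prop))
    (integrable_sphMeasure_of_continuous (by fun_prop)), ← integral_add
    (integrable_sphMeasure_of_continuous (by fun_prop))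
    (integrable_sphMeasure_of_continuous (by fun_prop))]
  refine integral_congr_ae ?_
  filter_upwards [ae_sphMeasure_norm] with ω hω
  have h1 : ω 0 ^ 2 + ω 1 ^ 2 + ω 2 ^ 2 = 1 := by
    have := EuclideanSpace.norm_sq_eq ω
    rw [hω, Fin.sum_univ_three] at this
    simpa using this.symm
  have h2 : ((ω 0 : ℝ) : ℂ) ^ 2 + ((ω 1 : ℝ) : ℂ) ^ 2 + ((ω 2 : ℝ) : ℂ) ^ 2 = 1 := by
    have := congrArg (fun x : ℝ => (x : ℂ)) h1
    push_cast at this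
    exact this
  push_cast
  linear_combination Complex.exp (Complex.I * (r * ω 0)) * h2

theorem mul_sphChar_one (r : ℝ) : r * sphChar (fun _ => 1) r = Real.sin r := by
  set φ := sphChar (fun _ => 1) with hφ
  set φ₁ : ℝ → ℂ := fun r => Complex.I * sphChar (fun ω => ω 0) r with hφ₁
  have d0 : ∀ r, HasDerivAt φ (φ₁ r) r := fun r => by
    simpa using hasDerivAt_sphChar (f := fun _ => 1) continuous_const r
  have d1 : ∀ r, HasDerivAt φ₁ (-sphChar (fun ω => ω 0 * ω 0) r) r := fun r => by
    refine ((hasDerivAt_sphChar (f := fun ω => ω 0) (by fun_prop) r).const_mul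
      Complex.I).congr_deriv ?_
    rw [← mul_assoc, Complex.I_mul_I]; ring
  have hode : ∀ r : ℝ, 2 * φ₁ r - r * sphChar (fun ω => ω 0 * ω 0) r = -(r * φ r) := fun r => by
    have h1 := sphChar_rotation r
    have h2 := sphChar_sum r
    simp only [hφ₁, hφ]
    rw [← h2, h1]
    linear_combination 2 * r * sphChar (fun ω => ω 1 ^ 2) r * Complex.I_mul_I
  have e0 : ∀ r : ℝ, HasDerivAt (fun r : ℝ => (r : ℂ) * φ r) (φ r + r * φ₁ r) r := fun r => by
    refine (((hasDerivAt_id r).ofReal_comp).mul (d0 r)).congr_deriv ?_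
    simp
  have e1 : ∀ r : ℝ, HasDerivAt (fun r : ℝ => φ r + r * φ₁ r) (-(r * φ r)) r := fun r => by
    refine ((d0 r).add (((hasDerivAt_id r).ofReal_comp).mul (d1 r))).congr_deriv ?_
    rw [← hode r]
    simp
    ring
  have hs : ∀ r : ℝ, HasDerivAt (fun r => (Real.sin r : ℂ)) (Real.cos r) r := fun r =>
    (Real.hasDerivAt_sin r).ofReal_comp
  have hc : ∀ r : ℝ, HasDerivAt (fun r => (Real.cos r : ℂ)) ((-Real.sin r : ℝ) : ℂ) r := fun r =>
    (Real.hasDerivAt_cos r).ofReal_comp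
  have i1 : ∀ r : ℝ, HasDerivAt (fun r : ℝ => (r : ℂ) * φ r * Real.cos r -
      (φ r + r * φ₁ r) * Real.sin r) 0 r := fun r => by
    refine (((e0 r).mul (hc r)).sub ((e1 r).mul (hs r))).congr_deriv ?_
    push_cast; ring
  have i2 : ∀ r : ℝ, HasDerivAt (fun r : ℝ => (r : ℂ) * φ r * Real.sin r +
      (φ r + r * φ₁ r) * Real.cos r) 0 r := fun r => by
    refine (((e0 r).mul (hs r)).add ((e1 r).mul (hc r))).congr_deriv ?_
    push_cast; ring
  have c1 := is_const_of_deriv_eq_zero (fun r => (i1 r).differentiableAt) (fun r => (i1 r).deriv) r 0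
  have c2 := is_const_of_deriv_eq_zero (fun r => (i2 r).differentiableAt) (fun r => (i2 r).deriv) r 0
  have hφ0 : φ 0 = 1 := by simp [hφ, sphChar]
  simp [hφ0] at c1 c2
  have hsc : (Complex.sin r) ^ 2 + (Complex.cos r) ^ 2 = 1 := Complex.sin_sq_add_cos_sq _
  rw [Complex.ofReal_sin]
  linear_combination Complex.cos r * c1 + Complex.sin r * c2 - r * φ r * hsc

theorem sphChar_one (r : ℝ) : sphChar (fun _ => 1) r = Real.sinc r := by
  by_cases hr : r = 0
  · subst hr; simp [sphChar]
  · rw [Real.sinc_of_ne_zero hr, Complex.ofReal_div, ← mul_sphChar_one]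
    field_simp [Complex.ofReal_ne_zero.2 hr]

theorem integral_fourierChar_sphMeasure (ξ : R3) (r : ℝ) :
    ∫ ω, ((Real.fourierChar (inner ℝ ξ (r • ω)) : Circle) : ℂ) ∂sphMeasure =
      Real.sinc (2 * Real.pi * ‖ξ‖ * r) := by
  set e : R3 := EuclideanSpace.single 0 1 with he
  have hne : ‖‖ξ‖ • e‖ = ‖ξ‖ := by rw [norm_smul, he]; simp
  obtain ⟨R, hR⟩ := exists_isometry_map hne.symm
  rw [← sphChar_one, sphChar]
  refine Eq.trans ?_ (integral_sphMeasure_comp R _)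
  refine integral_congr_ae (Eventually.of_forall fun ω => ?_)
  have h1 : inner ℝ ξ (r • ω) = r * (‖ξ‖ * (R ω) 0) := by
    rw [inner_smul_right, ← R.inner_map_map, hR, inner_smul_left, he, EuclideanSpace.inner_single_left]
    simp
  simp only [h1, Real.fourierChar_apply, Complex.ofReal_one, one_mul]
  congr 1
  push_cast; ring

theorem ev_compIso (R : R3 ≃ₗᵢ[ℝ] R3) (a : L2R3) (x : R3) : ev x (compIso R a) = ev (R x) a := by
  refine ev_eq_of_ae (f := fun x => ev (R x) a) ((continuous_ev a).comp R.continuous) ?_ x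
  rw [mult_compIso]
  filter_upwards [compIso_ae R (mult (ji ^ 2) a),
    R.measurePreserving.quasiMeasurePreserving.ae (mult_ji_sq_ae a)] with x h1 h2
  rw [h1, Function.comp_apply, h2]

/-- Invariance under all linear isometries of `ℝ³`. -/
def IsRotInvariant (a : L2R3) : Prop := ∀ R : R3 ≃ₗᵢ[ℝ] R3, compIso R a = a

theorem IsRotInvariant.ev_eq {a : L2R3} (ha : IsRotInvariant a) {x y : R3} (h : ‖x‖ = ‖y‖) :
    ev x a = ev y a := by
  obtain ⟨R, rfl⟩ := exists_isometry_map h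
  rw [← ev_compIso, ha R]

theorem IsRotInvariant.map_mult {a : L2R3} (ha : IsRotInvariant a) (m : ℝ →ᵇ ℝ) :
    IsRotInvariant (mult m a) := fun R => by rw [← mult_compIso, ha R]

/-- The radial Fourier inversion formula. -/
theorem IsRotInvariant.norm_mul_ev {a : L2R3} (ha : IsRotInvariant a) (x : R3) :
    ‖x‖ * ev x a = ev 0 (mult (ji * kS ‖x‖) a) := by
  have h1 : evC x a = ∫ ω, evC (‖x‖ • ω) a ∂sphMeasure := by
    have : ∀ᵐ ω ∂sphMeasure, evC (‖x‖ • ω) a = evC x a := by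
      filter_upwards [ae_sphMeasure_norm] with ω hω
      rw [evC_eq, evC_eq, ha.ev_eq]
      rw [norm_smul, hω, norm_norm, mul_one]
    rw [integral_congr_ae this]
    simp
  have hint : Integrable (Function.uncurry fun (ω ξ : R3) =>
      Real.fourierChar (inner ℝ ξ (‖x‖ • ω)) • sobFun (ftL a) ξ) (sphMeasure.prod volume) := by
    have hi : Integrable (fun p : R3 × R3 => sobFun (ftL a) p.2) (sphMeasure.prod volume) :=
      (integrable_sobFun (ftL a)).comp_snd sphMeasure
    refine hi.mono ?_ (Eventually.of_forall fun p => by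
      simp only [Function.uncurry]; rw [Circle.norm_smul])
    have hc : Continuous fun p : R3 × R3 =>
        ((Real.fourierChar (inner ℝ p.2 (‖x‖ • p.1)) : Circle) : ℂ) := by
      fun_prop
    exact hc.aestronglyMeasurable.mul hi.aestronglyMeasurable
  have h2 : evC x a = ∫ ξ, (Real.sinc (2 * Real.pi * ‖ξ‖ * ‖x‖) : ℂ) * sobFun (ftL a) ξ := by
    rw [h1]
    simp only [evC, Real.fourierInv_eq]
    rw [integral_integral_swap hint]
    refine integral_congr_ae (Eventually.of_forall fun ξ => ?_)
    simp only [Circle.smul_def, smul_eq_mul]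
    rw [integral_mul_const, integral_fourierChar_sphMeasure]
  have h3 : evC 0 (mult (ji * kS ‖x‖) a) = ‖x‖ * evC x a := by
    rw [h2, ← integral_const_mul, evC, Real.fourierInv_eq]
    refine integral_congr_ae ?_
    rw [ftL_mult]
    filter_upwards [mulC_ae (ji * kS ‖x‖) (ftL a)] with ξ hξ
    rw [sobFun, sobFun, hξ]
    simp only [inner_zero_right, AddChar.map_zero_eq_one, one_smul,
      BoundedContinuousFunction.coe_mul, Pi.mul_apply, ji_mul_kS_apply, sig]
    push_cast; ring
  rw [evC_eq, evC_eq] at h3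
  exact_mod_cast h3.symm

theorem ContinuousOn.exists_norm_le_Icc {E : Type*} [NormedAddCommGroup E] {T t : ℝ}
    {y : ℝ → E} (h : ContinuousOn y (Ico 0 T)) (ht : t < T) : ∃ R, 0 ≤ R ∧ ∀ s ∈ Icc 0 t, ‖y s‖ ≤ R := by
  obtain ⟨R, hR⟩ := isCompact_Icc.exists_bound_of_continuousOn
    (h.mono (Icc_subset_Ico_right ht : Icc 0 t ⊆ Ico 0 T))
  exact ⟨max R 0, le_max_right _ _, fun s hs => (hR s hs).trans (le_max_left _ _)⟩

section AbstractODE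

open scoped NNReal

variable {E : Type*} [NormedAddCommGroup E] [NormedSpace ℝ E]

/-- A time-dependent vector field that is continuous in time, and bounded and Lipschitz on bounded
sets, locally uniformly in time. -/
structure IsLocLip (f : ℝ → E → E) : Prop where
  lip : ∀ T R : ℝ, ∃ K : ℝ≥0, ∀ t ∈ Icc 0 T, LipschitzOnWith K (f t) (Metric.closedBall 0 R)
  bdd : ∀ T R : ℝ, ∃ L : ℝ≥0, ∀ t ∈ Icc 0 T, ∀ x ∈ Metric.closedBall (0 : E) R, ‖f t x‖ ≤ L
  cont : ∀ x, Continuous fun t => f t x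

/-- `y` solves `y' = f(t, y)` on `[0, T)`. -/
def IsSol (f : ℝ → E → E) (T : ℝ) (y : ℝ → E) : Prop :=
  ∀ t ∈ Ico 0 T, HasDerivWithinAt y (f t (y t)) (Ico 0 T) t

variable {f : ℝ → E → E}

theorem HasDerivWithinAt.Ico_of_lt {y : ℝ → E} {y' : E} {t S T : ℝ}
    (h : HasDerivWithinAt y y' (Ico 0 S) t) (ht : t < S) : HasDerivWithinAt y y' (Ico 0 T) t := by
  refine h.mono_of_mem_nhdsWithin ?_
  filter_upwards [self_mem_nhdsWithin, nhdsWithin_le_nhds (Iio_mem_nhds ht)] with s hs hs'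
  exact ⟨hs.1, hs'⟩

theorem HasDerivWithinAt.Ici_of_Ico {y : ℝ → E} {y' : E} {t T : ℝ}
    (h : HasDerivWithinAt y y' (Ico 0 T) t) (ht : t ∈ Ico 0 T) :
    HasDerivWithinAt y y' (Ici t) t := by
  refine h.mono_of_mem_nhdsWithin ?_
  filter_upwards [self_mem_nhdsWithin, nhdsWithin_le_nhds (Iio_mem_nhds ht.2)] with s hs hs'
  exact ⟨ht.1.trans hs, hs'⟩

theorem IsSol.mono {S T : ℝ} {y : ℝ → E} (h : IsSol f T y) (hS : S ≤ T) : IsSol f S y :=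
  fun t ht => (h t ⟨ht.1, ht.2.trans_le hS⟩).Ico_of_lt (ht.2.trans_le hS)

theorem IsSol.continuousOn {T : ℝ} {y : ℝ → E} (h : IsSol f T y) : ContinuousOn y (Ico 0 T) :=
  fun t ht => (h t ht).continuousWithinAt

theorem IsSol.eqOn (hf : IsLocLip f) {T : ℝ} {y z : ℝ → E} (hy : IsSol f T y) (hz : IsSol f T z)
    (h0 : y 0 = z 0) : EqOn y z (Ico 0 T) := by
  intro t ht
  obtain ⟨R₁, h10, h1⟩ := hy.continuousOn.exists_norm_le_Icc ht.2
  obtain ⟨R₂, h20, h2⟩ := hz.continuousOn.exists_norm_le_Icc ht.2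
  obtain ⟨K, hK⟩ := hf.lip t (R₁ + R₂)
  have sub : ∀ s ∈ Ico 0 t, s ∈ Ico 0 T := fun s hs => ⟨hs.1, hs.2.trans ht.2⟩
  exact ODE_solution_unique_of_mem_Icc_right (v := f)
    (s := fun _ => Metric.closedBall 0 (R₁ + R₂)) (K := K) (a := 0) (b := t)
    (fun s hs => hK s ⟨hs.1, hs.2.le⟩)
    (hy.continuousOn.mono (Icc_subset_Ico_right ht.2))
    (fun s hs => (hy s (sub s hs)).Ici_of_Ico (sub s hs))
    (fun s hs => by
      rw [mem_closedBall_zero_iff]; linarith [h1 s ⟨hs.1, hs.2.le⟩])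
    (hz.continuousOn.mono (Icc_subset_Ico_right ht.2))
    (fun s hs => (hz s (sub s hs)).Ici_of_Ico (sub s hs))
    (fun s hs => by
      rw [mem_closedBall_zero_iff]; linarith [h2 s ⟨hs.1, hs.2.le⟩]) h0 ⟨ht.1, le_rfl⟩

theorem IsLocLip.exists_local [CompleteSpace E] (hf : IsLocLip f) (T R : ℝ) :
    ∃ τ, 0 < τ ∧ ∀ t₀ ∈ Icc 0 T, ∀ y₀ : E, ‖y₀‖ ≤ R → ∃ α : ℝ → E, α t₀ = y₀ ∧
      ∀ t ∈ Icc t₀ (t₀ + τ), HasDerivWithinAt α (f t (α t)) (Icc t₀ (t₀ + τ)) t := by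
  obtain ⟨K, hK⟩ := hf.lip (T + 1) (R + 1)
  obtain ⟨L, hL⟩ := hf.bdd (T + 1) (R + 1)
  refine ⟨min 1 (1 / (L + 1)), by positivity, fun t₀ ht₀ y₀ hy₀ => ?_⟩
  set τ : ℝ := min 1 (1 / (L + 1)) with hτ
  have hτ0 : 0 < τ := by positivity
  have hsub : Metric.closedBall y₀ ((1 : ℝ≥0) : ℝ) ⊆ Metric.closedBall 0 (R + 1) := by
    refine Metric.closedBall_subset_closedBall' ?_
    rw [dist_zero_right, NNReal.coe_one]; linarith
  have ht : ∀ t ∈ Icc t₀ (t₀ + τ), t ∈ Icc 0 (T + 1) := fun t ht =>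
    ⟨ht₀.1.trans ht.1, ht.2.trans (add_le_add ht₀.2 (min_le_left _ _))⟩
  have hpl : IsPicardLindelof f (tmin := t₀) (tmax := t₀ + τ)
      ⟨t₀, left_mem_Icc.2 (by linarith)⟩ y₀ 1 0 L K :=
    { lipschitzOnWith := fun t h => (hK t (ht t h)).mono hsub
      continuousOn := fun x _ => (hf.cont x).continuousOn
      norm_le := fun t h x hx => hL t (ht t h) x (hsub hx)
      mul_max_le := by
        simp only [add_sub_cancel_left, sub_self, NNReal.coe_one, NNReal.coe_zero, sub_zero]
        rw [max_eq_left hτ0.le]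
        calc (L : ℝ) * τ ≤ L * (1 / (L + 1)) := by gcongr; exact min_le_right _ _
          _ ≤ 1 := by
            rw [mul_one_div, div_le_one (by positivity)]; linarith }
  exact hpl.exists_eq_forall_mem_Icc_hasDerivWithinAt₀

theorem IsLocLip.exists_extension [CompleteSpace E] (hf : IsLocLip f) {T R : ℝ} {y : ℝ → E}
    (hT : 0 < T) (hy : IsSol f T y) (hR : ∃ᶠ t in 𝓝[<] T, ‖y t‖ ≤ R) :
    ∃ T' > T, ∃ z : ℝ → E, z 0 = y 0 ∧ IsSol f T' z := by
  obtain ⟨τ, hτ, hloc⟩ := hf.exists_local T R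
  obtain ⟨t₀, hle, ht₀⟩ := (hR.and_eventually (Ico_mem_nhdsLT
    (show max 0 (T - τ / 2) < T from max_lt hT (by linarith)))).exists
  have h0 : 0 ≤ t₀ := (le_max_left _ _).trans ht₀.1
  have h1 : T - τ / 2 ≤ t₀ := (le_max_right _ _).trans ht₀.1
  obtain ⟨α, hα0, hα⟩ := hloc t₀ ⟨h0, ht₀.2.le⟩ (y t₀) hle
  classical
  set z : ℝ → E := fun t => if t ≤ t₀ then y t else α t with hz
  have zy : ∀ t, t ≤ t₀ → z t = y t := fun t h => if_pos h
  have zα : ∀ t, t₀ ≤ t → z t = α t := fun t h => by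
    rcases h.eq_or_lt with rfl | h
    · rw [zy _ le_rfl, hα0]
    · exact if_neg (not_le.2 h)
  refine ⟨t₀ + τ, by linarith, z, zy 0 h0, fun t ht => ?_⟩
  rcases lt_trichotomy t t₀ with h | h | h
  · rw [zy t h.le]
    refine ((hy t ⟨ht.1, h.trans ht₀.2⟩).Ico_of_lt (h.trans ht₀.2)).congr_of_eventuallyEq ?_
      (zy t h.le)
    filter_upwards [nhdsWithin_le_nhds (Iio_mem_nhds h)] with s hs using zy s (le_of_lt hs)
  · subst h
    have hl : HasDerivWithinAt z (f t (z t)) (Icc 0 t) t := by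
      rw [zy t le_rfl]
      exact ((hy t ⟨ht.1, ht₀.2⟩).mono (Icc_subset_Ico_right ht₀.2)).congr
        (fun s hs => zy s hs.2) (zy t le_rfl)
    have hr : HasDerivWithinAt z (f t (z t)) (Icc t (t + τ)) t := by
      rw [zα t le_rfl]
      exact (hα t ⟨le_rfl, by linarith⟩).congr (fun s hs => zα s hs.1) (zα t le_rfl)
    refine (hl.union hr).mono fun s hs => ?_
    rcases le_total s t with h | h
    · exact Or.inl ⟨hs.1, h⟩
    · exact Or.inr ⟨h, hs.2.le⟩
  · rw [zα t h.le]
    refine HasDerivWithinAt.congr_of_eventuallyEq (f := α) ?_ ?_ (zα t h.le)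
    · refine (hα t ⟨h.le, ht.2.le⟩).mono_of_mem_nhdsWithin ?_
      filter_upwards [self_mem_nhdsWithin, nhdsWithin_le_nhds (Ioi_mem_nhds h)] with s hs hs'
      exact ⟨le_of_lt hs', hs.2.le⟩
    · filter_upwards [nhdsWithin_le_nhds (Ioi_mem_nhds h)] with s hs using zα s (le_of_lt hs)

theorem IsLocLip.exists_maximal [CompleteSpace E] (hf : IsLocLip f) (y₀ : E)
    (hb : BddAbove {T : ℝ | 0 < T ∧ ∃ y : ℝ → E, y 0 = y₀ ∧ IsSol f T y}) :
    ∃ T, 0 < T ∧ ∃ y : ℝ → E, y 0 = y₀ ∧ IsSol f T y ∧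
      Tendsto (fun t => ‖y t‖) (𝓝[<] T) atTop ∧
      ∀ (S : ℝ) (z : ℝ → E), 0 < S → z 0 = y₀ → IsSol f S z → S ≤ T := by
  set S := {T : ℝ | 0 < T ∧ ∃ y : ℝ → E, y 0 = y₀ ∧ IsSol f T y} with hS
  have hne : S.Nonempty := by
    obtain ⟨τ, hτ, hloc⟩ := hf.exists_local 0 ‖y₀‖
    obtain ⟨α, h0, hα⟩ := hloc 0 ⟨le_rfl, le_rfl⟩ y₀ le_rfl
    rw [zero_add] at hα
    exact ⟨τ, hτ, α, h0, fun t ht => (hα t ⟨ht.1, ht.2.le⟩).mono Ico_subset_Icc_self⟩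
  set T := sSup S with hT
  have hlt : ∀ t, ∃ y : ℝ → E, t < T → ∃ τ, t < τ ∧ y 0 = y₀ ∧ IsSol f τ y := fun t => by
    by_cases h : t < T
    · obtain ⟨τ, ⟨-, y, hy⟩, hτ⟩ := exists_lt_of_lt_csSup hne h
      exact ⟨y, fun _ => ⟨τ, hτ, hy⟩⟩
    · exact ⟨fun _ => 0, fun h' => absurd h' h⟩
  choose Y hY using hlt
  set y : ℝ → E := fun t => Y t t with hy
  have heq : ∀ τ (z : ℝ → E), τ ≤ T → z 0 = y₀ → IsSol f τ z → EqOn y z (Ico 0 τ) := by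
    intro τ z hτ hz0 hz t ht
    obtain ⟨τ', h1, h2, h3⟩ := hY t (ht.2.trans_le hτ)
    exact (h3.mono (min_le_left τ' τ)).eqOn hf (hz.mono (min_le_right τ' τ)) (h2.trans hz0.symm)
      ⟨ht.1, lt_min h1 ht.2⟩
  have hle : ∀ τ ∈ S, τ ≤ T := fun τ hτ => le_csSup hb hτ
  have hT0 : 0 < T := by
    obtain ⟨τ, hτ⟩ := hne
    exact hτ.1.trans_le (hle τ hτ)
  have hsol : IsSol f T y := by
    intro t ht
    obtain ⟨τ, h1, h2, h3⟩ := hY t ht.2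
    have hτT : τ ≤ T := hle τ ⟨ht.1.trans_lt h1, _, h2, h3⟩
    have he := heq τ _ hτT h2 h3
    have hd := h3 t ⟨ht.1, h1⟩
    rw [← he ⟨ht.1, h1⟩] at hd
    exact (hd.congr he (he ⟨ht.1, h1⟩)).Ico_of_lt h1
  have hy0 : y 0 = y₀ := by
    obtain ⟨τ, -, h2, -⟩ := hY 0 hT0
    exact h2
  refine ⟨T, hT0, y, hy0, hsol, ?_, fun τ z h1 h2 h3 => hle τ ⟨h1, z, h2, h3⟩⟩
  rw [tendsto_atTop]
  intro R
  by_contra hcon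
  have hfr : ∃ᶠ t in 𝓝[<] T, ‖y t‖ ≤ R := by
    exact fun h => hcon (h.mono fun t ht => (not_le.1 ht).le)
  obtain ⟨T', hT', z, hz0, hz⟩ := hf.exists_extension hT0 hsol hfr
  exact absurd (hle T' ⟨hT0.trans hT', z, hz0.trans hy0, hz⟩) (not_le.2 hT')

theorem IsLocLip.continuous_dependence (hf : IsLocLip f) {T t₁ : ℝ} {y : ℝ → E}
    (hy : IsSol f T y) (ht₁ : t₁ < T) (h0 : 0 ≤ t₁) :
    ∃ δ > 0, ∃ C ≥ 0, ∀ (S : ℝ) (z : ℝ → E), t₁ < S → IsSol f S z → ‖z 0 - y 0‖ ≤ δ →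
      ∀ t ∈ Icc 0 t₁, ‖z t - y t‖ ≤ C * ‖z 0 - y 0‖ := by
  obtain ⟨R, hR0, hR⟩ := hy.continuousOn.exists_norm_le_Icc ht₁
  obtain ⟨K, hK⟩ := hf.lip t₁ (R + 1)
  set C := Real.exp (K * t₁) with hC
  have hC0 : 0 < C := Real.exp_pos _
  refine ⟨1 / (2 * C), by positivity, C, hC0.le, fun S z hS hz hδ => ?_⟩
  have gron : ∀ b ∈ Icc 0 t₁, (∀ s ∈ Ico 0 b, ‖z s - y s‖ ≤ 1) →
      ∀ t ∈ Icc 0 b, ‖z t - y t‖ ≤ C * ‖z 0 - y 0‖ := by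
    intro b hb hs t ht
    have hlt : ∀ s ∈ Ico 0 b, s ∈ Icc 0 t₁ := fun s hs => ⟨hs.1, hs.2.le.trans hb.2⟩
    have h := dist_le_of_trajectories_ODE_of_mem (v := f)
      (s := fun _ => Metric.closedBall 0 (R + 1)) (K := K) (a := 0) (b := b) (f := z) (g := y)
      (δ := ‖z 0 - y 0‖) (fun s hs => hK s (hlt s hs))
      (hz.continuousOn.mono (Icc_subset_Ico_right (hb.2.trans_lt hS)))
      (fun s hs => (hz s ⟨hs.1, (hlt s hs).2.trans_lt hS⟩).Ici_of_Ico
        ⟨hs.1, (hlt s hs).2.trans_lt hS⟩)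
      (fun s hs' => by
        rw [mem_closedBall_zero_iff]
        have h1 := norm_add_le (z s - y s) (y s)
        rw [sub_add_cancel] at h1
        linarith [hR s (hlt s hs'), hs s hs'])
      (hy.continuousOn.mono (Icc_subset_Ico_right (hb.2.trans_lt ht₁)))
      (fun s hs => (hy s ⟨hs.1, (hlt s hs).2.trans_lt ht₁⟩).Ici_of_Ico
        ⟨hs.1, (hlt s hs).2.trans_lt ht₁⟩)
      (fun s hs => by
        rw [mem_closedBall_zero_iff]; linarith [hR s (hlt s hs)])
      (by rw [dist_eq_norm]) t ht
    rw [dist_eq_norm, sub_zero, mul_comm] at h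
    refine h.trans ?_
    gcongr
    rw [hC]
    gcongr
    exact ht.2.trans hb.2
  refine gron t₁ ⟨h0, le_rfl⟩ fun s hs => ?_
  by_contra hcon
  set A := {t ∈ Icc 0 t₁ | 1 ≤ ‖z t - y t‖} with hA
  have hAc : IsCompact A := by
    refine isCompact_Icc.of_isClosed_subset ?_ (sep_subset _ _)
    have hc : ContinuousOn (fun t => ‖z t - y t‖) (Icc 0 t₁) :=
      ((hz.continuousOn.mono (Icc_subset_Ico_right hS)).sub
        (hy.continuousOn.mono (Icc_subset_Ico_right ht₁))).norm
    exact hc.preimage_isClosed_of_isClosed isClosed_Icc isClosed_Ici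
  obtain ⟨b, hb, hmin⟩ := hAc.exists_isLeast ⟨s, ⟨hs.1, hs.2.le⟩, (not_le.1 hcon).le⟩
  have hb2 := gron b hb.1 (fun r hr => by
    by_contra hr'
    exact absurd (hmin ⟨⟨hr.1, hr.2.le.trans hb.1.2⟩, (not_le.1 hr').le⟩) (not_le.2 hr.2)) b
    ⟨hb.1.1, le_rfl⟩
  have : C * ‖z 0 - y 0‖ ≤ 1 / 2 := by
    calc C * ‖z 0 - y 0‖ ≤ C * (1 / (2 * C)) := by gcongr
      _ = 1 / 2 := by field_simp
  linarith [hb.2]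

end AbstractODE

/-- The bounded symbols act on real `L²` functions as Fourier multipliers. -/
noncomputable instance multModule : Module (ℝ →ᵇ ℝ) L2R3 where
  smul m f := mult m f
  one_smul := mult_one
  mul_smul := mult_mul
  smul_zero m := map_zero (mult m)
  smul_add m := map_add (mult m)
  add_smul m n f := by change mult (m + n) f = _; rw [map_add]; rfl
  zero_smul f := by change mult 0 f = _; rw [map_zero]; rfl

theorem mult_eq_smul (m : ℝ →ᵇ ℝ) (f : L2R3) : mult m f = m • f := rfl

theorem continuousWithinAt_mult {m : ℝ → ℝ →ᵇ ℝ} (hC : ∀ τ, ‖m τ‖ ≤ 1 + |τ|)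
    (hm : ∀ x, Continuous fun τ => m τ x) {g : ℝ → L2R3} {s : Set ℝ} {t : ℝ}
    (hg : ContinuousWithinAt g s t) : ContinuousWithinAt (fun τ => mult (m τ) (g τ)) s t := by
  have h1 : ContinuousAt (fun τ => mult (m τ) (g t)) t := by
    have hI : Ioo (t - 1) (t + 1) ∈ 𝓝 t := Ioo_mem_nhds (by linarith) (by linarith)
    refine (continuousWithinAt_mult_apply (C := 2 + |t|) (s := Ioo (t - 1) (t + 1)) (fun τ hτ => ?_)
      ⟨by linarith, by linarith⟩ (fun x => (hm x).continuousWithinAt) (g t)).continuousAt hI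
    have : |τ - t| ≤ 1 := abs_le.2 ⟨by linarith [hτ.1], by linarith [hτ.2]⟩
    have := abs_sub_abs_le_abs_sub τ t
    linarith [hC τ]
  have h2 : Tendsto (fun τ => mult (m τ) (g τ - g t)) (𝓝[s] t) (𝓝 0) := by
    refine squeeze_zero_norm (a := fun τ => (1 + |τ|) * ‖g τ - g t‖) (fun τ => ?_) ?_
    · exact (norm_mult_le _ _).trans (by gcongr; exact hC τ)
    · have h3 : Tendsto (fun τ => ‖g τ - g t‖) (𝓝[s] t) (𝓝 0) := by
        have := (ContinuousWithinAt.sub hg (continuousWithinAt_const (b := g t))).norm.tendsto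
        simpa only [Pi.sub_apply, sub_self, norm_zero] using this
      have h4 : Tendsto (fun τ : ℝ => 1 + |τ|) (𝓝[s] t) (𝓝 (1 + |t|)) :=
        ((continuous_const.add continuous_abs).tendsto t).mono_left nhdsWithin_le_nhds
      simpa using h4.mul h3
  have h5 := h2.add (h1.continuousWithinAt (s := s))
  rw [zero_add] at h5
  refine Tendsto.congr (fun τ => ?_) h5
  rw [map_sub, sub_add_cancel]

theorem norm_cS_le' (t : ℝ) : ‖cS t‖ ≤ 1 + |t| := (norm_cS_le t).trans (by simp)

theorem continuous_cS_apply (x : ℝ) : Continuous fun t => cS t x := by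
  simp only [cS_apply]; fun_prop

theorem continuous_kS_apply (x : ℝ) : Continuous fun t => kS t x := by
  have := Real.continuous_sinc
  simp only [kS_apply, sig]; fun_prop

/-- The first component of the wave propagator on `L² × L²`. -/
noncomputable def waveFst (t : ℝ) (Y : L2R3 × L2R3) : L2R3 := mult (cS t) Y.1 + mult (kS t) Y.2

/-- The second component of the wave propagator on `L² × L²`. -/
noncomputable def waveSnd (t : ℝ) (Y : L2R3 × L2R3) : L2R3 :=
  mult (cS t) Y.2 - mult ((1 - ji ^ 2) * kS t) Y.1

/-- The cube in the algebra `sobMul`. -/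
noncomputable def cubic (a : L2R3) : L2R3 := sobMul (sobMul a a) a

/-- The vector field of the wave equation in the interaction picture. -/
noncomputable def waveField (t : ℝ) (Y : L2R3 × L2R3) : L2R3 × L2R3 :=
  (-mult (kS t) (cubic (mult ji (waveFst t Y))), mult (cS t) (cubic (mult ji (waveFst t Y))))

theorem waveFst_sub (t : ℝ) (Y Z : L2R3 × L2R3) :
    waveFst t Y - waveFst t Z = waveFst t (Y - Z) := by
  simp only [waveFst, Prod.fst_sub, Prod.snd_sub, map_sub]; abel

theorem norm_waveFst_le (t : ℝ) (Y : L2R3 × L2R3) : ‖waveFst t Y‖ ≤ (2 + |t|) * ‖Y‖ := by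
  have h1 : ‖mult (cS t) Y.1‖ ≤ 1 * ‖Y‖ :=
    (norm_mult_le _ _).trans (mul_le_mul (norm_cS_le t) (norm_fst_le Y) (norm_nonneg _) zero_le_one)
  have h2 : ‖mult (kS t) Y.2‖ ≤ (1 + |t|) * ‖Y‖ :=
    (norm_mult_le _ _).trans
      (mul_le_mul (norm_kS_le t) (norm_snd_le Y) (norm_nonneg _) (by positivity))
  calc _ ≤ _ := norm_add_le _ _
    _ ≤ 1 * ‖Y‖ + (1 + |t|) * ‖Y‖ := add_le_add h1 h2
    _ = _ := by ring

theorem norm_mult_ji_le (a : L2R3) : ‖mult ji a‖ ≤ ‖a‖ :=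
  (norm_mult_le _ _).trans (mul_le_of_le_one_left (norm_nonneg _) norm_ji_le)

theorem norm_cubic_le (a : L2R3) : ‖cubic a‖ ≤ ‖sobMul‖ ^ 2 * ‖a‖ ^ 3 := by
  calc ‖cubic a‖ ≤ ‖sobMul‖ * ‖sobMul a a‖ * ‖a‖ := sobMul.le_opNorm₂ _ _
    _ ≤ ‖sobMul‖ * (‖sobMul‖ * ‖a‖ * ‖a‖) * ‖a‖ := by gcongr; exact sobMul.le_opNorm₂ _ _
    _ = _ := by ring

theorem norm_cubic_sub_le {R : ℝ} {a b : L2R3} (ha : ‖a‖ ≤ R) (hb : ‖b‖ ≤ R) :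
    ‖cubic a - cubic b‖ ≤ 3 * ‖sobMul‖ ^ 2 * R ^ 2 * ‖a - b‖ := by
  have hR : 0 ≤ R := (norm_nonneg a).trans ha
  have e : cubic a - cubic b = sobMul (sobMul (a - b) a) a + sobMul (sobMul b (a - b)) a
      + sobMul (sobMul b b) (a - b) := by
    simp only [cubic, map_sub, sub_apply]; abel
  have t : ∀ x y z : L2R3, ‖sobMul (sobMul x y) z‖ ≤ ‖sobMul‖ ^ 2 * (‖x‖ * ‖y‖ * ‖z‖) := by
    intro x y z
    calc _ ≤ ‖sobMul‖ * ‖sobMul x y‖ * ‖z‖ := sobMul.le_opNorm₂ _ _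
      _ ≤ ‖sobMul‖ * (‖sobMul‖ * ‖x‖ * ‖y‖) * ‖z‖ := by gcongr; exact sobMul.le_opNorm₂ _ _
      _ = _ := by ring
  rw [e]
  calc _ ≤ _ := norm_add₃_le
    _ ≤ ‖sobMul‖ ^ 2 * (‖a - b‖ * ‖a‖ * ‖a‖) + ‖sobMul‖ ^ 2 * (‖b‖ * ‖a - b‖ * ‖a‖)
        + ‖sobMul‖ ^ 2 * (‖b‖ * ‖b‖ * ‖a - b‖) := by gcongr <;> exact t _ _ _
    _ ≤ ‖sobMul‖ ^ 2 * (‖a - b‖ * R * R) + ‖sobMul‖ ^ 2 * (R * ‖a - b‖ * R)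
        + ‖sobMul‖ ^ 2 * (R * R * ‖a - b‖) := by gcongr
    _ = _ := by ring

theorem continuous_cubic : Continuous cubic :=
  (sobMul.continuous.comp ((sobMul.continuous.clm_apply continuous_id))).clm_apply continuous_id

theorem norm_mult_pair_le {t : ℝ} (a : L2R3) :
    ‖((-mult (kS t) a, mult (cS t) a) : L2R3 × L2R3)‖ ≤ (1 + |t|) * ‖a‖ := by
  rw [Prod.norm_mk, norm_neg]
  refine max_le ((norm_mult_le _ _).trans ?_) ((norm_mult_le _ _).trans ?_)
  · gcongr; exact norm_kS_le t
  · gcongr; exact norm_cS_le' t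

theorem norm_mult_ji_waveFst_le {T R t : ℝ} (ht : t ∈ Icc 0 T) {Y : L2R3 × L2R3}
    (hY : Y ∈ Metric.closedBall 0 R) : ‖mult ji (waveFst t Y)‖ ≤ (2 + T) * R := by
  rw [mem_closedBall_zero_iff] at hY
  refine (norm_mult_ji_le _).trans ((norm_waveFst_le t Y).trans ?_)
  rw [abs_of_nonneg ht.1]
  have h0 := ht.1; have h1 := ht.2
  have : 0 ≤ 2 + T := by linarith
  gcongr

theorem continuousWithinAt_waveFst {Y : ℝ → L2R3 × L2R3} {s : Set ℝ} {t : ℝ}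
    (hY : ContinuousWithinAt Y s t) : ContinuousWithinAt (fun t => waveFst t (Y t)) s t :=
  (continuousWithinAt_mult norm_cS_le' continuous_cS_apply
    (continuous_fst.continuousAt.comp_continuousWithinAt hY)).add
  (continuousWithinAt_mult norm_kS_le continuous_kS_apply
    (continuous_snd.continuousAt.comp_continuousWithinAt hY))

theorem continuousWithinAt_waveField {Y : ℝ → L2R3 × L2R3} {s : Set ℝ} {t : ℝ}
    (hY : ContinuousWithinAt Y s t) : ContinuousWithinAt (fun t => waveField t (Y t)) s t := by
  have hN : ContinuousWithinAt (fun t => cubic (mult ji (waveFst t (Y t)))) s t :=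
    (continuous_cubic.comp (mult ji).continuous).continuousAt.comp_continuousWithinAt
      (continuousWithinAt_waveFst hY)
  exact ((continuousWithinAt_mult norm_kS_le continuous_kS_apply hN).neg).prodMk
    (continuousWithinAt_mult norm_cS_le' continuous_cS_apply hN)

theorem isLocLip_waveField : IsLocLip waveField where
  lip T R := by
    refine ⟨Real.toNNReal ((1 + T) * (3 * ‖sobMul‖ ^ 2 * ((2 + T) * R) ^ 2 * (2 + T))),
      fun t ht => LipschitzOnWith.of_dist_le_mul fun Y hY Z hZ => ?_⟩
    have h0 := ht.1; have h1 := ht.2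
    have hT : 0 ≤ T := h0.trans h1
    have e : waveField t Y - waveField t Z =
        (-mult (kS t) (cubic (mult ji (waveFst t Y)) - cubic (mult ji (waveFst t Z))),
          mult (cS t) (cubic (mult ji (waveFst t Y)) - cubic (mult ji (waveFst t Z)))) := by
      simp only [waveField, map_sub, Prod.mk_sub_mk]
      congr 1; abel
    rw [dist_eq_norm, dist_eq_norm, e, Real.coe_toNNReal _ (by positivity)]
    refine (norm_mult_pair_le _).trans ?_
    have h2 : ‖mult ji (waveFst t Y) - mult ji (waveFst t Z)‖ ≤ (2 + T) * ‖Y - Z‖ := by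
      rw [← map_sub, waveFst_sub]
      refine (norm_mult_ji_le _).trans ((norm_waveFst_le t _).trans ?_)
      rw [abs_of_nonneg h0]; gcongr
    calc _ ≤ (1 + T) * (3 * ‖sobMul‖ ^ 2 * ((2 + T) * R) ^ 2 * ((2 + T) * ‖Y - Z‖)) := by
          refine mul_le_mul (by rw [abs_of_nonneg h0]; gcongr) ?_ (norm_nonneg _) (by linarith)
          refine (norm_cubic_sub_le (norm_mult_ji_waveFst_le ht hY)
            (norm_mult_ji_waveFst_le ht hZ)).trans ?_
          gcongr
      _ = _ := by ring
  bdd T R := by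
    refine ⟨Real.toNNReal ((1 + T) * (‖sobMul‖ ^ 2 * ((2 + T) * R) ^ 3)), fun t ht Y hY => ?_⟩
    refine le_trans ?_ (Real.le_coe_toNNReal _)
    have h0 := ht.1; have h1 := ht.2
    refine (norm_mult_pair_le _).trans ?_
    refine mul_le_mul (by rw [abs_of_nonneg h0]; gcongr) ((norm_cubic_le _).trans ?_)
      (norm_nonneg _) (by linarith)
    have := norm_mult_ji_waveFst_le ht hY
    gcongr
  cont Y := continuous_iff_continuousAt.2 fun t => by
    exact (continuousWithinAt_univ _ _).1 <| continuousWithinAt_waveField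
      (continuousWithinAt_const (b := Y) (s := univ) (x := t))

theorem HasDerivAt.hasDerivWithinAt_mult {m : ℝ → ℝ →ᵇ ℝ} {m' : ℝ →ᵇ ℝ} {g : ℝ → L2R3}
    {g' : L2R3} {s : Set ℝ} {t : ℝ} (hm : HasDerivAt m m' t) (hg : HasDerivWithinAt g g' s t) :
    HasDerivWithinAt (fun t => mult (m t) (g t)) (mult m' (g t) + mult (m t) g') s t :=
  ((mult.hasFDerivAt.comp_hasDerivAt t hm).hasDerivWithinAt).clm_apply hg

section Derivative

variable {A B : ℝ → L2R3} {N : L2R3} {s : Set ℝ} {t : ℝ}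

theorem hasDerivWithinAt_ji_cube_waveFst
    (hA : HasDerivWithinAt A (-mult (kS t) N) s t) (hB : HasDerivWithinAt B (mult (cS t) N) s t) :
    HasDerivWithinAt (fun t => mult (ji ^ 3) (waveFst t (A t, B t)))
      (mult (ji ^ 2) (waveSnd t (A t, B t))) s t := by
  have h := (mult ji).hasFDerivAt.comp_hasDerivWithinAt t
    (((hasDerivAt_ji_sq_cS t).hasDerivWithinAt_mult hA).add
      ((hasDerivAt_ji_sq_kS t).hasDerivWithinAt_mult hB))
  refine (h.congr_deriv ?_).congr (fun τ _ => ?_) ?_ <;>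
  · simp only [Function.comp_apply, Pi.add_apply, waveFst, waveSnd, mult_eq_smul]
    module

theorem hasDerivWithinAt_ji_sq_waveSnd
    (hA : HasDerivWithinAt A (-mult (kS t) N) s t) (hB : HasDerivWithinAt B (mult (cS t) N) s t) :
    HasDerivWithinAt (fun t => mult (ji ^ 2) (waveSnd t (A t, B t)))
      (mult (ji ^ 2) N - mult ((1 - ji ^ 2) * ji) (waveFst t (A t, B t))) s t := by
  have h := ((hasDerivAt_ji_sq_cS t).hasDerivWithinAt_mult hB).sub
    ((mult (1 - ji ^ 2)).hasFDerivAt.comp_hasDerivWithinAt t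
      ((hasDerivAt_ji_sq_kS t).hasDerivWithinAt_mult hA))
  refine (h.congr_deriv ?_).congr (fun τ _ => ?_) ?_
  · simp only [waveFst, mult_eq_smul]
    have e : N = (cS t * cS t + (1 - ji ^ 2) * (kS t * kS t)) • N := by
      rw [cS_sq_add, one_smul]
    conv_rhs => rw [e]
    module
  all_goals
    simp only [Function.comp_apply, Pi.sub_apply, waveSnd, mult_eq_smul]
    module

end Derivative

theorem waveFst_neg_wave (t : ℝ) (Y : L2R3 × L2R3) :
    waveFst (-t) (waveFst t Y, waveSnd t Y) = Y.1 := by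
  have e : Y.1 = (cS t * cS t + (1 - ji ^ 2) * (kS t * kS t)) • Y.1 := by rw [cS_sq_add, one_smul]
  conv_rhs => rw [e]
  simp only [waveFst, waveSnd, mult_eq_smul, cS_neg, kS_neg]
  module

theorem waveSnd_neg_wave (t : ℝ) (Y : L2R3 × L2R3) :
    waveSnd (-t) (waveFst t Y, waveSnd t Y) = Y.2 := by
  have e : Y.2 = (cS t * cS t + (1 - ji ^ 2) * (kS t * kS t)) • Y.2 := by rw [cS_sq_add, one_smul]
  conv_rhs => rw [e]
  simp only [waveFst, waveSnd, mult_eq_smul, cS_neg, kS_neg]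
  module

theorem waveFst_wave_neg (t : ℝ) (Y : L2R3 × L2R3) :
    waveFst t (waveFst (-t) Y, waveSnd (-t) Y) = Y.1 := by
  simpa using waveFst_neg_wave (-t) Y

theorem waveSnd_wave_neg (t : ℝ) (Y : L2R3 × L2R3) :
    waveSnd t (waveFst (-t) Y, waveSnd (-t) Y) = Y.2 := by
  simpa using waveSnd_neg_wave (-t) Y

theorem waveFst_zero (Y : L2R3 × L2R3) : waveFst 0 Y = Y.1 := by
  simp only [waveFst, cS_zero, kS_zero, mult_one, map_zero, zero_apply, add_zero]

theorem waveSnd_zero (Y : L2R3 × L2R3) : waveSnd 0 Y = Y.2 := by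
  simp only [waveSnd, cS_zero, kS_zero, mult_one, mul_zero, map_zero, zero_apply, sub_zero]

theorem symbol_rpow_mul_ji_pow (k : ℕ) (x : ℝ) :
    ((1 + x ^ 2) ^ ((k : ℝ) / 2) : ℝ) * (ji ^ k) x = 1 := by
  have h0 : (0 : ℝ) ≤ 1 + x ^ 2 := by positivity
  have h1 : √(1 + x ^ 2) ≠ 0 := by positivity
  rw [show (k : ℝ) / 2 = (1 / 2) * k by ring, Real.rpow_mul h0, ← Real.sqrt_eq_rpow,
    Real.rpow_natCast, BoundedContinuousFunction.coe_pow, Pi.pow_apply, ji_apply, ← mul_pow,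
    mul_inv_cancel₀ h1, one_pow]

theorem sobolevNorm_mult_ji_pow (k : ℕ) (F : L2R3) : sobolevNorm k (mult (ji ^ k) F) = ‖F‖ₑ := by
  have h : (fun ξ : R3 => (((1 + (2 * Real.pi * ‖ξ‖) ^ 2) ^ ((k : ℝ) / 2) : ℝ) : ℂ) *
      (𝓕 (toComplexL2 (mult (ji ^ k) F)) : CL2) ξ) =ᵐ[volume] ftL F := by
    have h2 : (𝓕 (toComplexL2 (mult (ji ^ k) F)) : CL2) = mulC (ji ^ k) (ftL F) := by
      rw [← ftL_mult]; rfl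
    rw [h2]
    filter_upwards [mulC_ae (ji ^ k) (ftL F)] with ξ hξ
    rw [hξ, ← mul_assoc, ← Complex.ofReal_mul, symbol_rpow_mul_ji_pow, Complex.ofReal_one, one_mul]
  rw [sobolevNorm, eLpNorm_congr_ae h, ← Lp.enorm_def, ← ofReal_norm, norm_ftL, ofReal_norm]

theorem exists_eq_mult_ji_pow (k : ℕ) {f : L2R3} (hf : sobolevNorm k f < ⊤) :
    ∃ F, mult (ji ^ k) F = f := by
  set g : R3 → ℂ := fun ξ : R3 => (((1 + (2 * Real.pi * ‖ξ‖) ^ 2) ^ ((k : ℝ) / 2) : ℝ) : ℂ) *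
      (𝓕 (toComplexL2 f) : CL2) ξ with hg
  have hgm : MemLp g 2 volume := by
    refine ⟨AEStronglyMeasurable.mul ?_ (Lp.aestronglyMeasurable _), hf⟩
    refine (Complex.continuous_ofReal.comp ?_).aestronglyMeasurable
    exact Continuous.rpow_const (by fun_prop) fun ξ => Or.inr (by positivity)
  have h1 : mulC (ji ^ k) (hgm.toLp g) = ftL f := by
    apply Lp.ext
    filter_upwards [mulC_ae (ji ^ k) (hgm.toLp g), hgm.coeFn_toLp] with ξ h1 h2
    rw [h1, h2, hg, ← mul_assoc, ← Complex.ofReal_mul, mul_comm ((ji ^ k) _),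
      symbol_rpow_mul_ji_pow, Complex.ofReal_one, one_mul]
    rfl
  refine ⟨iftL (hgm.toLp g), ?_⟩
  rw [iftL_apply, ← reL_multC, multC, FourierTransform.fourier_fourierInv_eq, h1, ftL_apply,
    FourierTransform.fourierInv_fourier_eq, reL_ofRealL]

theorem pairNorm_mult (F G : L2R3) :
    pairNorm (mult (ji ^ 3) F) (mult (ji ^ 2) G) = ‖F‖ₑ + ‖G‖ₑ := by
  rw [pairNorm, ← sobolevNorm_mult_ji_pow 3 F, ← sobolevNorm_mult_ji_pow 2 G]
  norm_num

theorem exists_of_pairNorm_lt_top {f g : L2R3} (h : pairNorm f g < ⊤) :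
    ∃ F G, mult (ji ^ 3) F = f ∧ mult (ji ^ 2) G = g := by
  rw [pairNorm, ENNReal.add_lt_top] at h
  obtain ⟨F, hF⟩ := exists_eq_mult_ji_pow 3 (f := f) (by exact_mod_cast h.1)
  obtain ⟨G, hG⟩ := exists_eq_mult_ji_pow 2 (f := g) (by exact_mod_cast h.2)
  exact ⟨F, G, hF, hG⟩

/-- A real Schwartz function, seen as a complex-valued one. -/
noncomputable def complexify (φ : 𝓢(R3, ℝ)) : 𝓢(R3, ℂ) := φ.postcompCLM Complex.ofRealCLM

theorem ofRealL_toLp (φ : 𝓢(R3, ℝ)) : ofRealL (φ.toLp 2) = (complexify φ).toLp 2 := by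
  apply Lp.ext
  filter_upwards [ofRealL_ae (φ.toLp 2), φ.coeFn_toLp 2, (complexify φ).coeFn_toLp 2]
    with x h1 h2 h3
  rw [h1, h2, h3]; rfl

theorem laplacian_complexify (φ : 𝓢(R3, ℝ)) :
    Laplacian.laplacian (complexify φ) = complexify (Laplacian.laplacian φ) := by
  ext x
  rw [SchwartzMap.laplacian_apply]
  have h := ((φ.smooth 2).contDiffAt (x := x)).laplacian_CLM_comp_left (l := Complex.ofRealCLM)
  refine h.trans ?_
  change Complex.ofRealCLM _ = Complex.ofRealCLM _
  rw [SchwartzMap.laplacian_apply]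

theorem mult_ji_sq_laplacian (φ : 𝓢(R3, ℝ)) :
    mult (ji ^ 2) ((Laplacian.laplacian φ).toLp 2) = -mult (1 - ji ^ 2) (φ.toLp 2) := by
  apply ftL_injective
  rw [map_neg, ftL_mult, ftL_mult, ftL_apply, ftL_apply, ofRealL_toLp, ofRealL_toLp,
    ← laplacian_complexify, SchwartzMap.toLp_fourier_eq, SchwartzMap.toLp_fourier_eq]
  apply Lp.ext
  have hL : ∀ ξ, (𝓕 (Laplacian.laplacian (complexify φ))) ξ =
      -(((2 * Real.pi * ‖ξ‖) ^ 2 : ℝ) : ℂ) * (𝓕 (complexify φ)) ξ := by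
    intro ξ
    rw [SchwartzMap.laplacian_eq_fourierMultiplierCLM, FourierTransform.fourier_smul,
      SchwartzMap.fourierMultiplierCLM_apply, FourierTransform.fourier_fourierInv_eq,
      smul_apply,
      SchwartzMap.smulLeftCLM_apply_apply (by fun_prop)]
    simp only [Complex.real_smul]
    push_cast; ring
  filter_upwards [mulC_ae (ji ^ 2) ((𝓕 (Laplacian.laplacian (complexify φ))).toLp 2),
    mulC_ae (1 - ji ^ 2) ((𝓕 (complexify φ)).toLp 2),
    (𝓕 (Laplacian.laplacian (complexify φ))).coeFn_toLp 2, (𝓕 (complexify φ)).coeFn_toLp 2,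
    Lp.coeFn_neg (mulC (1 - ji ^ 2) ((𝓕 (complexify φ)).toLp 2))] with ξ h1 h2 h3 h4 h5
  rw [h1, h5, Pi.neg_apply, h2, h3, h4, hL]
  simp only [BoundedContinuousFunction.coe_sub, BoundedContinuousFunction.coe_one,
    BoundedContinuousFunction.coe_pow, Pi.sub_apply, Pi.one_apply, Pi.pow_apply, one_sub_ji_sq]
  push_cast; ring

theorem integral_mul_schwartz (f : L2R3) (φ : 𝓢(R3, ℝ)) :
    ∫ x, f x * φ x = ⟪f, φ.toLp 2⟫_ℝ := by
  rw [L2.inner_def]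
  refine integral_congr_ae ?_
  filter_upwards [φ.coeFn_toLp 2] with x h
  simp [h, mul_comm]

theorem eq_zero_of_inner_schwartz {g : L2R3} (h : ∀ φ : 𝓢(R3, ℝ), ⟪g, φ.toLp 2⟫_ℝ = 0) :
    g = 0 := by
  have hd := SchwartzMap.denseRange_toLpCLM (E := R3) (F := ℝ) (p := 2) (by simp)
    (μ := (volume : Measure R3))
  have h2 := DenseRange.equalizer (g := fun x : L2R3 => ⟪g, x⟫_ℝ) (h := fun _ => 0) hd (by fun_prop)
    continuous_const (funext fun φ => h φ)
  exact inner_self_eq_zero.1 (congrFun h2 g)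

theorem mult_ji_sq_cubic_ae (a : L2R3) :
    mult (ji ^ 2) (cubic a) =ᵐ[volume] fun x => (mult (ji ^ 2) a x) ^ 3 := by
  filter_upwards [mult_ji_sq_ae (cubic a), mult_ji_sq_ae a] with x h1 h2
  rw [h1, h2, cubic, ev_sobMul, ev_sobMul]; ring

theorem isLaplacianAddCube_iff (a b : L2R3) :
    IsLaplacianAddCube (mult (ji ^ 2) a) b ↔ b = mult (ji ^ 2) (cubic a) - mult (1 - ji ^ 2) a := by
  have key : ∀ φ : 𝓢(R3, ℝ), (∫ x, mult (ji ^ 2) a x * (Laplacian.laplacian φ) x)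
      + ∫ x, (mult (ji ^ 2) a x) ^ 3 * φ x =
        ⟪mult (ji ^ 2) (cubic a) - mult (1 - ji ^ 2) a, φ.toLp 2⟫_ℝ := by
    intro φ
    have h1 : ∫ x, (mult (ji ^ 2) a x) ^ 3 * φ x = ∫ x, mult (ji ^ 2) (cubic a) x * φ x := by
      refine integral_congr_ae ?_
      filter_upwards [mult_ji_sq_cubic_ae a] with x hx
      rw [hx]
    rw [h1, integral_mul_schwartz, integral_mul_schwartz, mult_symm, mult_ji_sq_laplacian,
      inner_neg_right, ← mult_symm, inner_sub_left]
    ring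
  constructor
  · intro h
    rw [← sub_eq_zero]
    refine eq_zero_of_inner_schwartz fun φ => ?_
    rw [inner_sub_left, ← key, ← h φ, integral_mul_schwartz, sub_self]
  · rintro rfl φ
    rw [key, integral_mul_schwartz]

theorem HasDerivWithinAt.of_injective {E : Type*} [NormedAddCommGroup E] [NormedSpace ℝ E]
    [CompleteSpace E] {L : E →L[ℝ] E} (hL : Function.Injective L) {T : ℝ} {y g : ℝ → E}
    (hg : ContinuousOn g (Ico 0 T))
    (h : ∀ t ∈ Ico 0 T, HasDerivWithinAt (fun t => L (y t)) (L (g t)) (Ico 0 T) t) :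
    ∀ t ∈ Ico 0 T, HasDerivWithinAt y (g t) (Ico 0 T) t := by
  intro t ht
  obtain ⟨S, htS, hST⟩ := exists_between ht.2
  have h0S : 0 ≤ S := ht.1.trans htS.le
  set g' : ℝ → E := IccExtend h0S ((Icc 0 S).domRestrict g) with hg'
  have hgc : Continuous g' :=
    ((hg.mono (Icc_subset_Ico_right hST)).domRestrict).Icc_extend'
  have hgg : ∀ s ∈ Icc 0 S, g' s = g s := fun s hs => by
    rw [hg', IccExtend_of_mem _ _ hs]; rfl
  set z : ℝ → E := fun t => y 0 + ∫ s in (0 : ℝ)..t, g' s with hz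
  have hzd : ∀ s, HasDerivAt z (g' s) s := fun s =>
    ((hgc.integral_hasStrictDerivAt 0 s).hasDerivAt).const_add _
  have hyz : ∀ s ∈ Ico 0 S, y s = z s := by
    intro s hs
    have hd : ∀ r ∈ Ico 0 s, HasDerivWithinAt (fun t => L (y t) - L (z t)) 0 (Ici r) r := by
      intro r hr
      have hrT : r ∈ Ico 0 T := ⟨hr.1, (hr.2.trans hs.2).trans hST⟩
      have h1 := (h r hrT).Ici_of_Ico hrT
      have h2 := (L.hasFDerivAt.comp_hasDerivAt r (hzd r)).hasDerivWithinAt (s := Ici r)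
      refine (h1.sub h2).congr_deriv ?_
      rw [hgg r ⟨hr.1, (hr.2.trans hs.2).le⟩, sub_self]
    have hc : ContinuousOn (fun t => L (y t) - L (z t)) (Icc 0 s) := by
      refine ContinuousOn.sub (fun r hr => ?_) (fun r _ => ?_)
      · exact (h r ⟨hr.1, (hr.2.trans_lt hs.2).trans hST⟩).continuousWithinAt.mono
          (Icc_subset_Ico_right (hs.2.trans hST))
      · exact (L.continuous.continuousAt.comp (hzd r).continuousAt).continuousWithinAt
    have h3 := constant_of_has_deriv_right_zero hc hd s ⟨hs.1, le_rfl⟩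
    apply hL
    have h4 : z 0 = y 0 := by simp [hz]
    rw [h4, sub_self] at h3
    exact sub_eq_zero.1 h3
  have h5 : HasDerivWithinAt y (g t) (Ico 0 S) t := by
    rw [← hgg t ⟨ht.1, htS.le⟩]
    exact (hzd t).hasDerivWithinAt.congr hyz (hyz t ⟨ht.1, htS⟩)
  exact h5.Ico_of_lt htS

/-- The position component of the pair with interaction-picture state `Y`. -/
noncomputable def position (Y : ℝ → L2R3 × L2R3) (t : ℝ) : L2R3 := mult (ji ^ 3) (waveFst t (Y t))

/-- The velocity component of the pair with interaction-picture state `Y`. -/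
noncomputable def velocity (Y : ℝ → L2R3 × L2R3) (t : ℝ) : L2R3 := mult (ji ^ 2) (waveSnd t (Y t))

theorem continuousWithinAt_waveSnd {Y : ℝ → L2R3 × L2R3} {s : Set ℝ} {t : ℝ}
    (hY : ContinuousWithinAt Y s t) : ContinuousWithinAt (fun t => waveSnd t (Y t)) s t := by
  have h := (continuousWithinAt_mult norm_kS_le continuous_kS_apply
    (continuous_fst.continuousAt.comp_continuousWithinAt hY))
  have h2 := (mult (1 - ji ^ 2)).continuous.continuousAt.comp_continuousWithinAt h
  refine ((continuousWithinAt_mult norm_cS_le' continuous_cS_apply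
    (continuous_snd.continuousAt.comp_continuousWithinAt hY)).sub h2).congr (fun τ _ => ?_) ?_ <;>
  · simp only [waveSnd, mult_mul]; rfl

theorem tendsto_enorm_sub {y : ℝ → L2R3} {s : Set ℝ} {t : ℝ} :
    Tendsto (fun τ => ‖y τ - y t‖ₑ) (𝓝[s] t) (𝓝 0) ↔ ContinuousWithinAt y s t := by
  simp only [← edist_eq_enorm_sub]
  exact tendsto_iff_edist_tendsto_0.symm

theorem IsSol.isSolution {T : ℝ} {Y : ℝ → L2R3 × L2R3} (h : IsSol waveField T Y) :
    IsSolution T (position Y 0) (velocity Y 0) (position Y) (velocity Y) where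
  init_fst := rfl
  init_snd := rfl
  finite t ht := by
    rw [position, velocity, pairNorm_mult]; exact ENNReal.add_lt_top.2 ⟨enorm_lt_top, enorm_lt_top⟩
  continuous t ht := by
    have hc := (h t ht).continuousWithinAt
    simp only [position, velocity, ← map_sub, pairNorm_mult]
    simpa using (tendsto_enorm_sub.2 (continuousWithinAt_waveFst hc)).add
      (tendsto_enorm_sub.2 (continuousWithinAt_waveSnd hc))
  deriv_fst t ht := hasDerivWithinAt_ji_cube_waveFst (A := fun t => (Y t).1) (B := fun t => (Y t).2)
    (h t ht).fst (h t ht).snd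
  deriv_snd t ht := by
    refine ⟨_, hasDerivWithinAt_ji_sq_waveSnd (A := fun t => (Y t).1) (B := fun t => (Y t).2)
      (h t ht).fst (h t ht).snd, ?_⟩
    rw [position, show (ji ^ 3 : ℝ →ᵇ ℝ) = ji ^ 2 * ji by ring, mult_mul, isLaplacianAddCube_iff,
      mult_mul]

theorem IsSolution.exists_isSol {T : ℝ} {v₀ v₁ : L2R3} {v w : ℝ → L2R3}
    (h : IsSolution T v₀ v₁ v w) : ∃ Y : ℝ → L2R3 × L2R3, IsSol waveField T Y ∧
      ∀ t ∈ Ico 0 T, position Y t = v t ∧ velocity Y t = w t := by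
  have hex : ∀ t, ∃ Z : L2R3 × L2R3, t ∈ Ico 0 T →
      mult (ji ^ 3) Z.1 = v t ∧ mult (ji ^ 2) Z.2 = w t := by
    intro t
    by_cases ht : t ∈ Ico 0 T
    · obtain ⟨F, G, h1, h2⟩ := exists_of_pairNorm_lt_top (h.finite t ht)
      exact ⟨(F, G), fun _ => ⟨h1, h2⟩⟩
    · exact ⟨0, fun h' => absurd h' ht⟩
  choose Z hZ using hex
  have hZc : ContinuousOn Z (Ico 0 T) := by
    intro t ht
    have h1 : Tendsto (fun τ => ‖(Z τ).1 - (Z t).1‖ₑ + ‖(Z τ).2 - (Z t).2‖ₑ) (𝓝[Ico 0 T] t)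
        (𝓝 0) := by
      refine (h.continuous t ht).congr' ?_
      filter_upwards [self_mem_nhdsWithin] with τ hτ
      rw [← (hZ τ hτ).1, ← (hZ τ hτ).2, ← (hZ t ht).1, ← (hZ t ht).2, ← map_sub, ← map_sub,
        pairNorm_mult]
    have h2 := tendsto_enorm_sub.1 (tendsto_of_tendsto_of_tendsto_of_le_of_le tendsto_const_nhds h1
      (fun _ => zero_le) (fun _ => le_self_add))
    have h3 := tendsto_enorm_sub.1 (tendsto_of_tendsto_of_tendsto_of_le_of_le tendsto_const_nhds h1
      (fun _ => zero_le) (fun _ => le_add_self))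
    exact h2.prodMk h3
  set Y : ℝ → L2R3 × L2R3 := fun t => (waveFst (-t) (Z t), waveSnd (-t) (Z t)) with hY
  have hYF : ∀ t, waveFst t (Y t) = (Z t).1 := fun t => waveFst_wave_neg t (Z t)
  have hYG : ∀ t, waveSnd t (Y t) = (Z t).2 := fun t => waveSnd_wave_neg t (Z t)
  have hNc : ContinuousOn (fun t => cubic (mult ji (Z t).1)) (Ico 0 T) := fun t ht =>
    (continuous_cubic.comp ((mult ji).continuous.comp
      continuous_fst)).continuousAt.comp_continuousWithinAt (hZc t ht)
  have hw : ∀ t ∈ Ico 0 T, HasDerivWithinAt w (mult (ji ^ 2) (cubic (mult ji (Z t).1)) -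
      mult (1 - ji ^ 2) (mult ji (Z t).1)) (Ico 0 T) t := by
    intro t ht
    obtain ⟨a, ha, hl⟩ := h.deriv_snd t ht
    rw [← (hZ t ht).1, show (ji ^ 3 : ℝ →ᵇ ℝ) = ji ^ 2 * ji by ring, mult_mul,
      isLaplacianAddCube_iff] at hl
    rwa [← hl]
  have hinj : Function.Injective (mult (ji ^ 5)) := mult_ji_pow_injective 5
  have hA : ∀ t ∈ Ico 0 T, HasDerivWithinAt (fun t => (Y t).1)
      (-mult (kS t) (cubic (mult ji (Z t).1))) (Ico 0 T) t := by
    refine HasDerivWithinAt.of_injective hinj (fun t ht =>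
      (continuousWithinAt_mult norm_kS_le continuous_kS_apply (hNc t ht)).neg) fun t ht => ?_
    have h1 := ((hasDerivAt_ji_sq_cS t).hasDerivWithinAt_mult (h.deriv_fst t ht)).sub
      ((mult ji).hasFDerivAt.comp_hasDerivWithinAt t
        ((hasDerivAt_ji_sq_kS t).hasDerivWithinAt_mult (hw t ht)))
    have e : ∀ τ ∈ Ico 0 T, mult (ji ^ 5) (Y τ).1 = mult (ji ^ 2 * cS τ) (v τ) -
        mult ji (mult (ji ^ 2 * kS τ) (w τ)) := by
      intro τ hτ
      rw [← (hZ τ hτ).1, ← (hZ τ hτ).2]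
      simp only [hY, waveFst, cS_neg, kS_neg, mult_eq_smul]
      module
    refine (h1.congr_deriv ?_).congr e (e t ht)
    rw [← (hZ t ht).1, ← (hZ t ht).2]
    simp only [mult_eq_smul]
    module
  have hB : ∀ t ∈ Ico 0 T, HasDerivWithinAt (fun t => (Y t).2)
      (mult (cS t) (cubic (mult ji (Z t).1))) (Ico 0 T) t := by
    refine HasDerivWithinAt.of_injective hinj (fun t ht =>
      (continuousWithinAt_mult norm_cS_le' continuous_cS_apply (hNc t ht))) fun t ht => ?_
    have h1 := ((mult (1 - ji ^ 2)).hasFDerivAt.comp_hasDerivWithinAt t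
      ((hasDerivAt_ji_sq_kS t).hasDerivWithinAt_mult (h.deriv_fst t ht))).add
      ((mult ji).hasFDerivAt.comp_hasDerivWithinAt t
        ((hasDerivAt_ji_sq_cS t).hasDerivWithinAt_mult (hw t ht)))
    have e : ∀ τ ∈ Ico 0 T, mult (ji ^ 5) (Y τ).2 =
        mult (1 - ji ^ 2) (mult (ji ^ 2 * kS τ) (v τ)) + mult ji (mult (ji ^ 2 * cS τ) (w τ)) := by
      intro τ hτ
      rw [← (hZ τ hτ).1, ← (hZ τ hτ).2]
      simp only [hY, waveSnd, cS_neg, kS_neg, mult_eq_smul]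
      module
    refine (h1.congr_deriv ?_).congr e (e t ht)
    rw [← (hZ t ht).1, ← (hZ t ht).2]
    simp only [mult_eq_smul]
    module
  refine ⟨Y, fun t ht => ?_, fun t ht => ?_⟩
  · rw [waveField, hYF]
    exact (hA t ht).prodMk (hB t ht)
  · rw [position, velocity, hYF, hYG]
    exact hZ t ht

theorem state_zero_injective {Y Z : ℝ → L2R3 × L2R3} (h1 : position Y 0 = position Z 0)
    (h2 : velocity Y 0 = velocity Z 0) : Y 0 = Z 0 := by
  rw [position, position, waveFst_zero, waveFst_zero] at h1
  rw [velocity, velocity, waveSnd_zero, waveSnd_zero] at h2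
  exact Prod.ext (mult_ji_pow_injective 3 h1) (mult_ji_pow_injective 2 h2)

theorem IsRadial.isRotInvariant {f : L2R3} (h : IsRadial f) : IsRotInvariant f := by
  intro R
  obtain ⟨g, hg⟩ := h
  apply Lp.ext
  filter_upwards [compIso_ae R f, hg, R.measurePreserving.quasiMeasurePreserving.ae hg]
    with x h1 h2 h3
  rw [h1, Function.comp_apply, h3, h2, R.norm_map]

theorem compIso_sobMul (R : R3 ≃ₗᵢ[ℝ] R3) (a b : L2R3) :
    compIso R (sobMul a b) = sobMul (compIso R a) (compIso R b) :=
  ev_injective fun x => by simp only [ev_compIso, ev_sobMul]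

theorem compIso_cubic (R : R3 ≃ₗᵢ[ℝ] R3) (a : L2R3) :
    compIso R (cubic a) = cubic (compIso R a) := by
  simp only [cubic, compIso_sobMul]

theorem IsRotInvariant.of_mult_ji_pow {k : ℕ} {a : L2R3} (h : IsRotInvariant (mult (ji ^ k) a)) :
    IsRotInvariant a := fun R => mult_ji_pow_injective k (by rw [mult_compIso, h R])

theorem IsRotInvariant.cubic {a : L2R3} (h : IsRotInvariant a) : IsRotInvariant (cubic a) :=
  fun R => by rw [compIso_cubic, h R]

theorem IsRotInvariant.add {a b : L2R3} (ha : IsRotInvariant a) (hb : IsRotInvariant b) :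
    IsRotInvariant (a + b) := fun R => by rw [map_add, ha R, hb R]

theorem IsRotInvariant.sub {a b : L2R3} (ha : IsRotInvariant a) (hb : IsRotInvariant b) :
    IsRotInvariant (a - b) := fun R => by rw [map_sub, ha R, hb R]

theorem waveFst_compIso (R : R3 ≃ₗᵢ[ℝ] R3) (t : ℝ) (Y : L2R3 × L2R3) :
    waveFst t (compIso R Y.1, compIso R Y.2) = compIso R (waveFst t Y) := by
  simp only [waveFst, mult_compIso, map_add]

theorem IsSol.isRotInvariant {T : ℝ} {Y : ℝ → L2R3 × L2R3} (h : IsSol waveField T Y)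
    (h1 : IsRotInvariant (Y 0).1) (h2 : IsRotInvariant (Y 0).2) {t : ℝ} (ht : t ∈ Ico 0 T) :
    IsRotInvariant (Y t).1 ∧ IsRotInvariant (Y t).2 := by
  have key : ∀ R : R3 ≃ₗᵢ[ℝ] R3, (compIso R (Y t).1, compIso R (Y t).2) = Y t := by
    intro R
    refine IsSol.eqOn isLocLip_waveField (y := fun t => (compIso R (Y t).1, compIso R (Y t).2))
      (fun s hs => ?_) h ?_ ht
    · refine (((compIso R).hasFDerivAt.comp_hasDerivWithinAt s (h s hs).fst).prodMk
        ((compIso R).hasFDerivAt.comp_hasDerivWithinAt s (h s hs).snd)).congr_deriv ?_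
      simp only [waveField, waveFst_compIso, mult_compIso, ← compIso_cubic, map_neg]
    · exact Prod.ext (h1 R) (h2 R)
  exact ⟨fun R => congrArg Prod.fst (key R), fun R => congrArg Prod.snd (key R)⟩

theorem waveFst_wave (r t : ℝ) (Y : L2R3 × L2R3) :
    waveFst r (waveFst t Y, waveSnd t Y) = waveFst (r + t) Y := by
  simp only [waveFst, waveSnd, mult_eq_smul, cS_add, kS_add]
  module

theorem waveSnd_wave (r t : ℝ) (Y : L2R3 × L2R3) :
    waveSnd r (waveFst t Y, waveSnd t Y) = waveSnd (r + t) Y := by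
  simp only [waveFst, waveSnd, mult_eq_smul, cS_add, kS_add]
  module

theorem waveFst_forcing (c s : ℝ) (N : L2R3) :
    waveFst c (-mult (kS s) N, mult (cS s) N) = mult (kS (c - s)) N := by
  rw [sub_eq_add_neg, kS_add, kS_neg, cS_neg]
  simp only [waveFst, mult_eq_smul]
  module

theorem waveSnd_forcing (c s : ℝ) (N : L2R3) :
    waveSnd c (-mult (kS s) N, mult (cS s) N) = mult (cS (c - s)) N := by
  rw [sub_eq_add_neg, cS_add, kS_neg, cS_neg]
  simp only [waveSnd, mult_eq_smul]
  module

/-- The propagator `waveFst t` as a continuous linear map. -/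
noncomputable def waveFstL (t : ℝ) : L2R3 × L2R3 →L[ℝ] L2R3 := (mult (cS t)).coprod (mult (kS t))

theorem waveFstL_apply (t : ℝ) (Y : L2R3 × L2R3) : waveFstL t Y = waveFst t Y := rfl

/-- The propagator `waveSnd t` as a continuous linear map. -/
noncomputable def waveSndL (t : ℝ) : L2R3 × L2R3 →L[ℝ] L2R3 :=
  (-mult ((1 - ji ^ 2) * kS t)).coprod (mult (cS t))

theorem waveSndL_apply (t : ℝ) (Y : L2R3 × L2R3) : waveSndL t Y = waveSnd t Y := by
  rw [waveSndL, ContinuousLinearMap.coprod_apply, neg_apply, neg_add_eq_sub]; rfl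

/-- The value at `x` of the position component at time `t` of the state `Y`. -/
noncomputable def posVal (Y : ℝ → L2R3 × L2R3) (t : ℝ) (x : R3) : ℝ :=
  ev x (mult ji (waveFst t (Y t)))

/-- For radial solutions, `r` times the value of the solution at radius `r`. -/
noncomputable def radW (Y : ℝ → L2R3 × L2R3) (t r : ℝ) : ℝ :=
  ev 0 (mult (ji ^ 2 * kS r) (waveFst t (Y t)))

/-- For radial solutions, the outgoing derivative `(∂ₜ + ∂ᵣ) (r u)`. -/
noncomputable def radP (Y : ℝ → L2R3 × L2R3) (t r : ℝ) : ℝ :=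
  ev 0 (mult ji (waveFst (r + t) (Y t)))

theorem radP_eq (Y : ℝ → L2R3 × L2R3) (t r : ℝ) : radP Y t r =
    ev 0 (mult (ji * cS r) (waveFst t (Y t))) + ev 0 (mult (ji * kS r) (waveSnd t (Y t))) := by
  rw [radP, ← waveFst_wave, waveFst, map_add, map_add, mult_mul, mult_mul]

section Transport

variable {T : ℝ} {Y : ℝ → L2R3 × L2R3}

/-- The states of radial solutions. -/
structure IsRadSol (T : ℝ) (Y : ℝ → L2R3 × L2R3) : Prop where
  isSol : IsSol waveField T Y
  fst : ∀ t ∈ Ico 0 T, IsRotInvariant (Y t).1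
  snd : ∀ t ∈ Ico 0 T, IsRotInvariant (Y t).2

theorem IsRadSol.waveFst (h : IsRadSol T Y) {t : ℝ} (ht : t ∈ Ico 0 T) :
    IsRotInvariant (waveFst t (Y t)) :=
  ((h.fst t ht).map_mult _).add ((h.snd t ht).map_mult _)

theorem IsRadSol.waveSnd (h : IsRadSol T Y) {t : ℝ} (ht : t ∈ Ico 0 T) :
    IsRotInvariant (waveSnd t (Y t)) :=
  ((h.snd t ht).map_mult _).sub ((h.fst t ht).map_mult _)

theorem IsRadSol.radW_eq (h : IsRadSol T Y) {t : ℝ} (ht : t ∈ Ico 0 T) (x : R3) :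
    radW Y t ‖x‖ = ‖x‖ * posVal Y t x := by
  rw [posVal, ((h.waveFst ht).map_mult ji).norm_mul_ev, radW, ← mult_mul]
  congr 3; ring

theorem hasDerivAt_ev_ji_sq_kS (F : L2R3) (r : ℝ) :
    HasDerivAt (fun r => ev 0 (mult (ji ^ 2 * kS r) F)) (ev 0 (mult (ji * cS r) F)) r :=
  (ev 0).hasFDerivAt.comp_hasDerivAt r
    ((ContinuousLinearMap.apply ℝ L2R3 F).hasFDerivAt.comp_hasDerivAt r
      (mult.hasFDerivAt.comp_hasDerivAt r (hasDerivAt_ji_sq_kS r)))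

theorem radW_zero (Y : ℝ → L2R3 × L2R3) (t : ℝ) : radW Y t 0 = 0 := by
  rw [radW, kS_zero, mul_zero, map_zero, zero_apply, map_zero]

theorem IsSol.hasDerivWithinAt_radP (h : IsSol waveField T Y) (c : ℝ) {s : ℝ} (hs : s ∈ Ico 0 T) :
    HasDerivWithinAt (fun s => radP Y s (c - s))
      (ev 0 (mult (ji * kS (c - s)) (cubic (mult ji (waveFst s (Y s)))))) (Ico 0 T) s := by
  have h1 := (ev 0).hasFDerivAt.comp_hasDerivWithinAt s ((mult ji).hasFDerivAt.comp_hasDerivWithinAt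
    s ((waveFstL c).hasFDerivAt.comp_hasDerivWithinAt s (h s hs)))
  refine (h1.congr_deriv ?_).congr (fun τ _ => ?_) ?_
  · rw [waveFstL_apply, waveField, waveFst_forcing, mult_mul]
  · rw [radP, sub_add_cancel]; rfl
  · rw [radP, sub_add_cancel]; rfl

theorem IsRadSol.hasDerivWithinAt_radP (h : IsRadSol T Y) (c : ℝ) {s : ℝ} (hs : s ∈ Ico 0 T)
    {x : R3} (hx : ‖x‖ = c - s) :
    HasDerivWithinAt (fun s => radP Y s (c - s)) (‖x‖ * posVal Y s x ^ 3) (Ico 0 T) s := by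
  refine (h.isSol.hasDerivWithinAt_radP c hs).congr_deriv ?_
  rw [← hx, ← (((h.waveFst hs).map_mult ji).cubic).norm_mul_ev, posVal, _root_.cubic, ev_sobMul,
    ev_sobMul]
  ring

theorem hasDerivAt_ji_sq_kS_mul_cS (c s : ℝ) :
    HasDerivAt (fun s => ji ^ 2 * (kS (c + s) * cS s)) (ji * cS (c + 2 * s)) s := by
  have e : (fun s => ji ^ 2 * (kS (c + s) * cS s)) =
      fun s => (2⁻¹ : ℝ) • (ji ^ 2 * kS (c + 2 * s) + ji ^ 2 * kS c) := by
    funext s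
    have h1 : kS (c + 2 * s) = kS (c + s) * cS s + cS (c + s) * kS s := by
      rw [← kS_add]; congr 1; ring
    have h2 : kS c = kS (c + s) * cS s - cS (c + s) * kS s := by
      have h3 := kS_add (c + s) (-s)
      rw [add_neg_cancel_right, cS_neg, kS_neg] at h3
      exact h3.trans (by ring)
    rw [h1, h2, ← mul_add, add_add_sub_cancel, ← two_smul ℝ, mul_smul_comm, smul_smul]
    norm_num
  rw [e]
  have h1 := (hasDerivAt_ji_sq_kS (c + 2 * s)).scomp s
    (((hasDerivAt_id s).const_mul 2).const_add c)
  refine ((h1.add_const (ji ^ 2 * kS c)).const_smul (2⁻¹ : ℝ)).congr_deriv ?_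
  rw [mul_one, smul_smul]; norm_num

theorem IsSol.hasDerivWithinAt_radW (h : IsSol waveField T Y) (c : ℝ) {s : ℝ} (hs : s ∈ Ico 0 T) :
    HasDerivWithinAt (fun s => radW Y s (c + s)) (radP Y s (c + s)) (Ico 0 T) s := by
  have h1 := (ev 0).hasFDerivAt.comp_hasDerivWithinAt s
    (((hasDerivAt_ji_sq_kS_mul_cS c s).hasDerivWithinAt_mult (h s hs).fst).add
      ((hasDerivAt_ji_sq_kS_mul_kS c s).hasDerivWithinAt_mult (h s hs).snd))
  refine (h1.congr_deriv ?_).congr (fun τ _ => ?_) ?_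
  · rw [radP, show c + s + s = c + 2 * s by ring]
    have h2 : kS (c + 2 * s) = kS (c + s) * cS s + cS (c + s) * kS s := by
      rw [← kS_add]; congr 1; ring
    congr 1
    simp only [waveField, waveFst, mult_eq_smul]
    rw [h2]
    module
  all_goals
    rw [radW]
    simp only [Function.comp_apply, Pi.add_apply]
    congr 1
    simp only [_root_.waveFst, mult_eq_smul]
    module

end Transport

theorem hasDerivWithinAt_ji_sq_waveFst {A B : ℝ → L2R3} {N : L2R3} {s : Set ℝ} {t : ℝ}
    (hA : HasDerivWithinAt A (-mult (kS t) N) s t) (hB : HasDerivWithinAt B (mult (cS t) N) s t) :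
    HasDerivWithinAt (fun t => mult (ji ^ 2) (waveFst t (A t, B t)))
      (mult ji (waveSnd t (A t, B t))) s t := by
  have h := ((hasDerivAt_ji_sq_cS t).hasDerivWithinAt_mult hA).add
      ((hasDerivAt_ji_sq_kS t).hasDerivWithinAt_mult hB)
  refine (h.congr_deriv ?_).congr (fun τ _ => ?_) ?_ <;>
  · simp only [Pi.add_apply, waveFst, waveSnd, mult_eq_smul]
    module

theorem IsSol.shift {T a : ℝ} {Y : ℝ → L2R3 × L2R3} (h : IsSol waveField T Y) (ha : 0 ≤ a) :
    IsSol waveField (T - a) (fun t => (waveFst a (Y (t + a)), waveSnd a (Y (t + a)))) := by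
  intro t ht
  have h1 : HasDerivWithinAt (fun t => Y (t + a)) (waveField (t + a) (Y (t + a)))
      (Ico 0 (T - a)) t := by
    have hm : MapsTo (fun s => s + a) (Ico 0 (T - a)) (Ico 0 T) :=
      fun s hs => ⟨by linarith [hs.1], by linarith [hs.2]⟩
    have := (h (t + a) ⟨by linarith [ht.1], by linarith [ht.2]⟩).scomp t
      ((hasDerivWithinAt_id t (Ico 0 (T - a))).add_const a) hm
    simpa using! this
  refine (((waveFstL a).hasFDerivAt.comp_hasDerivWithinAt t h1).prodMk
    (((waveSndL a).hasFDerivAt.comp_hasDerivWithinAt t h1).congr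
      (fun τ _ => (waveSndL_apply _ _).symm) (waveSndL_apply _ _).symm)).congr_deriv ?_
  rw [waveFstL_apply, waveSndL_apply, waveField, waveFst_forcing, waveSnd_forcing, waveField,
    waveFst_wave, sub_add_cancel_right, kS_neg, cS_neg, map_neg, neg_apply, add_comm t a]

theorem norm_ji_sq_cubic_sub_le {M : ℝ} {a b : L2R3} (ha : ∀ x, |ev x a| ≤ M)
    (hb : ∀ x, |ev x b| ≤ M) :
    ‖mult (ji ^ 2) (cubic a) - mult (ji ^ 2) (cubic b)‖ ≤ 3 * M ^ 2 * ‖mult (ji ^ 2) (a - b)‖ := by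
  refine Lp.norm_le_mul_norm_of_ae_le_mul ?_
  filter_upwards [Lp.coeFn_sub (mult (ji ^ 2) (cubic a)) (mult (ji ^ 2) (cubic b)),
    mult_ji_sq_ae (cubic a), mult_ji_sq_ae (cubic b), mult_ji_sq_ae (a - b)] with x h1 h2 h3 h4
  rw [h1, Pi.sub_apply, h2, h3, h4, map_sub, cubic, cubic, ev_sobMul, ev_sobMul, ev_sobMul,
    ev_sobMul, Real.norm_eq_abs, Real.norm_eq_abs]
  have ha := ha x; have hb := hb x
  have h0 : 0 ≤ M := (abs_nonneg _).trans ha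
  generalize ev x a = p at *
  generalize ev x b = q at *
  rw [show p * p * p - q * q * q = (p * p + p * q + q * q) * (p - q) by ring, abs_mul]
  gcongr
  calc |p * p + p * q + q * q| ≤ |p * p| + |p * q| + |q * q| := abs_add_three _ _ _
    _ = |p| * |p| + |p| * |q| + |q| * |q| := by simp only [abs_mul]
    _ ≤ M * M + M * M + M * M := by gcongr
    _ = 3 * M ^ 2 := by ring

/-- The smoothing `(1 - Δ)⁻¹` on pairs. -/
noncomputable def jiSqPair : L2R3 × L2R3 →L[ℝ] L2R3 × L2R3 :=
  (mult (ji ^ 2)).prodMap (mult (ji ^ 2))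

theorem jiSqPair_apply (Y : L2R3 × L2R3) :
    jiSqPair Y = (mult (ji ^ 2) Y.1, mult (ji ^ 2) Y.2) := rfl

theorem waveFst_jiSqPair (t : ℝ) (Y : L2R3 × L2R3) :
    waveFst t (jiSqPair Y) = mult (ji ^ 2) (waveFst t Y) := by
  simp only [jiSqPair_apply, waveFst, mult_eq_smul]
  module

theorem waveSnd_jiSqPair (t : ℝ) (Y : L2R3 × L2R3) :
    waveSnd t (jiSqPair Y) = mult (ji ^ 2) (waveSnd t Y) := by
  simp only [jiSqPair_apply, waveSnd, mult_eq_smul]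
  module

theorem waveSnd_sub (t : ℝ) (Y Z : L2R3 × L2R3) :
    waveSnd t Y - waveSnd t Z = waveSnd t (Y - Z) := by
  simp only [waveSnd, Prod.fst_sub, Prod.snd_sub, map_sub]; abel

theorem norm_waveSnd_le (t : ℝ) (Y : L2R3 × L2R3) :
    ‖waveSnd t Y‖ ≤ (1 + ‖(1 - ji ^ 2 : ℝ →ᵇ ℝ)‖ * (1 + |t|)) * ‖Y‖ := by
  have h1 : ‖mult (cS t) Y.2‖ ≤ 1 * ‖Y‖ :=
    (norm_mult_le _ _).trans (mul_le_mul (norm_cS_le t) (norm_snd_le Y) (norm_nonneg _) zero_le_one)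
  have h2 : ‖mult ((1 - ji ^ 2) * kS t) Y.1‖ ≤ ‖(1 - ji ^ 2 : ℝ →ᵇ ℝ)‖ * (1 + |t|) * ‖Y‖ :=
    (norm_mult_le _ _).trans (mul_le_mul ((norm_mul_le _ _).trans
      (by gcongr; exact norm_kS_le t)) (norm_fst_le Y) (norm_nonneg _) (by positivity))
  calc _ ≤ _ := norm_sub_le _ _
    _ ≤ 1 * ‖Y‖ + ‖(1 - ji ^ 2 : ℝ →ᵇ ℝ)‖ * (1 + |t|) * ‖Y‖ := add_le_add h1 h2
    _ = _ := by ring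

theorem IsSol.norm_jiSqPair_sub_le {T M : ℝ} {Y Z : ℝ → L2R3 × L2R3} (hY : IsSol waveField T Y)
    (hZ : IsSol waveField T Z) (hYM : ∀ t ∈ Ico 0 T, ∀ x, |posVal Y t x| ≤ M)
    (hZM : ∀ t ∈ Ico 0 T, ∀ x, |posVal Z t x| ≤ M) {t : ℝ} (ht : t ∈ Ico 0 T) :
    ‖jiSqPair (Y t - Z t)‖ ≤
      ‖jiSqPair (Y 0 - Z 0)‖ * Real.exp ((1 + T) * (3 * M ^ 2 * (2 + T)) * T) := by
  have hT : 0 ≤ T := ht.1.trans ht.2.le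
  have sub : ∀ s ∈ Icc 0 t, s ∈ Ico 0 T := fun s hs => ⟨hs.1, hs.2.trans_lt ht.2⟩
  have h := norm_le_gronwallBound_of_norm_deriv_right_le (f := fun t => jiSqPair (Y t - Z t))
    (f' := fun t => jiSqPair (waveField t (Y t) - waveField t (Z t)))
    (δ := ‖jiSqPair (Y 0 - Z 0)‖) (K := (1 + T) * (3 * M ^ 2 * (2 + T))) (ε := 0) (a := 0) (b := t)
    (fun s hs => jiSqPair.continuous.continuousAt.comp_continuousWithinAt
      (((hY.continuousOn.sub hZ.continuousOn) s (sub s hs)).mono sub))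
    (fun s hs => jiSqPair.hasFDerivAt.comp_hasDerivWithinAt s
      (((hY s (sub s ⟨hs.1, hs.2.le⟩)).Ici_of_Ico (sub s ⟨hs.1, hs.2.le⟩)).sub
        ((hZ s (sub s ⟨hs.1, hs.2.le⟩)).Ici_of_Ico (sub s ⟨hs.1, hs.2.le⟩))))
    le_rfl (fun s hs => ?_) t ⟨ht.1, le_rfl⟩
  · rw [gronwallBound_ε0, sub_zero] at h
    refine h.trans ?_
    gcongr
    exact ht.2.le
  · have hs' := sub s ⟨hs.1, hs.2.le⟩
    have e : jiSqPair (waveField s (Y s) - waveField s (Z s)) =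
        (-mult (kS s) (mult (ji ^ 2) (cubic (mult ji (waveFst s (Y s))))
            - mult (ji ^ 2) (cubic (mult ji (waveFst s (Z s))))),
          mult (cS s) (mult (ji ^ 2) (cubic (mult ji (waveFst s (Y s))))
            - mult (ji ^ 2) (cubic (mult ji (waveFst s (Z s)))))) := by
      simp only [jiSqPair_apply, waveField, Prod.mk_sub_mk, mult_eq_smul, Prod.mk.injEq]
      constructor <;> module
    have e2 : mult (ji ^ 2) (mult ji (waveFst s (Y s)) - mult ji (waveFst s (Z s))) =
        mult ji (waveFst s (jiSqPair (Y s - Z s))) := by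
      rw [waveFst_jiSqPair, ← waveFst_sub]
      simp only [mult_eq_smul]
      module
    rw [add_zero, e]
    have h3 : ‖mult ji (waveFst s (jiSqPair (Y s - Z s)))‖ ≤ (2 + T) * ‖jiSqPair (Y s - Z s)‖ := by
      refine (norm_mult_ji_le _).trans ((norm_waveFst_le s _).trans ?_)
      rw [abs_of_nonneg hs'.1]
      gcongr
      exact hs'.2.le
    calc _ ≤ (1 + |s|) * _ := norm_mult_pair_le _
      _ ≤ (1 + T) * (3 * M ^ 2 * ((2 + T) * ‖jiSqPair (Y s - Z s)‖)) := by
        refine mul_le_mul (by rw [abs_of_nonneg hs'.1]; linarith [hs'.2]) ?_ (norm_nonneg _)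
          (by linarith)
        refine (norm_ji_sq_cubic_sub_le (hYM s hs') (hZM s hs')).trans ?_
        rw [e2]
        gcongr
      _ = _ := by ring

theorem cubic_zero : cubic 0 = 0 := by simp [cubic]

theorem isSol_zero (T : ℝ) : IsSol waveField T 0 := by
  intro t _
  have e : waveField t 0 = 0 := by
    have h : waveFst t 0 = 0 := by simp [waveFst]
    rw [waveField, h, map_zero, cubic_zero, map_zero, map_zero, neg_zero]; rfl
  rw [Pi.zero_apply, e]
  exact hasDerivWithinAt_const _ _ _

theorem HasDerivWithinAt.norm_le_of_eventually {E : Type*} [NormedAddCommGroup E]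
    [NormedSpace ℝ E] {f : ℝ → E} {f' : E} {t C : ℝ} (hf : HasDerivWithinAt f f' (Ici t) t)
    (h : ∀ᶠ a in 𝓝[>] (0 : ℝ), ‖f (t + a) - f t‖ ≤ C * a) : ‖f'‖ ≤ C := by
  rw [hasDerivWithinAt_iff_tendsto_slope, Ici_sdiff_left] at hf
  have hadd : Tendsto (fun a : ℝ => t + a) (𝓝[>] 0) (𝓝[>] t) := by
    refine tendsto_nhdsWithin_iff.2 ⟨?_, ?_⟩
    · have : Tendsto (fun a : ℝ => t + a) (𝓝 0) (𝓝 (t + 0)) :=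
        (continuous_const.add continuous_id).tendsto 0
      rw [add_zero] at this
      exact this.mono_left nhdsWithin_le_nhds
    · filter_upwards [self_mem_nhdsWithin] with a ha
      simpa using ha
  refine le_of_tendsto (hf.comp hadd).norm ?_
  filter_upwards [h, self_mem_nhdsWithin] with a h1 h2
  have ha : 0 < a := h2
  rw [Function.comp_apply, slope, vsub_eq_sub, norm_smul, add_sub_cancel_left, norm_inv,
    Real.norm_of_nonneg ha.le, inv_mul_le_iff₀ ha, mul_comm]
  exact h1

/-- A solution that is bounded in `L^∞` is bounded in `H³ × H²`. -/
theorem IsSol.exists_norm_le {T M : ℝ} {Y : ℝ → L2R3 × L2R3} (hT : 0 < T)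
    (hY : IsSol waveField T Y) (hYM : ∀ t ∈ Ico 0 T, ∀ x, |posVal Y t x| ≤ M) :
    ∃ R, ∀ t ∈ Ico 0 T, ‖Y t‖ ≤ R := by
  have hM : 0 ≤ M := (abs_nonneg _).trans (hYM 0 ⟨le_rfl, hT⟩ 0)
  set c := Real.exp ((1 + T) * (3 * M ^ 2 * (2 + T)) * T) with hc
  have hZM : ∀ t ∈ Ico 0 T, ∀ x, |posVal 0 t x| ≤ M := fun t _ x => by
    simpa [posVal, waveFst] using hM
  have hev0 : ∀ x, |ev x 0| ≤ M := fun x => by simpa using hM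
  set C₁ := (2 + T) * (‖jiSqPair (Y 0)‖ * c) with hC₁
  have hpos : ∀ t ∈ Ico 0 T, ‖mult (ji ^ 3) (waveFst t (Y t))‖ ≤ C₁ := by
    intro t ht
    have h1 := hY.norm_jiSqPair_sub_le (isSol_zero T) hYM hZM ht
    simp only [Pi.zero_apply, sub_zero] at h1
    rw [show (ji ^ 3 : ℝ →ᵇ ℝ) = ji * ji ^ 2 by ring, mult_mul, ← waveFst_jiSqPair]
    refine (norm_mult_ji_le _).trans ((norm_waveFst_le t _).trans ?_)
    rw [abs_of_nonneg ht.1, hC₁]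
    have := ht.2.le
    gcongr
  have hN : ∀ t ∈ Ico 0 T, ‖mult (ji ^ 2) (cubic (mult ji (waveFst t (Y t))))‖ ≤
      3 * M ^ 2 * C₁ := by
    intro t ht
    have h1 := norm_ji_sq_cubic_sub_le (hYM t ht) hev0
    rw [cubic_zero, map_zero, sub_zero, sub_zero, ← mult_mul, ← pow_succ] at h1
    exact h1.trans (by gcongr; exact hpos t ht)
  have h0T : (0 : ℝ) ∈ Ico 0 T := ⟨le_rfl, hT⟩
  obtain ⟨C₂, hC₂⟩ : ∃ C, ∀ᶠ a in 𝓝[>] (0 : ℝ),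
      ‖jiSqPair ((waveFst a (Y a), waveSnd a (Y a)) - Y 0)‖ ≤ C * a := by
    have h1 := (hasDerivWithinAt_ji_sq_waveFst (A := fun t => (Y t).1) (B := fun t => (Y t).2)
      (hY 0 h0T).fst (hY 0 h0T).snd).prodMk
      (hasDerivWithinAt_ji_sq_waveSnd (A := fun t => (Y t).1) (B := fun t => (Y t).2)
      (hY 0 h0T).fst (hY 0 h0T).snd)
    have h2 := h1.Ici_of_Ico h0T
    obtain ⟨C, hC⟩ := h2.hasFDerivWithinAt.isBigO_sub.bound
    refine ⟨C, ?_⟩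
    filter_upwards [nhdsWithin_mono _ Ioi_subset_Ici_self hC, self_mem_nhdsWithin] with a h3 h4
    have ha : (0 : ℝ) < a := h4
    rw [sub_zero, Real.norm_of_nonneg ha.le] at h3
    refine le_trans (le_of_eq ?_) h3
    simp only [waveFst_zero, waveSnd_zero, Prod.mk.eta]
    rw [map_sub]
    rfl
  set C₃ := (1 + ‖(1 - ji ^ 2 : ℝ →ᵇ ℝ)‖ * (1 + T)) * (C₂ * c) with hC₃
  have hw : ∀ t ∈ Ico 0 T, ‖mult (ji ^ 2) (cubic (mult ji (waveFst t (Y t)))) -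
      mult ((1 - ji ^ 2) * ji) (waveFst t (Y t))‖ ≤ C₃ := by
    intro t ht
    refine ((hasDerivWithinAt_ji_sq_waveSnd (A := fun t => (Y t).1) (B := fun t => (Y t).2)
      (hY t ht).fst (hY t ht).snd).Ici_of_Ico ht).norm_le_of_eventually ?_
    filter_upwards [hC₂, self_mem_nhdsWithin,
      nhdsWithin_le_nhds (Iio_mem_nhds (show 0 < T - t by linarith [ht.2]))] with a h1 h2 h3
    have ha : (0 : ℝ) < a := h2
    have haT : a < T - t := h3
    have hsh := hY.shift ha.le
    have h4 := hsh.norm_jiSqPair_sub_le (hY.mono (by linarith : T - a ≤ T)) (M := M)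
      (fun s hs x => by
        rw [posVal, waveFst_wave]
        exact hYM (s + a) ⟨by linarith [hs.1], by linarith [hs.2]⟩ x)
      (fun s hs => hYM s ⟨hs.1, by linarith [hs.2]⟩) (t := t) ⟨ht.1, by linarith⟩
    have h5 : ‖jiSqPair ((waveFst a (Y (t + a)), waveSnd a (Y (t + a))) - Y t)‖ ≤ C₂ * a * c := by
      refine h4.trans ?_
      rw [zero_add]
      have : T - a ≤ T := by linarith
      have : 0 ≤ T - a := by linarith [ht.1]
      have := (norm_nonneg _).trans h1
      rw [hc]
      gcongr
    have e : mult (ji ^ 2) (waveSnd (t + a) ((Y (t + a)).1, (Y (t + a)).2)) -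
        mult (ji ^ 2) (waveSnd t ((Y t).1, (Y t).2)) =
        waveSnd t (jiSqPair ((waveFst a (Y (t + a)), waveSnd a (Y (t + a))) - Y t)) := by
      rw [waveSnd_jiSqPair, ← waveSnd_sub, waveSnd_wave, map_sub]
    rw [e]
    refine (norm_waveSnd_le t _).trans ?_
    rw [abs_of_nonneg ht.1]
    calc _ ≤ (1 + ‖(1 - ji ^ 2 : ℝ →ᵇ ℝ)‖ * (1 + T)) * (C₂ * a * c) := by
          have := ht.2.le
          gcongr
      _ = C₃ * a := by rw [hC₃]; ring
  set C₄ := 3 * M ^ 2 * C₁ + C₃ + C₁ with hC₄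
  have hH2 : ∀ t ∈ Ico 0 T, ‖mult ji (waveFst t (Y t))‖ ≤ C₄ := by
    intro t ht
    have e : mult ji (waveFst t (Y t)) = mult (ji ^ 2) (cubic (mult ji (waveFst t (Y t)))) -
        (mult (ji ^ 2) (cubic (mult ji (waveFst t (Y t)))) -
          mult ((1 - ji ^ 2) * ji) (waveFst t (Y t))) + mult (ji ^ 3) (waveFst t (Y t)) := by
      simp only [mult_eq_smul]
      module
    rw [e]
    exact (norm_add_le _ _).trans (add_le_add ((norm_sub_le _ _).trans
      (add_le_add (hN t ht) (hw t ht))) (hpos t ht))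
  refine ⟨‖Y 0‖ + (1 + T) * (‖sobMul‖ ^ 2 * C₄ ^ 3) * T, fun t ht => ?_⟩
  have hF : ∀ s ∈ Ico 0 T, ‖waveField s (Y s)‖ ≤ (1 + T) * (‖sobMul‖ ^ 2 * C₄ ^ 3) := by
    intro s hs
    refine (norm_mult_pair_le _).trans ?_
    rw [abs_of_nonneg hs.1]
    have h1 := hH2 s hs
    have h2 := hs.2.le
    refine mul_le_mul (by linarith) ((norm_cubic_le _).trans (by gcongr)) (norm_nonneg _)
      (by linarith)
  have h1 := norm_image_sub_le_of_norm_deriv_le_segment' (f := Y) (a := 0) (b := t)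
    (C := (1 + T) * (‖sobMul‖ ^ 2 * C₄ ^ 3))
    (fun s hs => (hY s ⟨hs.1, hs.2.trans_lt ht.2⟩).mono (Icc_subset_Ico_right ht.2))
    (fun s hs => hF s ⟨hs.1, hs.2.trans ht.2⟩) t ⟨ht.1, le_rfl⟩
  have h2 : ‖Y t‖ ≤ ‖Y 0‖ + ‖Y t - Y 0‖ := by
    have := norm_add_le (Y 0) (Y t - Y 0)
    rwa [add_sub_cancel] at this
  refine h2.trans (add_le_add le_rfl (h1.trans ?_))
  rw [sub_zero]
  have := (norm_nonneg _).trans (hF t ht)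
  gcongr
  exact ht.2.le

theorem image_ge_of_deriv_ge {f f' : ℝ → ℝ} {a b K L : ℝ} (hab : a ≤ b) (hL : 0 < L)
    (hf : ∀ s ∈ Icc a b, HasDerivWithinAt f (f' s) (Icc a b) s)
    (hf' : ∀ s ∈ Icc a b, -(K * Real.exp (L * s)) ≤ f' s) :
    f a - K / L * (Real.exp (L * b) - Real.exp (L * a)) ≤ f b := by
  have hmono : MonotoneOn (fun s => f s + K / L * Real.exp (L * s)) (Icc a b) := by
    have hd : ∀ s ∈ Icc a b, HasDerivWithinAt (fun s => f s + K / L * Real.exp (L * s))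
        (f' s + K * Real.exp (L * s)) (Icc a b) s := by
      intro s hs
      have h1 := (((hasDerivAt_id s).const_mul L).exp.const_mul (K / L)).hasDerivWithinAt
        (s := Icc a b)
      refine ((hf s hs).add h1).congr_deriv ?_
      simp only [id, mul_one]
      field_simp
    refine monotoneOn_of_hasDerivWithinAt_nonneg (convex_Icc a b)
      (fun s hs => (hd s hs).continuousWithinAt)
      (fun s hs => (hd s (interior_subset hs)).mono interior_subset) fun s hs => ?_
    linarith [hf' s (interior_subset hs)]
  have h := hmono ⟨le_rfl, hab⟩ ⟨hab, le_rfl⟩ hab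
  simp only at h
  linarith

/-- Positivity for the radial wave equation `(∂ₜ - ∂ᵣ)(∂ₜ + ∂ᵣ) D = q D`, `q ≥ 0`, on a truncated
backward light cone, written along characteristics with `P = (∂ₜ + ∂ᵣ) D`. -/
theorem cone_nonneg {a b ρ A C : ℝ} {D P q : ℝ → ℝ → ℝ}
    (hD0 : ∀ r, 0 ≤ r → r + a ≤ ρ → 0 ≤ D a r) (hP0 : ∀ r, 0 ≤ r → r + a ≤ ρ → 0 ≤ P a r)
    (hb : ∀ t ∈ Icc a b, 0 ≤ D t 0)
    (hD : ∀ c, ∀ s ∈ Icc a b, 0 ≤ c + s →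
      HasDerivWithinAt (fun s => D s (c + s)) (P s (c + s)) (Icc a b ∩ {s | 0 ≤ c + s}) s)
    (hP : ∀ c, ∀ s ∈ Icc a b, 0 ≤ c - s →
      HasDerivWithinAt (fun s => P s (c - s)) (q s (c - s) * D s (c - s))
        (Icc a b ∩ {s | 0 ≤ c - s}) s)
    (hq : ∀ t ∈ Icc a b, ∀ r, 0 ≤ r → 0 ≤ q t r ∧ q t r ≤ C)
    (hA : ∀ t ∈ Icc a b, ∀ r, 0 ≤ r → r + t ≤ ρ → -A ≤ D t r ∧ -A ≤ P t r)
    {t r : ℝ} (ht : t ∈ Icc a b) (hr : 0 ≤ r) (hrt : r + t ≤ ρ) :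
    0 ≤ D t r ∧ 0 ≤ P t r := by
  set B := max A 0 with hB
  have hB0 : 0 ≤ B := le_max_right _ _
  set L := 2 * max 1 C with hL
  have hL1 : 2 ≤ L := by rw [hL]; linarith [le_max_left 1 C]
  have hLC : 2 * C ≤ L := by rw [hL]; linarith [le_max_right 1 C]
  have hL0 : 0 < L := by linarith
  set K : ℕ → ℝ := fun n => B * Real.exp (-(L * a)) / 2 ^ n with hK
  have hK0 : ∀ n, 0 ≤ K n := fun n => by positivity
  have key : ∀ n, ∀ t ∈ Icc a b, ∀ r, 0 ≤ r → r + t ≤ ρ →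
      -(K n * Real.exp (L * t)) ≤ D t r ∧ -(K n * Real.exp (L * t)) ≤ P t r := by
    intro n
    induction n with
    | zero =>
      intro t ht r hr hrt
      have h1 : B ≤ K 0 * Real.exp (L * t) := by
        simp only [hK]
        rw [pow_zero, div_one, mul_assoc, ← Real.exp_add]
        refine le_mul_of_one_le_right hB0 (Real.one_le_exp ?_)
        nlinarith [ht.1]
      obtain ⟨h2, h3⟩ := hA t ht r hr hrt
      have := le_max_left A 0
      exact ⟨by linarith, by linarith⟩
    | succ n ih =>
      intro t ht r hr hrt
      have hKs : K n = 2 * K (n + 1) := by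
        simp only [hK, pow_succ]; field_simp
      have hKn := hK0 (n + 1)
      constructor
      · set s₀ := max a (t - r) with hs₀
        have hst : s₀ ≤ t := max_le ht.1 (by linarith)
        have has : a ≤ s₀ := le_max_left _ _
        have hrs : t - r ≤ s₀ := le_max_right _ _
        have hsub : Icc s₀ t ⊆ Icc a b := Icc_subset_Icc has ht.2
        have h0 : 0 ≤ D s₀ (r - t + s₀) := by
          rcases max_cases a (t - r) with ⟨h1, h2⟩ | ⟨h1, h2⟩
          · rw [hs₀, h1]
            exact hD0 _ (by linarith) (by linarith [ht.1])
          · rw [hs₀, h1, show r - t + (t - r) = 0 by ring]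
            exact hb _ ⟨h2.le, by linarith [ht.2]⟩
        have h1 := image_ge_of_deriv_ge (f := fun s => D s (r - t + s)) (K := K n) hst hL0
          (fun s hs => (hD (r - t) s (hsub hs) (by linarith [hs.1])).mono
            fun τ hτ => ⟨hsub hτ, by simp only [mem_ofPred_eq]; linarith [hτ.1]⟩)
          (fun s hs => (ih s (hsub hs) _ (by linarith [hs.1]) (by linarith [hs.2])).2)
        simp only [sub_add_cancel] at h1
        have h2 : K n / L * (Real.exp (L * t) - Real.exp (L * s₀)) ≤
            K (n + 1) * Real.exp (L * t) := by
          have : K n / L ≤ K (n + 1) := by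
            rw [div_le_iff₀ hL0, hKs]; nlinarith
          refine mul_le_mul this (by linarith [Real.exp_pos (L * s₀)]) ?_ hKn
          rw [sub_nonneg]
          gcongr
        linarith
      · have hsub : Icc a t ⊆ Icc a b := Icc_subset_Icc le_rfl ht.2
        have h0 : 0 ≤ P a (r + t - a) := hP0 _ (by linarith [ht.1]) (by linarith)
        have h1 := image_ge_of_deriv_ge (f := fun s => P s (r + t - s)) (K := max 1 C * K n)
          ht.1 hL0 (fun s hs => (hP (r + t) s (hsub hs) (by linarith [hs.2])).mono
            fun τ hτ => ⟨hsub hτ, by simp only [mem_ofPred_eq]; linarith [hτ.2]⟩)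
          (fun s hs => by
            obtain ⟨h2, h3⟩ := hq s (hsub hs) (r + t - s) (by linarith [hs.2])
            have h4 := (ih s (hsub hs) (r + t - s) (by linarith [hs.2]) (by linarith)).1
            have h5 : 0 ≤ K n * Real.exp (L * s) := mul_nonneg (hK0 n) (Real.exp_pos _).le
            have h6 : C ≤ max 1 C := le_max_right _ _
            rw [mul_assoc]
            nlinarith)
        simp only [add_sub_cancel_right] at h1
        have h2 : max 1 C * K n / L * (Real.exp (L * t) - Real.exp (L * a)) ≤
            K (n + 1) * Real.exp (L * t) := by
          have : max 1 C * K n / L = K (n + 1) := by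
            have : max 1 C ≠ 0 := by
              have := le_max_left 1 C
              intro h; linarith
            rw [hL, hKs]; field_simp
          rw [this]
          have := Real.exp_pos (L * a)
          gcongr
          linarith
        linarith
  have hlim : Tendsto (fun n => -(K n * Real.exp (L * t))) atTop (𝓝 0) := by
    have h1 : Tendsto (fun n : ℕ => B * Real.exp (-(L * a)) / 2 ^ n) atTop (𝓝 0) :=
      tendsto_const_nhds.div_atTop (tendsto_pow_atTop_atTop_of_one_lt one_lt_two)
    simpa [hK] using (h1.mul_const (Real.exp (L * t))).neg
  exact ⟨le_of_tendsto' hlim fun n => (key n t ht r hr hrt).1,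
    le_of_tendsto' hlim fun n => (key n t ht r hr hrt).2⟩

/-- A point of `ℝ³` at distance `|r|` from the origin. -/
noncomputable def radPt (r : ℝ) : R3 := EuclideanSpace.single 0 r

theorem norm_radPt {r : ℝ} (hr : 0 ≤ r) : ‖radPt r‖ = r := by
  rw [radPt, PiLp.norm_single, Real.norm_of_nonneg hr]

theorem IsRadSol.radW_eq_radPt {T : ℝ} {Y : ℝ → L2R3 × L2R3} (h : IsRadSol T Y) {t r : ℝ}
    (ht : t ∈ Ico 0 T) (hr : 0 ≤ r) : radW Y t r = r * posVal Y t (radPt r) := by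
  have := h.radW_eq ht (radPt r)
  rwa [norm_radPt hr] at this

theorem radP_zero (Y : ℝ → L2R3 × L2R3) (t : ℝ) : radP Y t 0 = posVal Y t 0 := by
  rw [radP, posVal, zero_add]

theorem abs_ev_waveFst_le (x : R3) (t : ℝ) (Z : L2R3 × L2R3) :
    |ev x (mult ji (waveFst t Z))| ≤ sobConst * ((2 + |t|) * ‖Z‖) :=
  (abs_ev_le _ _).trans (mul_le_mul_of_nonneg_left
    ((norm_mult_ji_le _).trans (norm_waveFst_le t Z)) sobConst_nonneg)

theorem posVal_sub (Y Z : ℝ → L2R3 × L2R3) (t : ℝ) (x : R3) :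
    posVal Y t x - posVal Z t x = ev x (mult ji (waveFst t (Y t - Z t))) := by
  rw [posVal, posVal, ← map_sub, ← map_sub, waveFst_sub]

theorem radP_sub (Y Z : ℝ → L2R3 × L2R3) (t r : ℝ) :
    radP Y t r - radP Z t r = ev 0 (mult ji (waveFst (r + t) (Y t - Z t))) := by
  rw [radP, radP, ← map_sub, ← map_sub, waveFst_sub]

/-- Comparison of a radial solution with a function `u` such that
`(∂ₜ + ∂ᵣ) (r u) = P` and `(∂ₜ - ∂ᵣ) P = r u³` on a truncated backward light cone. -/
theorem IsRadSol.comparison {T : ℝ} {Y : ℝ → L2R3 × L2R3} (h : IsRadSol T Y) {a b ρ M M' σ : ℝ}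
    (ha : 0 ≤ a) (hbT : b < T) (hσ : σ = 1 ∨ σ = -1) {u P : ℝ → ℝ → ℝ}
    (hW : ∀ c, ∀ s ∈ Icc a b, 0 ≤ c + s →
      HasDerivWithinAt (fun s => (c + s) * u s (c + s)) (P s (c + s))
        (Icc a b ∩ {s | 0 ≤ c + s}) s)
    (hP : ∀ c, ∀ s ∈ Icc a b, 0 ≤ c - s →
      HasDerivWithinAt (fun s => P s (c - s)) ((c - s) * u s (c - s) ^ 3)
        (Icc a b ∩ {s | 0 ≤ c - s}) s)
    (hu : ∀ t ∈ Icc a b, ∀ r, 0 ≤ r → |u t r| ≤ M)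
    (hPb : ∀ t ∈ Icc a b, ∀ r, 0 ≤ r → r + t ≤ ρ → |P t r| ≤ M')
    (hu0 : ∀ r, 0 ≤ r → r + a ≤ ρ → r * u a r ≤ σ * radW Y a r)
    (hP0 : ∀ r, 0 ≤ r → r + a ≤ ρ → P a r ≤ σ * radP Y a r)
    {t r : ℝ} (ht : t ∈ Icc a b) (hr : 0 ≤ r) (hrt : r + t ≤ ρ) :
    r * u t r ≤ σ * radW Y t r ∧ P t r ≤ σ * radP Y t r := by
  have hsub : Icc a b ⊆ Ico 0 T := fun s hs => ⟨ha.trans hs.1, hs.2.trans_lt hbT⟩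
  obtain ⟨R, hR0, hR⟩ := h.isSol.continuousOn.exists_norm_le_Icc hbT
  have hRn : ∀ s ∈ Icc a b, ‖Y s‖ ≤ R := fun s hs => hR s ⟨ha.trans hs.1, hs.2⟩
  have hσa : |σ| = 1 := by rcases hσ with rfl | rfl <;> simp
  set V := sobConst * ((2 + b) * R) with hV
  have hv : ∀ s ∈ Icc a b, ∀ x, |σ * posVal Y s x| ≤ V := by
    intro s hs x
    rw [abs_mul, hσa, one_mul]
    refine (abs_ev_waveFst_le _ _ _).trans ?_
    rw [abs_of_nonneg (ha.trans hs.1)]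
    have := hs.2; have := hRn s hs; have := sobConst_nonneg
    have : 0 ≤ s := ha.trans hs.1
    have : 0 ≤ 2 + b := by linarith
    rw [hV]
    gcongr
  have hVM : ∀ s ∈ Icc a b, ∀ r, 0 ≤ r → |σ * posVal Y s (radPt r) - u s r| ≤ V + M :=
    fun s hs r hr => (abs_sub _ _).trans (add_le_add (hv s hs _) (hu s hs r hr))
  have hWe : ∀ s ∈ Icc a b, ∀ r, 0 ≤ r → σ * radW Y s r - r * u s r =
      r * (σ * posVal Y s (radPt r) - u s r) := fun s hs r hr => by
    rw [h.radW_eq_radPt (hsub hs) hr]; ring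
  have key := cone_nonneg (a := a) (b := b) (ρ := ρ) (C := 3 * (V + M) ^ 2)
    (A := |ρ - a| * (V + M) + (sobConst * ((2 + |ρ|) * R) + M'))
    (D := fun t r => σ * radW Y t r - r * u t r) (P := fun t r => σ * radP Y t r - P t r)
    (q := fun t r => (σ * posVal Y t (radPt r)) ^ 2 + σ * posVal Y t (radPt r) * u t r + u t r ^ 2)
    (fun r hr hra => sub_nonneg.2 (hu0 r hr hra)) (fun r hr hra => sub_nonneg.2 (hP0 r hr hra))
    (fun t _ => by simp [radW_zero])
    (fun c s hs hcs => ((((h.isSol.hasDerivWithinAt_radW c (hsub hs)).mono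
      (inter_subset_left.trans hsub)).const_mul σ).sub
      (hW c s hs hcs)))
    (fun c s hs hcs => by
      refine ((((h.hasDerivWithinAt_radP c (hsub hs) (norm_radPt hcs)).mono
        (inter_subset_left.trans hsub)).const_mul σ).sub
        (hP c s hs hcs)).congr_deriv ?_
      rw [hWe s hs _ hcs, norm_radPt hcs]
      rcases hσ with rfl | rfl <;> ring)
    (fun t ht r hr => by
      have h1 := abs_le.1 (hv t ht (radPt r))
      have h2 := abs_le.1 (hu t ht r hr)
      have hV0 : 0 ≤ V := (abs_nonneg _).trans (hv t ht (radPt r))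
      have hM0 : 0 ≤ M := (abs_nonneg _).trans (hu t ht r hr)
      generalize σ * posVal Y t (radPt r) = p at *
      generalize u t r = q at *
      constructor
      · nlinarith [sq_nonneg (p + q), sq_nonneg p, sq_nonneg q]
      · nlinarith [sq_nonneg (p - q), mul_nonneg hV0 hM0, mul_nonneg (sub_nonneg.2 h1.2)
          (by linarith [h1.1] : 0 ≤ p + V), mul_nonneg (sub_nonneg.2 h2.2)
          (by linarith [h2.1] : 0 ≤ q + M)])
    (fun t ht r hr hrt => by
      have h1 := hVM t ht r hr
      have hVM0 : 0 ≤ V + M := (abs_nonneg _).trans h1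
      have hM' := (abs_nonneg _).trans (hPb t ht r hr hrt)
      have h0 : 0 ≤ t := ha.trans ht.1
      have h2 : |σ * radP Y t r - P t r| ≤ sobConst * ((2 + |ρ|) * R) + M' := by
        refine (abs_sub _ _).trans (add_le_add ?_ (hPb t ht r hr hrt))
        rw [abs_mul, hσa, one_mul]
        refine (abs_ev_waveFst_le _ _ _).trans ?_
        have h3 : |r + t| ≤ |ρ| := by
          rw [abs_of_nonneg (by linarith)]; exact hrt.trans (le_abs_self ρ)
        have := sobConst_nonneg; have := hRn t ht
        gcongr
      have h4 : |σ * radW Y t r - r * u t r| ≤ |ρ - a| * (V + M) := by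
        rw [hWe t ht r hr, abs_mul, abs_of_nonneg hr]
        refine mul_le_mul ((by linarith [ht.1] : r ≤ ρ - a).trans (le_abs_self _)) h1
          (abs_nonneg _) (abs_nonneg _)
      have h5 := abs_le.1 h2
      have h6 := abs_le.1 h4
      have h7 : 0 ≤ |ρ - a| * (V + M) := by positivity
      have h8 := (abs_nonneg _).trans h2
      constructor <;> linarith [h5.1, h6.1])
    ht hr hrt
  exact ⟨sub_nonneg.1 key.1, sub_nonneg.1 key.2⟩

/-- The vector field of `ψ'' = ψ³ - ψ`. -/
def duffing (_ : ℝ) (y : ℝ × ℝ) : ℝ × ℝ := (y.2, y.1 ^ 3 - y.1)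

theorem isLocLip_duffing : IsLocLip duffing where
  lip T R := by
    refine ⟨Real.toNNReal (3 * R ^ 2 + 1), fun t _ => LipschitzOnWith.of_dist_le_mul
      fun y hy z hz => ?_⟩
    rw [mem_closedBall_zero_iff] at hy hz
    have hy1 := (norm_fst_le y).trans hy
    have hz1 := (norm_fst_le z).trans hz
    have hR : 0 ≤ R := (norm_nonneg _).trans hy1
    rw [Real.norm_eq_abs] at hy1 hz1
    rw [dist_eq_norm, dist_eq_norm, Real.coe_toNNReal _ (by positivity), duffing, duffing,
      Prod.mk_sub_mk, Prod.norm_mk]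
    have h1 : ‖y.1 - z.1‖ ≤ ‖y - z‖ := norm_fst_le (y - z)
    have h2 : ‖y.2 - z.2‖ ≤ ‖y - z‖ := norm_snd_le (y - z)
    refine max_le (h2.trans (le_mul_of_one_le_left (norm_nonneg _) (by nlinarith [sq_nonneg R]))) ?_
    rw [show y.1 ^ 3 - y.1 - (z.1 ^ 3 - z.1) =
      (y.1 * y.1 + y.1 * z.1 + z.1 * z.1 - 1) * (y.1 - z.1) by ring, norm_mul]
    gcongr
    rw [Real.norm_eq_abs]
    calc |y.1 * y.1 + y.1 * z.1 + z.1 * z.1 - 1|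
        ≤ |y.1 * y.1 + y.1 * z.1 + z.1 * z.1| + |(1 : ℝ)| := abs_sub _ _
      _ ≤ |y.1 * y.1| + |y.1 * z.1| + |z.1 * z.1| + |(1 : ℝ)| := by
        gcongr; exact abs_add_three _ _ _
      _ = |y.1| * |y.1| + |y.1| * |z.1| + |z.1| * |z.1| + 1 := by simp only [abs_mul, abs_one]
      _ ≤ R * R + R * R + R * R + 1 := by gcongr
      _ = 3 * R ^ 2 + 1 := by ring
  bdd T R := by
    refine ⟨Real.toNNReal (R + R ^ 3), fun t _ y hy => ?_⟩
    rw [mem_closedBall_zero_iff] at hy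
    have hy1 := (norm_fst_le y).trans hy
    have hy2 := (norm_snd_le y).trans hy
    have hR : 0 ≤ R := (norm_nonneg _).trans hy1
    rw [Real.coe_toNNReal _ (by positivity), duffing, Prod.norm_mk]
    refine max_le (hy2.trans (by linarith [pow_nonneg hR 3])) ((norm_sub_le _ _).trans ?_)
    rw [norm_pow, add_comm]
    gcongr
  cont _ := continuous_const

theorem sin_arctan_eq_mul_cos (x : ℝ) :
    Real.sin (Real.arctan x) = x * Real.cos (Real.arctan x) := by
  rw [Real.sin_arctan, Real.cos_arctan, mul_one_div]

/-- The radial function `Ω ψ(α + β)` with `α = arctan (t + r)`, `β = arctan (t - r)` and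
`Ω = 2 cos α cos β`. -/
noncomputable def cylSol (y : ℝ → ℝ × ℝ) (t r : ℝ) : ℝ :=
  2 * (Real.cos (Real.arctan (t + r)) * Real.cos (Real.arctan (t - r))) *
    (y (Real.arctan (t + r) + Real.arctan (t - r))).1

/-- The outgoing derivative of `r * cylSol y t r`. -/
noncomputable def cylSolP (y : ℝ → ℝ × ℝ) (t r : ℝ) : ℝ :=
  2 * Real.cos (Real.arctan (t + r)) ^ 2 *
    (Real.cos (Real.arctan (t + r) - Real.arctan (t - r)) *
        (y (Real.arctan (t + r) + Real.arctan (t - r))).1 +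
      Real.sin (Real.arctan (t + r) - Real.arctan (t - r)) *
        (y (Real.arctan (t + r) + Real.arctan (t - r))).2)

theorem sin_arctan_sub_arctan (t r : ℝ) :
    Real.sin (Real.arctan (t + r) - Real.arctan (t - r)) =
      r * (2 * (Real.cos (Real.arctan (t + r)) * Real.cos (Real.arctan (t - r)))) := by
  rw [Real.sin_sub, sin_arctan_eq_mul_cos, sin_arctan_eq_mul_cos]; ring

theorem mul_cylSol (y : ℝ → ℝ × ℝ) (t r : ℝ) : r * cylSol y t r =
    Real.sin (Real.arctan (t + r) - Real.arctan (t - r)) *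
      (y (Real.arctan (t + r) + Real.arctan (t - r))).1 := by
  rw [sin_arctan_sub_arctan, cylSol]; ring

theorem hasDerivAt_arctan_add (t r : ℝ) : HasDerivAt (fun r => Real.arctan (t + r))
    (1 / (1 + (t + r) ^ 2)) r := by
  simpa using! ((hasDerivAt_id r).const_add t).arctan

theorem hasDerivAt_arctan_sub (t r : ℝ) : HasDerivAt (fun r => Real.arctan (t - r))
    (-(1 / (1 + (t - r) ^ 2))) r := by
  simpa using! ((hasDerivAt_id r).const_sub t).arctan

theorem arctan_add_arctan_nonneg {t r : ℝ} (ht : 0 ≤ t) :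
    0 ≤ Real.arctan (t + r) + Real.arctan (t - r) := by
  have h : Real.arctan (-(t + r)) ≤ Real.arctan (t - r) := Real.arctan_mono (by linarith)
  rw [Real.arctan_neg] at h
  linarith

theorem arctan_add_arctan_le {t r : ℝ} (ht : 0 ≤ t) (hr : 0 ≤ r) :
    Real.arctan (t + r) + Real.arctan (t - r) ≤ 2 * Real.arctan t := by
  have hd : ∀ r, HasDerivAt (fun r => Real.arctan (t + r) + Real.arctan (t - r))
      (1 / (1 + (t + r) ^ 2) + -(1 / (1 + (t - r) ^ 2))) r := fun r =>
    (hasDerivAt_arctan_add t r).add (hasDerivAt_arctan_sub t r)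
  have h := antitoneOn_of_hasDerivWithinAt_nonpos (convex_Ici 0)
    (fun s _ => (hd s).continuousAt.continuousWithinAt)
    (fun s _ => (hd s).hasDerivWithinAt) (fun s hs => by
      rw [interior_Ici] at hs
      have hs' : 0 < s := hs
      have : 1 / (1 + (t + s) ^ 2) ≤ 1 / (1 + (t - s) ^ 2) :=
        one_div_le_one_div_of_le (by positivity) (by nlinarith)
      linarith) self_mem_Ici hr hr
  simp only [add_zero, sub_zero] at h
  linarith

theorem two_arctan_sub_sq_le {t r : ℝ} (ht : 0 ≤ t) (hr : 0 ≤ r) :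
    2 * Real.arctan t - r ^ 2 ≤ Real.arctan (t + r) + Real.arctan (t - r) := by
  have hd : ∀ r, HasDerivAt (fun r => Real.arctan (t + r) + Real.arctan (t - r) + r ^ 2)
      (1 / (1 + (t + r) ^ 2) + -(1 / (1 + (t - r) ^ 2)) + 2 * r) r := fun r => by
    simpa using! ((hasDerivAt_arctan_add t r).add (hasDerivAt_arctan_sub t r)).add
      (hasDerivAt_pow 2 r)
  have h := monotoneOn_of_hasDerivWithinAt_nonneg (convex_Ici 0)
    (fun s _ => (hd s).continuousAt.continuousWithinAt)
    (fun s _ => (hd s).hasDerivWithinAt) (fun s hs => by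
      rw [interior_Ici] at hs
      have hs' : 0 < s := hs
      have e : 1 / (1 + (t + s) ^ 2) + -(1 / (1 + (t - s) ^ 2)) + 2 * s =
          2 * s * ((1 + (t + s) ^ 2) * (1 + (t - s) ^ 2) - 2 * t) /
            ((1 + (t + s) ^ 2) * (1 + (t - s) ^ 2)) := by
        field_simp; ring
      rw [e]
      have h1 : 2 * t ≤ 1 + (t + s) ^ 2 := by nlinarith [sq_nonneg (t + s - 1)]
      have h2 : 1 + (t + s) ^ 2 ≤ (1 + (t + s) ^ 2) * (1 + (t - s) ^ 2) :=
        le_mul_of_one_le_right (by positivity) (by nlinarith [sq_nonneg (t - s)])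
      have h3 : 0 ≤ (1 + (t + s) ^ 2) * (1 + (t - s) ^ 2) - 2 * t := by linarith
      positivity) self_mem_Ici hr hr
  simp only [add_zero, sub_zero] at h
  nlinarith

section CylSol

variable {S b : ℝ} {y : ℝ → ℝ × ℝ}

theorem arctan_sum_mem (hb : 2 * Real.arctan b < S) {t r : ℝ} (ht : t ∈ Icc 0 b) (hr : 0 ≤ r) :
    Real.arctan (t + r) + Real.arctan (t - r) ∈ Ico 0 S :=
  ⟨arctan_add_arctan_nonneg ht.1, (arctan_add_arctan_le ht.1 hr).trans_lt
    (lt_of_le_of_lt (by linarith [Real.arctan_mono ht.2]) hb)⟩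

theorem hasDerivAt_arctan_two_mul (c s : ℝ) : HasDerivAt (fun s => Real.arctan (c + 2 * s))
    (2 * Real.cos (Real.arctan (c + 2 * s)) ^ 2) s := by
  refine ((((hasDerivAt_id s).const_mul 2).const_add c).arctan).congr_deriv ?_
  rw [Real.cos_sq_arctan]
  simp only [id]; ring

theorem hasDerivWithinAt_mul_cylSol (hy : IsSol duffing S y) (hb : 2 * Real.arctan b < S) (c : ℝ)
    {s : ℝ} (hs : s ∈ Icc 0 b) (hcs : 0 ≤ c + s) :
    HasDerivWithinAt (fun s => (c + s) * cylSol y s (c + s)) (cylSolP y s (c + s))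
      (Icc 0 b ∩ {s | 0 ≤ c + s}) s := by
  set β := Real.arctan (-c) with hβ
  have hm : MapsTo (fun s => Real.arctan (c + 2 * s) + β) (Icc 0 b ∩ {s | 0 ≤ c + s})
      (Ico 0 S) := by
    intro τ hτ
    have := arctan_sum_mem hb hτ.1 hτ.2
    rwa [show τ + (c + τ) = c + 2 * τ by ring, show τ - (c + τ) = -c by ring] at this
  have h1 := ((hasDerivAt_arctan_two_mul c s).add_const β).hasDerivWithinAt
    (s := Icc 0 b ∩ {s | 0 ≤ c + s})
  have h2 := (hy _ (hm ⟨hs, hcs⟩)).scomp s h1 hm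
  have h3 := (((hasDerivAt_arctan_two_mul c s).sub_const β).sin).hasDerivWithinAt
    (s := Icc 0 b ∩ {s | 0 ≤ c + s})
  have e : ∀ τ, (c + τ) * cylSol y τ (c + τ) = Real.sin (Real.arctan (c + 2 * τ) - β) *
      (y (Real.arctan (c + 2 * τ) + β)).1 := fun τ => by
    rw [mul_cylSol, show τ + (c + τ) = c + 2 * τ by ring, show τ - (c + τ) = -c by ring]
  refine ((h3.mul h2.fst).congr_deriv ?_).congr (fun τ _ => e τ) (e s)
  rw [cylSolP, show s + (c + s) = c + 2 * s by ring, show s - (c + s) = -c by ring, ← hβ]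
  simp only [duffing, Prod.smul_mk, smul_eq_mul, Function.comp_apply]
  ring

theorem hasDerivWithinAt_cylSolP (hy : IsSol duffing S y) (hb : 2 * Real.arctan b < S) (c : ℝ)
    {s : ℝ} (hs : s ∈ Icc 0 b) (hcs : 0 ≤ c - s) :
    HasDerivWithinAt (fun s => cylSolP y s (c - s)) ((c - s) * cylSol y s (c - s) ^ 3)
      (Icc 0 b ∩ {s | 0 ≤ c - s}) s := by
  set α := Real.arctan c with hα
  have hm : MapsTo (fun s => Real.arctan (-c + 2 * s) + α) (Icc 0 b ∩ {s | 0 ≤ c - s})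
      (Ico 0 S) := by
    intro τ hτ
    have := arctan_sum_mem hb hτ.1 hτ.2
    rwa [show τ + (c - τ) = c by ring, show τ - (c - τ) = -c + 2 * τ by ring, add_comm] at this
  have h1 := ((hasDerivAt_arctan_two_mul (-c) s).add_const α).hasDerivWithinAt
    (s := Icc 0 b ∩ {s | 0 ≤ c - s})
  have h2 := (hy _ (hm ⟨hs, hcs⟩)).scomp s h1 hm
  have h3 := (((hasDerivAt_arctan_two_mul (-c) s).const_sub α).sin).hasDerivWithinAt
    (s := Icc 0 b ∩ {s | 0 ≤ c - s})
  have h4 := (((hasDerivAt_arctan_two_mul (-c) s).const_sub α).cos).hasDerivWithinAt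
    (s := Icc 0 b ∩ {s | 0 ≤ c - s})
  have e : ∀ τ, cylSolP y τ (c - τ) = 2 * Real.cos α ^ 2 *
      (Real.cos (α - Real.arctan (-c + 2 * τ)) * (y (Real.arctan (-c + 2 * τ) + α)).1 +
        Real.sin (α - Real.arctan (-c + 2 * τ)) * (y (Real.arctan (-c + 2 * τ) + α)).2) :=
    fun τ => by
      rw [cylSolP, show τ + (c - τ) = c by ring, show τ - (c - τ) = -c + 2 * τ by ring, ← hα,
        add_comm α]
  refine ((((h4.mul h2.fst).add (h3.mul h2.snd)).const_mul (2 * Real.cos α ^ 2)).congr_deriv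
    ?_).congr (fun τ _ => e τ) (e s)
  rw [pow_succ' (cylSol y s (c - s)), ← mul_assoc, mul_cylSol, cylSol,
    show s + (c - s) = c by ring, show s - (c - s) = -c + 2 * s by ring, ← hα, add_comm α]
  simp only [duffing, Prod.smul_mk, smul_eq_mul, Function.comp_apply]
  ring

end CylSol

theorem cylSol_zero (y : ℝ → ℝ × ℝ) (r : ℝ) : cylSol y 0 r = 2 * (y 0).1 / (1 + r ^ 2) := by
  have h := Real.cos_sq_arctan r
  rw [cylSol, zero_add, zero_sub, Real.arctan_neg, Real.cos_neg, ← pow_two, h, add_neg_cancel]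
  ring

theorem cylSolP_zero (y : ℝ → ℝ × ℝ) (r : ℝ) : cylSolP y 0 r =
    2 * (y 0).1 * (1 - r ^ 2) / (1 + r ^ 2) ^ 2 + r * (4 * (y 0).2 / (1 + r ^ 2) ^ 2) := by
  have h := Real.cos_sq_arctan r
  have h0 : (1 + r ^ 2) ≠ 0 := by positivity
  rw [cylSolP, zero_add, zero_sub, Real.arctan_neg, sub_neg_eq_add, ← two_mul, Real.cos_two_mul,
    Real.sin_two_mul, sin_arctan_eq_mul_cos, add_neg_cancel,
    show 2 * (r * Real.cos (Real.arctan r)) * Real.cos (Real.arctan r) =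
      2 * r * Real.cos (Real.arctan r) ^ 2 by ring, h]
  field_simp
  ring

section Explicit

variable {T S X V : ℝ} {Y : ℝ → L2R3 × L2R3} {y : ℝ → ℝ × ℝ}

theorem posVal_zero_eq (hp : position Y 0 = initPosition X) (x : R3) :
    posVal Y 0 x = 2 * X / (1 + ‖x‖ ^ 2) := by
  rw [posVal]
  refine ev_eq_of_ae (f := fun x : R3 => 2 * X / (1 + ‖x‖ ^ 2)) ?_ ?_ x
  · exact Continuous.div (by fun_prop) (by fun_prop) fun x => by positivity
  · rw [← mult_mul, ← pow_succ]
    change position Y 0 =ᵐ[volume] _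
    rw [hp]
    exact MemLp.coeFn_toLp _

theorem ev_velocity_eq (hv : velocity Y 0 = initVelocity V) (x : R3) :
    ev x (waveSnd 0 (Y 0)) = 4 * V / (1 + ‖x‖ ^ 2) ^ 2 := by
  refine ev_eq_of_ae (f := fun x : R3 => 4 * V / (1 + ‖x‖ ^ 2) ^ 2) ?_ ?_ x
  · exact Continuous.div (by fun_prop) (by fun_prop) fun x => by positivity
  · change velocity Y 0 =ᵐ[volume] _
    rw [hv]
    exact MemLp.coeFn_toLp _

theorem IsRadSol.radW_zero_eq (h : IsRadSol T Y) (hT : 0 < T) (hp : position Y 0 = initPosition X)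
    {r : ℝ} (hr : 0 ≤ r) : radW Y 0 r = r * (2 * X / (1 + r ^ 2)) := by
  rw [h.radW_eq_radPt ⟨le_rfl, hT⟩ hr, posVal_zero_eq hp, norm_radPt hr]

theorem IsRadSol.radP_zero_eq (h : IsRadSol T Y) (hT : 0 < T) (hp : position Y 0 = initPosition X)
    (hv : velocity Y 0 = initVelocity V) {r : ℝ} (hr : 0 ≤ r) : radP Y 0 r =
      2 * X * (1 - r ^ 2) / (1 + r ^ 2) ^ 2 + r * (4 * V / (1 + r ^ 2) ^ 2) := by
  have h0 : (0 : ℝ) ∈ Ico 0 T := ⟨le_rfl, hT⟩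
  rw [radP_eq]
  congr 1
  · have h1 := (hasDerivAt_ev_ji_sq_kS (_root_.waveFst 0 (Y 0)) r).hasDerivWithinAt (s := Ici 0)
    have h2 : HasDerivAt (fun r : ℝ => r * (2 * X / (1 + r ^ 2)))
        (2 * X * (1 - r ^ 2) / (1 + r ^ 2) ^ 2) r := by
      have hne : 1 + r ^ 2 ≠ 0 := by positivity
      refine ((hasDerivAt_id r).mul (((hasDerivAt_const r (2 * X)).div
        ((hasDerivAt_pow 2 r).const_add 1) hne))).congr_deriv ?_
      simp only [id, Pi.div_apply]
      field_simp
      push_cast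
      ring
    have h3 : HasDerivWithinAt (fun r => ev 0 (mult (ji ^ 2 * kS r) (_root_.waveFst 0 (Y 0))))
        (2 * X * (1 - r ^ 2) / (1 + r ^ 2) ^ 2) (Ici 0) r :=
      h2.hasDerivWithinAt.congr (fun s hs => h.radW_zero_eq hT hp hs) (h.radW_zero_eq hT hp hr)
    exact (uniqueDiffOn_Ici (0 : ℝ) r hr).eq_deriv _ h1 h3
  · have h1 := (h.waveSnd h0).norm_mul_ev (radPt r)
    rw [ev_velocity_eq hv, norm_radPt hr] at h1
    exact h1.symm

theorem abs_cylSol_le {t r R : ℝ}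
    (h : ‖y (Real.arctan (t + r) + Real.arctan (t - r))‖ ≤ R) : |cylSol y t r| ≤ 2 * R := by
  have h1 := (norm_fst_le _).trans h
  rw [Real.norm_eq_abs] at h1
  have h2 := Real.abs_cos_le_one (Real.arctan (t + r))
  have h3 := Real.abs_cos_le_one (Real.arctan (t - r))
  rw [cylSol, abs_mul, abs_mul, abs_mul, abs_two]
  calc _ ≤ 2 * (1 * 1) * R := by gcongr
    _ = 2 * R := by ring

theorem abs_cylSolP_le {t r R : ℝ}
    (h : ‖y (Real.arctan (t + r) + Real.arctan (t - r))‖ ≤ R) : |cylSolP y t r| ≤ 4 * R := by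
  have h1 := (norm_fst_le _).trans h
  have h2 := (norm_snd_le _).trans h
  rw [Real.norm_eq_abs] at h1 h2
  have h3 := Real.abs_cos_le_one (Real.arctan (t + r))
  have h4 := Real.abs_cos_le_one (Real.arctan (t + r) - Real.arctan (t - r))
  have h5 := Real.abs_sin_le_one (Real.arctan (t + r) - Real.arctan (t - r))
  rw [cylSolP, abs_mul, abs_mul, abs_two, abs_pow]
  calc _ ≤ 2 * 1 ^ 2 * (1 * R + 1 * R) := by
        gcongr
        refine (abs_add_le _ _).trans ?_
        rw [abs_mul, abs_mul]
        gcongr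
    _ = 4 * R := by ring

theorem IsRadSol.eq_cylSol (h : IsRadSol T Y) (hp : position Y 0 = initPosition X)
    (hv : velocity Y 0 = initVelocity V) (hy : IsSol duffing S y) (hy0 : y 0 = (X, V)) {b : ℝ}
    (hbT : b < T) (hbS : 2 * Real.arctan b < S) {t r : ℝ} (ht : t ∈ Icc 0 b) (hr : 0 ≤ r) :
    radW Y t r = r * cylSol y t r ∧ radP Y t r = cylSolP y t r := by
  have hT : 0 < T := (ht.1.trans ht.2).trans_lt hbT
  obtain ⟨R, hR0, hR⟩ := hy.continuousOn.exists_norm_le_Icc hbS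
  have hRb : ∀ t ∈ Icc 0 b, ∀ r, 0 ≤ r →
      ‖y (Real.arctan (t + r) + Real.arctan (t - r))‖ ≤ R := fun t ht r hr =>
    hR _ ⟨arctan_add_arctan_nonneg ht.1, (arctan_add_arctan_le ht.1 hr).trans
      (by linarith [Real.arctan_mono ht.2])⟩
  have hW0 : ∀ r, 0 ≤ r → radW Y 0 r = r * cylSol y 0 r := fun r hr => by
    rw [h.radW_zero_eq hT hp hr, cylSol_zero, hy0]
  have hP0 : ∀ r, 0 ≤ r → radP Y 0 r = cylSolP y 0 r := fun r hr => by
    rw [h.radP_zero_eq hT hp hv hr, cylSolP_zero, hy0]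
  have h1 := h.comparison (ρ := r + t) le_rfl hbT (Or.inl rfl) (u := cylSol y) (P := cylSolP y)
    (fun c s hs hcs => hasDerivWithinAt_mul_cylSol hy hbS c hs hcs)
    (fun c s hs hcs => hasDerivWithinAt_cylSolP hy hbS c hs hcs)
    (fun t ht r hr => abs_cylSol_le (hRb t ht r hr))
    (fun t ht r hr _ => abs_cylSolP_le (hRb t ht r hr))
    (fun r hr _ => by rw [one_mul, hW0 r hr]) (fun r hr _ => by rw [one_mul, hP0 r hr])
    ht hr le_rfl
  have h2 := h.comparison (ρ := r + t) le_rfl hbT (Or.inr rfl) (u := fun t r => -cylSol y t r)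
    (P := fun t r => -cylSolP y t r)
    (fun c s hs hcs => ((hasDerivWithinAt_mul_cylSol hy hbS c hs hcs).neg).congr
      (fun τ _ => by simp) (by simp))
    (fun c s hs hcs => ((hasDerivWithinAt_cylSolP hy hbS c hs hcs).neg).congr_deriv (by ring))
    (fun t ht r hr => by rw [abs_neg]; exact abs_cylSol_le (hRb t ht r hr))
    (fun t ht r hr _ => by rw [abs_neg]; exact abs_cylSolP_le (hRb t ht r hr))
    (fun r hr _ => by rw [hW0 r hr]; simp) (fun r hr _ => by rw [hP0 r hr]; simp)
    ht hr le_rfl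
  constructor
  · linarith [h1.1, h2.1]
  · linarith [h1.2, h2.2]

theorem IsRadSol.abs_posVal_le (h : IsRadSol T Y) (hp : position Y 0 = initPosition X)
    (hv : velocity Y 0 = initVelocity V) (hy : IsSol duffing S y) (hy0 : y 0 = (X, V)) {R t : ℝ}
    (ht : t ∈ Ico 0 T) (htS : 2 * Real.arctan t < S)
    (hR : ∀ s ∈ Icc 0 (2 * Real.arctan t), ‖y s‖ ≤ R) (x : R3) : |posVal Y t x| ≤ 4 * R := by
  have hRb : ∀ r, 0 ≤ r → ‖y (Real.arctan (t + r) + Real.arctan (t - r))‖ ≤ R := fun r hr =>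
    hR _ ⟨arctan_add_arctan_nonneg ht.1, arctan_add_arctan_le ht.1 hr⟩
  have hR0 : 0 ≤ R := (norm_nonneg _).trans (hRb 0 le_rfl)
  by_cases hx : x = 0
  · subst hx
    rw [← radP_zero, (h.eq_cylSol hp hv hy hy0 ht.2 htS ⟨ht.1, le_rfl⟩ le_rfl).2]
    exact abs_cylSolP_le (hRb 0 le_rfl)
  · have hx' : ‖x‖ ≠ 0 := norm_ne_zero_iff.2 hx
    have h1 := (h.eq_cylSol hp hv hy hy0 ht.2 htS ⟨ht.1, le_rfl⟩ (norm_nonneg x)).1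
    rw [h.radW_eq ht] at h1
    rw [mul_left_cancel₀ hx' h1]
    exact (abs_cylSol_le (hRb _ (norm_nonneg x))).trans (by linarith)

end Explicit

theorem isRadial_initPosition (X : ℝ) : IsRadial (initPosition X) :=
  ⟨fun r => 2 * X / (1 + r ^ 2), MemLp.coeFn_toLp _⟩

theorem isRadial_initVelocity (V : ℝ) : IsRadial (initVelocity V) :=
  ⟨fun r => 4 * V / (1 + r ^ 2) ^ 2, MemLp.coeFn_toLp _⟩

theorem IsSol.isRadSol {T : ℝ} {Y : ℝ → L2R3 × L2R3} (h : IsSol waveField T Y)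
    (hp : IsRadial (position Y 0)) (hv : IsRadial (velocity Y 0)) : IsRadSol T Y := by
  have h1 := hp.isRotInvariant
  have h2 := hv.isRotInvariant
  rw [position, waveFst_zero] at h1
  rw [velocity, waveSnd_zero] at h2
  exact ⟨h, fun t ht => (h.isRotInvariant h1.of_mult_ji_pow h2.of_mult_ji_pow ht).1,
    fun t ht => (h.isRotInvariant h1.of_mult_ji_pow h2.of_mult_ji_pow ht).2⟩

theorem ContinuousOn.pos_of_ne_zero {f : ℝ → ℝ} {a b : ℝ} (hf : ContinuousOn f (Ico a b))
    (hne : ∀ s ∈ Ico a b, f s ≠ 0) (ha : 0 < f a) : ∀ s ∈ Ico a b, 0 < f s := by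
  intro s hs
  by_contra hcon
  obtain ⟨c, hc, hc0⟩ := intermediate_value_Icc' hs.1 (hf.mono (Icc_subset_Ico_right hs.2))
    (show (0 : ℝ) ∈ Icc (f s) (f a) from ⟨not_lt.1 hcon, ha.le⟩)
  exact hne c ⟨hc.1, hc.2.trans_lt hs.2⟩ hc0

section Duffing

variable {S : ℝ} {y : ℝ → ℝ × ℝ}

theorem IsSol.duffing_energy (hy : IsSol duffing S y) {s : ℝ} (hs : s ∈ Ico 0 S) :
    (y s).2 ^ 2 = (y s).1 ^ 4 / 2 - (y s).1 ^ 2 +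
      ((y 0).2 ^ 2 - (y 0).1 ^ 4 / 2 + (y 0).1 ^ 2) := by
  have hd : ∀ r ∈ Ico 0 S, HasDerivWithinAt
      (fun s => (y s).2 ^ 2 - (y s).1 ^ 4 / 2 + (y s).1 ^ 2) 0 (Ico 0 S) r := by
    intro r hr
    have h1 : HasDerivWithinAt (fun s => (y s).1) (duffing r (y r)).1 (Ico 0 S) r := (hy r hr).fst
    have h2 : HasDerivWithinAt (fun s => (y s).2) (duffing r (y r)).2 (Ico 0 S) r := (hy r hr).snd
    refine (((h2.pow 2).sub ((h1.pow 4).div_const 2)).add (h1.pow 2)).congr_deriv ?_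
    simp only [duffing]
    push_cast
    ring
  have h := constant_of_has_deriv_right_zero (a := 0) (b := s)
    (fun r hr => ((hd r ⟨hr.1, hr.2.trans_lt hs.2⟩).continuousWithinAt).mono
      (Icc_subset_Ico_right hs.2))
    (fun r hr => (hd r ⟨hr.1, hr.2.trans hs.2⟩).Ici_of_Ico ⟨hr.1, hr.2.trans hs.2⟩) s
    ⟨hs.1, le_rfl⟩
  linarith

/-- Near a blow-up time, a solution of `ψ'' = ψ³ - ψ` has constant sign, is monotone, and
satisfies `|ψ(s)| ≥ (S - s)⁻¹`. -/
theorem IsSol.duffing_blowup (hS : 0 < S) (hy : IsSol duffing S y)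
    (hlim : Tendsto (fun s => ‖y s‖) (𝓝[<] S) atTop) :
    ∃ σ : ℝ, (σ = 1 ∨ σ = -1) ∧ ∃ S₀ ∈ Ico 0 S, ∀ s ∈ Ico S₀ S,
      1 / (S - s) ≤ σ * (y s).1 ∧ 0 ≤ σ * (y s).2 := by
  set e := (y 0).2 ^ 2 - (y 0).1 ^ 4 / 2 + (y 0).1 ^ 2 with he
  have hE : ∀ s ∈ Ico 0 S, (y s).2 ^ 2 = (y s).1 ^ 4 / 2 - (y s).1 ^ 2 + e := fun s hs =>
    hy.duffing_energy hs
  have hIco : ∀ᶠ s in 𝓝[<] S, s ∈ Ico 0 S := Ico_mem_nhdsLT hS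
  have hplim : Tendsto (fun s => |(y s).1|) (𝓝[<] S) atTop := by
    rw [tendsto_atTop]
    intro M
    filter_upwards [hIco, (tendsto_atTop.1 hlim) (max |M| (|M| ^ 4 + |e| + 1) + 1)] with s hs h1
    by_contra hcon
    have h2 : |(y s).1| < |M| := (not_le.1 hcon).trans_le (le_abs_self M)
    have h3 : (y s).1 ^ 4 ≤ |M| ^ 4 := by
      rw [← (show Even 4 by decide).pow_abs]
      gcongr
    have h4 : |(y s).2| ≤ |M| ^ 4 + |e| + 1 := by
      have h5 := hE s hs
      have h6 := le_abs_self e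
      have h7 := sq_nonneg (|(y s).2| - 1)
      have h8 := sq_abs (y s).2
      have h9 : 0 ≤ |M| ^ 4 := by positivity
      nlinarith [sq_nonneg (y s).1, abs_nonneg (y s).2, abs_nonneg e]
    have h5 : ‖y s‖ ≤ max |M| (|M| ^ 4 + |e| + 1) := max_le_max h2.le h4
    linarith
  set K := 2 + 4 * |e| with hK
  have hK0 : 0 ≤ |e| := abs_nonneg e
  obtain ⟨S₀, hS₀, hbig⟩ : ∃ S₀ ∈ Ico 0 S, ∀ s ∈ Ico S₀ S, K ≤ |(y s).1| := by
    obtain ⟨l, hl, h⟩ := mem_nhdsLT_iff_exists_Ico_subset.1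
      (hIco.and (tendsto_atTop.1 hplim K))
    exact ⟨l, (h ⟨le_rfl, hl⟩).1, fun s hs => (h hs).2⟩
  have hsub : Ico S₀ S ⊆ Ico 0 S := Ico_subset_Ico_left hS₀.1
  have hsq : ∀ s ∈ Ico S₀ S, 4 + 4 * |e| ≤ (y s).1 ^ 2 := fun s hs => by
    have h1 := hbig s hs
    rw [← sq_abs]
    nlinarith
  have hle := le_abs_self e
  have hge := neg_abs_le e
  have hqne : ∀ s ∈ Ico S₀ S, (y s).2 ≠ 0 := fun s hs h0 => by
    have h1 := hE s (hsub hs)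
    have h2 := hsq s hs
    rw [h0] at h1
    nlinarith
  have hpne : ∀ s ∈ Ico S₀ S, (y s).1 ≠ 0 := fun s hs h0 => by
    have h2 := hsq s hs
    rw [h0] at h2
    nlinarith
  have hq2 : ∀ s ∈ Ico S₀ S, |(y s).2| ≤ (y s).1 ^ 2 := fun s hs => by
    refine abs_le_of_sq_le_sq ?_ (sq_nonneg _)
    have h1 := hE s (hsub hs)
    have h2 := hsq s hs
    nlinarith
  have hpc : ContinuousOn (fun s => (y s).1) (Ico S₀ S) :=
    continuous_fst.comp_continuousOn (hy.continuousOn.mono hsub)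
  have hqc : ContinuousOn (fun s => (y s).2) (Ico S₀ S) :=
    continuous_snd.comp_continuousOn (hy.continuousOn.mono hsub)
  have hS₀m : S₀ ∈ Ico S₀ S := ⟨le_rfl, hS₀.2⟩
  obtain ⟨σ, hσ, hσp⟩ : ∃ σ : ℝ, (σ = 1 ∨ σ = -1) ∧ 0 < σ * (y S₀).1 := by
    rcases lt_or_gt_of_ne (hpne S₀ hS₀m) with h | h
    · exact ⟨-1, Or.inr rfl, by linarith⟩
    · exact ⟨1, Or.inl rfl, by linarith⟩
  have hσ0 : σ ≠ 0 := by rcases hσ with rfl | rfl <;> norm_num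
  have hσa : |σ| = 1 := by rcases hσ with rfl | rfl <;> simp
  have hσ2 : σ ^ 2 = 1 := by rw [← sq_abs, hσa, one_pow]
  have hP : ∀ s ∈ Ico S₀ S, 0 < σ * (y s).1 :=
    (continuousOn_const.mul hpc).pos_of_ne_zero (fun s hs => mul_ne_zero hσ0 (hpne s hs)) hσp
  have hPa : ∀ s ∈ Ico S₀ S, |(y s).1| = σ * (y s).1 := fun s hs => by
    rw [← abs_of_pos (hP s hs), abs_mul, hσa, one_mul]
  have hd : ∀ s ∈ Ico S₀ S, HasDerivWithinAt (fun s => σ * (y s).1) (σ * (y s).2) (Ico S₀ S) s :=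
    fun s hs => by
      have h1 : HasDerivWithinAt (fun s => (y s).1) (y s).2 (Ico 0 S) s := (hy s (hsub hs)).fst
      exact (h1.mono hsub).const_mul σ
  have hIco' : ∀ᶠ s in 𝓝[<] S, s ∈ Ico S₀ S := Ico_mem_nhdsLT hS₀.2
  have hPlim : Tendsto (fun s => σ * (y s).1) (𝓝[<] S) atTop :=
    hplim.congr' (by filter_upwards [hIco'] with s hs using hPa s hs)
  have hQ0 : 0 < σ * (y S₀).2 := by
    by_contra hcon
    have hneg : 0 < -σ * (y S₀).2 := by
      rcases lt_or_eq_of_le (not_lt.1 hcon) with h | h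
      · linarith
      · exact absurd h (mul_ne_zero hσ0 (hqne S₀ hS₀m))
    have hQ : ∀ s ∈ Ico S₀ S, 0 < -σ * (y s).2 := (continuousOn_const.mul hqc).pos_of_ne_zero
      (fun s hs => mul_ne_zero (neg_ne_zero.2 hσ0) (hqne s hs)) hneg
    have hanti := antitoneOn_of_hasDerivWithinAt_nonpos (convex_Ico S₀ S)
      (fun s hs => (hd s hs).continuousWithinAt)
      (fun s hs => (hd s (interior_subset hs)).mono interior_subset)
      (fun s hs => by linarith [hQ s (interior_subset hs)])
    obtain ⟨s, h1, h2⟩ := (hIco'.and (tendsto_atTop.1 hPlim (σ * (y S₀).1 + 1))).exists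
    have h3 := hanti hS₀m h1 h1.1
    simp only at h3
    linarith
  have hQ : ∀ s ∈ Ico S₀ S, 0 < σ * (y s).2 := (continuousOn_const.mul hqc).pos_of_ne_zero
    (fun s hs => mul_ne_zero hσ0 (hqne s hs)) hQ0
  refine ⟨σ, hσ, S₀, hS₀, fun s hs => ⟨?_, (hQ s hs).le⟩⟩
  have hmono : MonotoneOn (fun s => (σ * (y s).1)⁻¹ + s) (Ico S₀ S) := by
    have hd2 : ∀ s ∈ Ico S₀ S, HasDerivWithinAt (fun s => (σ * (y s).1)⁻¹ + s)
        (-(σ * (y s).2) / (σ * (y s).1) ^ 2 + 1) (Ico S₀ S) s := fun s hs =>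
      ((hd s hs).inv (hP s hs).ne').add (hasDerivWithinAt_id s _)
    refine monotoneOn_of_hasDerivWithinAt_nonneg (convex_Ico S₀ S)
      (fun s hs => (hd2 s hs).continuousWithinAt)
      (fun s hs => (hd2 s (interior_subset hs)).mono interior_subset) fun s hs => ?_
    have hs' := interior_subset hs
    have h1 : σ * (y s).2 ≤ (σ * (y s).1) ^ 2 := by
      rw [mul_pow, hσ2, one_mul]
      refine le_trans (le_abs_self _) ?_
      rw [abs_mul, hσa, one_mul]
      exact hq2 s hs'
    have h2 : 0 < (σ * (y s).1) ^ 2 := pow_pos (hP s hs') 2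
    have h3 : σ * (y s).2 / (σ * (y s).1) ^ 2 ≤ 1 := (div_le_one h2).2 h1
    rw [neg_div]
    linarith
  have hlim2 : Tendsto (fun s => (σ * (y s).1)⁻¹ + s) (𝓝[<] S) (𝓝 (0 + S)) :=
    (tendsto_inv_atTop_zero.comp hPlim).add (tendsto_id.mono_left nhdsWithin_le_nhds)
  have h1 : (σ * (y s).1)⁻¹ + s ≤ 0 + S := by
    refine ge_of_tendsto hlim2 ?_
    filter_upwards [Ico_mem_nhdsLT hs.2] with s' hs'
    exact hmono hs ⟨hs.1.trans hs'.1, hs'.2⟩ hs'.1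
  rw [one_div]
  refine inv_le_of_inv_le₀ (hP s hs) (by linarith)

end Duffing

theorem arctan_sub_le {a b : ℝ} (h : a ≤ b) : Real.arctan b - Real.arctan a ≤ b - a := by
  have hm : Monotone fun x : ℝ => x - Real.arctan x := by
    refine monotone_of_hasDerivAt_nonneg
      (fun x => (hasDerivAt_id x).sub (Real.hasDerivAt_arctan x)) fun x => ?_
    have : 1 / (1 + x ^ 2) ≤ 1 := by
      rw [div_le_one (by positivity)]; nlinarith [sq_nonneg x]
    simp only [Pi.zero_apply]
    linarith
  have := hm h
  simp only at this
  linarith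

theorem le_cos_arctan {x m : ℝ} (hx : |x| ≤ m) :
    1 / √(1 + m ^ 2) ≤ Real.cos (Real.arctan x) := by
  rw [Real.cos_arctan]
  have : x ^ 2 ≤ m ^ 2 := sq_le_sq' (by linarith [neg_abs_le x]) ((le_abs_self x).trans hx)
  gcongr

/-- Just before the blow-up time, the explicit solution dominates `c / η ^ 2` on a ball of
radius `2η`. -/
theorem cylSol_lower_bound {S S₀ σ ts η t r : ℝ} {y : ℝ → ℝ × ℝ} (hS : S = 2 * Real.arctan ts)
    (hy : ∀ s ∈ Ico S₀ S, 1 / (S - s) ≤ σ * (y s).1 ∧ 0 ≤ σ * (y s).2)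
    (hη0 : 0 < η) (hη : η ≤ 1 / 4) (hηS : 6 * η ^ 2 ≤ S - S₀) (ht0 : 0 ≤ t)
    (ht : t = ts - η ^ 2) (hr0 : 0 ≤ r) (hr : r ≤ 2 * η) :
    1 / (1 + (ts + 1) ^ 2) / (6 * η ^ 2) ≤ σ * cylSol y t r ∧
      1 / (1 + (ts + 1) ^ 2) / (6 * η ^ 2) ≤ σ * cylSolP y t r := by
  have hη2 : 0 < η ^ 2 := by positivity
  have htlt : t < ts := by linarith
  set θ := Real.arctan (t + r) + Real.arctan (t - r) with hθ
  have h1 : θ < S := by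
    have := arctan_add_arctan_le ht0 hr0
    have := Real.arctan_strictMono htlt
    linarith
  have h2 : S - θ ≤ 6 * η ^ 2 := by
    have h3 := two_arctan_sub_sq_le ht0 hr0
    have h4 := arctan_sub_le htlt.le
    have h5 : r ^ 2 ≤ (2 * η) ^ 2 := by gcongr
    nlinarith
  obtain ⟨h3, h4⟩ := hy θ ⟨by linarith, h1⟩
  have h5 : 1 / (6 * η ^ 2) ≤ σ * (y θ).1 :=
    (one_div_le_one_div_of_le (by linarith) h2).trans h3
  set c := 1 / √(1 + (ts + 1) ^ 2) with hc
  have hc0 : 0 < c := by positivity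
  have hcc : c ^ 2 = 1 / (1 + (ts + 1) ^ 2) := by
    rw [hc, div_pow, one_pow, Real.sq_sqrt (by positivity)]
  have hα : c ≤ Real.cos (Real.arctan (t + r)) := le_cos_arctan (by
    rw [abs_of_nonneg (by linarith)]; nlinarith)
  have hβ : c ≤ Real.cos (Real.arctan (t - r)) := le_cos_arctan (by
    rw [abs_le]; constructor <;> nlinarith)
  have hR0 : 0 ≤ Real.arctan (t + r) - Real.arctan (t - r) :=
    sub_nonneg.2 (Real.arctan_mono (by linarith))
  have hR1 : Real.arctan (t + r) - Real.arctan (t - r) ≤ 1 := by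
    have := arctan_sub_le (show t - r ≤ t + r by linarith)
    linarith
  have hcos : 1 / 2 ≤ Real.cos (Real.arctan (t + r) - Real.arctan (t - r)) := by
    have := Real.one_sub_sq_div_two_le_cos (x := Real.arctan (t + r) - Real.arctan (t - r))
    nlinarith
  have hsin : 0 ≤ Real.sin (Real.arctan (t + r) - Real.arctan (t - r)) :=
    Real.sin_nonneg_of_nonneg_of_le_pi hR0 (by linarith [Real.pi_gt_three])
  have hpos : 0 ≤ 1 / (6 * η ^ 2) := by positivity
  have hcc2 : c ^ 2 ≤ Real.cos (Real.arctan (t + r)) * Real.cos (Real.arctan (t - r)) := by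
    rw [pow_two]; gcongr
  have hcc3 : c ^ 2 ≤ Real.cos (Real.arctan (t + r)) ^ 2 := by gcongr
  rw [← hcc, div_eq_mul_one_div (c ^ 2)]
  constructor
  · have e : σ * cylSol y t r = 2 * (Real.cos (Real.arctan (t + r)) *
        Real.cos (Real.arctan (t - r))) * (σ * (y θ).1) := by rw [cylSol]; ring
    rw [e]
    refine mul_le_mul (by nlinarith) h5 hpos ?_
    nlinarith [sq_nonneg c]
  · have e : σ * cylSolP y t r = Real.cos (Real.arctan (t + r)) ^ 2 *
        (2 * Real.cos (Real.arctan (t + r) - Real.arctan (t - r)) * (σ * (y θ).1) +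
        2 * (Real.sin (Real.arctan (t + r) - Real.arctan (t - r)) * (σ * (y θ).2))) := by
      rw [cylSolP]; ring
    rw [e]
    refine mul_le_mul hcc3 ?_ hpos (by positivity)
    have h6 : 0 ≤ Real.sin (Real.arctan (t + r) - Real.arctan (t - r)) * (σ * (y θ).2) :=
      mul_nonneg hsin h4
    nlinarith

/-- Initial states and existence times of the equation for pairs and of the equation in the
interaction picture agree. -/
theorem isSolution_times_eq (Z : L2R3 × L2R3) :
    {τ : ℝ | 0 < τ ∧ ∃ v w : ℝ → L2R3,
      IsSolution τ (mult (ji ^ 3) Z.1) (mult (ji ^ 2) Z.2) v w} =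
    {τ : ℝ | 0 < τ ∧ ∃ y : ℝ → L2R3 × L2R3, y 0 = Z ∧ IsSol waveField τ y} := by
  ext τ
  refine and_congr_right fun hτ => ⟨?_, ?_⟩
  · rintro ⟨v, w, h⟩
    obtain ⟨Y, hY, hvw⟩ := h.exists_isSol
    obtain ⟨h1, h2⟩ := hvw 0 ⟨le_rfl, hτ⟩
    refine ⟨Y, state_zero_injective (Z := fun _ => Z) ?_ ?_, hY⟩
    · rw [h1, h.init_fst, position, waveFst_zero]
    · rw [h2, h.init_snd, velocity, waveSnd_zero]
  · rintro ⟨y, rfl, hy⟩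
    have h := hy.isSolution
    rw [position, velocity, waveFst_zero, waveSnd_zero] at h
    exact ⟨_, _, h⟩

theorem tendsto_pairNorm {T : ℝ} {y : ℝ → L2R3 × L2R3} (hT : 0 < T)
    (h : Tendsto (fun t => ‖y t‖) (𝓝[<] T) atTop) :
    Tendsto (fun t => pairNorm (position y t) (velocity y t)) (𝓝[<] T) (𝓝 ⊤) := by
  set C := (2 + T) + (1 + ‖(1 - ji ^ 2 : ℝ →ᵇ ℝ)‖ * (1 + T)) with hC
  have hC0 : 0 < C := by positivity
  have h1 : Tendsto (fun t => ENNReal.ofReal (‖y t‖ / C)) (𝓝[<] T) (𝓝 ⊤) :=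
    ENNReal.tendsto_ofReal_atTop.comp (h.atTop_div_const hC0)
  refine tendsto_nhds_top_mono h1 ?_
  filter_upwards [Ico_mem_nhdsLT hT] with t ht
  have h2 : ‖y t‖ ≤ C * ‖((waveFst t (y t), waveSnd t (y t)) : L2R3 × L2R3)‖ := by
    set Z : L2R3 × L2R3 := (waveFst t (y t), waveSnd t (y t)) with hZ
    have e1 : (y t).1 = waveFst (-t) Z := (waveFst_neg_wave t (y t)).symm
    have e2 : (y t).2 = waveSnd (-t) Z := (waveSnd_neg_wave t (y t)).symm
    have ht' : |(-t)| ≤ T := by rw [abs_neg, abs_of_nonneg ht.1]; exact ht.2.le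
    refine max_le ?_ ?_
    · rw [e1]
      refine (norm_waveFst_le _ _).trans ?_
      gcongr
      have : 0 ≤ 1 + ‖(1 - ji ^ 2 : ℝ →ᵇ ℝ)‖ * (1 + T) := by positivity
      linarith
    · rw [e2]
      refine (norm_waveSnd_le _ _).trans ?_
      gcongr
      have : ‖(1 - ji ^ 2 : ℝ →ᵇ ℝ)‖ * (1 + |(-t)|) ≤ ‖(1 - ji ^ 2 : ℝ →ᵇ ℝ)‖ * (1 + T) := by
        gcongr
      linarith
  rw [position, velocity, pairNorm_mult]
  calc ENNReal.ofReal (‖y t‖ / C)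
      ≤ ENNReal.ofReal ‖((waveFst t (y t), waveSnd t (y t)) : L2R3 × L2R3)‖ := by
        refine ENNReal.ofReal_le_ofReal ?_
        rwa [div_le_iff₀ hC0, mul_comm]
    _ = ENNReal.ofReal (max ‖waveFst t (y t)‖ ‖waveSnd t (y t)‖) := rfl
    _ ≤ ENNReal.ofReal (‖waveFst t (y t)‖ + ‖waveSnd t (y t)‖) :=
        ENNReal.ofReal_le_ofReal (max_le_add_of_nonneg (norm_nonneg _) (norm_nonneg _))
    _ = _ := by
        rw [ENNReal.ofReal_add (norm_nonneg _) (norm_nonneg _), ofReal_norm, ofReal_norm]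

theorem exists_blowsUpAt {B : ℝ} (Z : L2R3 × L2R3)
    (hB : ∀ T > 0, ∀ y : ℝ → L2R3 × L2R3, y 0 = Z → IsSol waveField T y → T ≤ B) :
    ∃ T, 0 < T ∧ T ≤ B ∧ BlowsUpAt (mult (ji ^ 3) Z.1) (mult (ji ^ 2) Z.2) T := by
  obtain ⟨T, hT, y, hy0, hy, hlim, hmax⟩ := isLocLip_waveField.exists_maximal (y₀ := Z)
    ⟨B, fun T hT => by
      obtain ⟨h1, y, h2, h3⟩ := hT
      exact hB T h1 y h2 h3⟩
  refine ⟨T, hT, hB T hT y hy0 hy, position y, velocity y, ?_, tendsto_pairNorm hT hlim, ?_⟩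
  · have h := hy.isSolution
    rwa [position, velocity, waveFst_zero, waveSnd_zero, hy0] at h
  · intro τ v w hτ h
    obtain ⟨Y, hY, hvw⟩ := h.exists_isSol
    obtain ⟨h1, h2⟩ := hvw 0 ⟨le_rfl, hτ⟩
    have hY0 : Y 0 = Z := state_zero_injective (Z := fun _ => Z)
      (by rw [h1, h.init_fst, position, waveFst_zero])
      (by rw [h2, h.init_snd, velocity, waveSnd_zero])
    have hτT := hmax τ Y hτ hY0 hY
    refine ⟨hτT, fun t ht => ?_⟩
    have e : Y t = y t := hY.eqOn isLocLip_waveField (hy.mono hτT) (hY0.trans hy0.symm) ht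
    rw [← (hvw t ht).1, ← (hvw t ht).2, position, position, velocity, velocity, e]
    exact ⟨rfl, rfl⟩

/-- A radial solution that dominates the spatially constant solution `√2 / (t₁ + η - t)` at time
`t₁` on a ball of radius `2η`, together with outgoing derivatives, does not exist beyond
`t₁ + η`. -/
theorem IsRadSol.le_of_dominates {T t₁ η σ : ℝ} {z : ℝ → L2R3 × L2R3} (h : IsRadSol T z)
    (ht₁ : 0 ≤ t₁) (hη : 0 < η) (hσ : σ = 1 ∨ σ = -1)
    (hW : ∀ r, 0 ≤ r → r ≤ 2 * η → r * (√2 / η) ≤ σ * radW z t₁ r)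
    (hP : ∀ r, 0 ≤ r → r ≤ 2 * η → r * (√2 / η ^ 2) + √2 / η ≤ σ * radP z t₁ r) :
    T ≤ t₁ + η := by
  by_contra hcon
  rw [not_le] at hcon
  obtain ⟨R, hR0, hR⟩ := h.isSol.continuousOn.exists_norm_le_Icc hcon
  have hσa : |σ| = 1 := by rcases hσ with rfl | rfl <;> simp
  set T' := t₁ + η with hT'
  have h2 : (√2 : ℝ) ^ 2 = 2 := Real.sq_sqrt (by norm_num)
  have h20 : 0 < √2 := by positivity
  have hsqrt : 1 ≤ √2 := by nlinarith
  set M := sobConst * ((2 + T') * R) with hM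
  have hM0 : 0 ≤ M := by
    have := sobConst_nonneg
    have : 0 ≤ 2 + T' := by linarith
    positivity
  have hbd : ∀ t ∈ Icc 0 T', ∀ x, |posVal z t x| ≤ M := by
    intro t ht x
    refine (abs_ev_waveFst_le _ _ _).trans ?_
    rw [abs_of_nonneg ht.1, hM]
    have := ht.1; have := ht.2; have := hR t ht; have := sobConst_nonneg
    have : 0 ≤ 2 + T' := by linarith
    gcongr
  set d := min (η / 2) (1 / (M + 1)) with hd
  have hd0 : 0 < d := lt_min (by positivity) (by positivity)
  have hdη : d ≤ η / 2 := min_le_left _ _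
  have hdM : d ≤ 1 / (M + 1) := min_le_right _ _
  set b := T' - d with hb
  have hpos : ∀ s ∈ Icc t₁ b, d ≤ T' - s := fun s hs => by linarith [hs.2]
  have hdT : ∀ s, HasDerivAt (fun s => T' - s) (-1) s := fun s => by
    simpa using! (hasDerivAt_id s).const_sub T'
  have key := h.comparison (a := t₁) (b := b) (ρ := t₁ + 2 * η) (M := √2 / d)
    (M' := 2 * η * (√2 / d ^ 2) + √2 / d) ht₁ (by linarith) hσ
    (u := fun t _ => √2 / (T' - t))
    (P := fun t r => r * (√2 / (T' - t) ^ 2) + √2 / (T' - t))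
    (fun c s hs hcs => by
      have hne : T' - s ≠ 0 := (hd0.trans_le (hpos s hs)).ne'
      have h3 := ((hasDerivAt_id s).const_add c).mul ((hasDerivAt_const s √2).div (hdT s) hne)
      refine (h3.congr_deriv ?_).hasDerivWithinAt
      simp only [id, Pi.div_apply]
      field_simp
      ring)
    (fun c s hs hcs => by
      have hne : T' - s ≠ 0 := (hd0.trans_le (hpos s hs)).ne'
      have h3 := (((hasDerivAt_id s).const_sub c).mul
        ((hasDerivAt_const s √2).div ((hdT s).pow 2) (pow_ne_zero 2 hne))).add
        ((hasDerivAt_const s √2).div (hdT s) hne)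
      refine (h3.congr_deriv ?_).hasDerivWithinAt
      have h4 : (√2 : ℝ) ^ 3 = 2 * √2 := by rw [pow_succ, h2]
      simp only [id, Pi.div_apply, Pi.pow_apply, div_pow, h4]
      field_simp
      ring)
    (fun t ht r hr => by
      have := hpos t ht
      rw [abs_of_nonneg (div_nonneg h20.le (by linarith))]
      gcongr)
    (fun t ht r hr hrt => by
      have h5 := hpos t ht
      have h6 : 0 ≤ T' - t := by linarith
      rw [abs_of_nonneg (by positivity)]
      have : r ≤ 2 * η := by linarith [ht.1]
      gcongr)
    (fun r hr hrt => by
      rw [show T' - t₁ = η by rw [hT']; ring]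
      exact hW r hr (by linarith))
    (fun r hr hrt => by
      rw [show T' - t₁ = η by rw [hT']; ring]
      exact hP r hr (by linarith))
    (t := b) (r := η) ⟨by linarith, le_rfl⟩ hη.le (by linarith)
  have hbT : b ∈ Ico 0 T := ⟨by linarith, by linarith⟩
  have h3 := key.1
  rw [h.radW_eq_radPt hbT hη.le, ← mul_assoc, mul_comm σ, mul_assoc] at h3
  have h4 := le_of_mul_le_mul_left h3 hη
  have h5 : σ * posVal z b (radPt η) ≤ M := by
    refine (le_abs_self _).trans ?_
    rw [abs_mul, hσa, one_mul]
    exact hbd b ⟨hbT.1, by linarith⟩ _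
  rw [show T' - b = d by rw [hb]; ring] at h4
  have h6 : M + 1 ≤ √2 / d := by
    rw [le_div_iff₀ hd0]
    calc (M + 1) * d ≤ (M + 1) * (1 / (M + 1)) := by gcongr
      _ = 1 := by field_simp
      _ ≤ √2 := hsqrt
  linarith

/-- The solution of `ψ'' = ψ³ - ψ` on the cylinder blows up no later than `u`. -/
theorem IsRadSol.duffing_time_le {T S X V : ℝ} {Y : ℝ → L2R3 × L2R3} {y : ℝ → ℝ × ℝ}
    (h : IsRadSol T Y) (hT : 0 < T) (hlim : Tendsto (fun t => ‖Y t‖) (𝓝[<] T) atTop)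
    (hp : position Y 0 = initPosition X) (hv : velocity Y 0 = initVelocity V)
    (hy : IsSol duffing S y) (hy0 : y 0 = (X, V)) : S ≤ 2 * Real.arctan T := by
  by_contra hcon
  rw [not_le] at hcon
  obtain ⟨R, -, hR⟩ := hy.continuousOn.exists_norm_le_Icc hcon
  obtain ⟨R', hR'⟩ := h.isSol.exists_norm_le hT (M := 4 * R) fun t ht x => by
    have h1 := Real.arctan_mono ht.2.le
    exact h.abs_posVal_le hp hv hy hy0 ht (by linarith)
      (fun s hs => hR s ⟨hs.1, by linarith [hs.2]⟩) x
  obtain ⟨t, h1, h2⟩ := ((tendsto_atTop.1 hlim (R' + 1)).and (Ico_mem_nhdsLT hT)).exists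
  linarith [hR' t h2]

/-- A radial solution that is close at time `t` to a solution dominating a large constant on a
ball of radius `2η` does not exist beyond `t + η`. -/
theorem IsRadSol.le_of_close {T T' t η σ c : ℝ} {Y z : ℝ → L2R3 × L2R3} (hY : IsRadSol T Y)
    (hz : IsRadSol T' z) (ht : 0 ≤ t) (htT : t < T) (hη : 0 < η) (hη1 : η ≤ 1 / 4)
    (hσ : σ = 1 ∨ σ = -1) (hc : 3 * √2 / η + 1 ≤ c)
    (hW : ∀ r, 0 ≤ r → r ≤ 2 * η → r * c ≤ σ * radW Y t r)
    (hP : ∀ r, 0 ≤ r → r ≤ 2 * η → c ≤ σ * radP Y t r)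
    (hclose : t < T' → sobConst * ((3 + t) * ‖z t - Y t‖) ≤ 1) : T' ≤ t + η := by
  rcases le_or_gt T' t with htT' | htT'
  · linarith
  have hclose := hclose htT'
  have hσa : |σ| = 1 := by rcases hσ with rfl | rfl <;> simp
  have hs2 : 0 < √2 := by positivity
  have hS := sobConst_nonneg
  refine hz.le_of_dominates ht hη hσ (fun r hr hrη => ?_) fun r hr hrη => ?_
  · have h1 := hW r hr hrη
    rw [hY.radW_eq_radPt ⟨ht, htT⟩ hr] at h1
    rw [hz.radW_eq_radPt ⟨ht, htT'⟩ hr]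
    have h2 : |σ * (posVal z t (radPt r) - posVal Y t (radPt r))| ≤ 1 := by
      rw [abs_mul, hσa, one_mul, posVal_sub]
      refine (abs_ev_waveFst_le _ _ _).trans (le_trans ?_ hclose)
      rw [abs_of_nonneg ht]
      gcongr
      norm_num
    have h3 := (abs_le.1 h2).1
    have h4 : √2 / η ≤ c - 1 := by
      have : √2 / η ≤ 3 * √2 / η := by gcongr; linarith
      linarith
    have h5 : r * (√2 / η) ≤ r * (c - 1) := by gcongr
    have h6 := mul_le_mul_of_nonneg_left h3 hr
    nlinarith
  · have h1 := hP r hr hrη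
    have h2 : |σ * (radP z t r - radP Y t r)| ≤ 1 := by
      rw [abs_mul, hσa, one_mul, radP_sub]
      refine (abs_ev_waveFst_le _ _ _).trans (le_trans ?_ hclose)
      rw [abs_of_nonneg (by linarith)]
      have : 2 + (r + t) ≤ 3 + t := by linarith
      gcongr
    have h3 := (abs_le.1 h2).1
    have h4 : r * (√2 / η ^ 2) + √2 / η ≤ 3 * √2 / η := by
      calc r * (√2 / η ^ 2) + √2 / η ≤ 2 * η * (√2 / η ^ 2) + √2 / η := by gcongr
        _ = 3 * √2 / η := by field_simp; norm_num
    nlinarith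

theorem theorem1p6 (X Y tplus η : ℝ)
    (hu : IsFiniteMaximalTime (initPosition X) (initVelocity Y) tplus) (hη : 0 < η) :
    ∃ ε : ℝ, 0 < ε ∧ ∀ v₀ v₁ : L2R3, IsRadial v₀ → IsRadial v₁ →
      pairNorm (v₀ - initPosition X) (v₁ - initVelocity Y) < ENNReal.ofReal ε →
      ∃ T : ℝ, 0 < T ∧ T < tplus + η ∧ BlowsUpAt v₀ v₁ T := by
  obtain ⟨τ, hτ, v, w, hsol⟩ := hu.nonempty
  obtain ⟨F₀, G₀, hF₀, hG₀⟩ := exists_of_pairNorm_lt_top (hsol.finite 0 ⟨le_rfl, hτ⟩)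
  rw [hsol.init_fst] at hF₀
  rw [hsol.init_snd] at hG₀
  have hu' : IsLUB {τ : ℝ | 0 < τ ∧ ∃ y : ℝ → L2R3 × L2R3, y 0 = (F₀, G₀) ∧
      IsSol waveField τ y} tplus := by
    rw [← isSolution_times_eq, hF₀, hG₀]
    exact hu
  obtain ⟨Tm, hTm, U, hU0, hU, hUlim, hUmax⟩ := isLocLip_waveField.exists_maximal (F₀, G₀)
    hu'.bddAbove
  have hub : Tm ∈ upperBounds {τ : ℝ | 0 < τ ∧ ∃ y : ℝ → L2R3 × L2R3, y 0 = (F₀, G₀) ∧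
      IsSol waveField τ y} := fun S hS => by
    obtain ⟨h1, y, h2, h3⟩ := hS
    exact hUmax S y h1 h2 h3
  obtain rfl : Tm = tplus := le_antisymm (hu'.1 ⟨hTm, U, hU0, hU⟩) (hu'.2 hub)
  have hp : position U 0 = initPosition X := by rw [position, waveFst_zero, hU0, hF₀]
  have hv : velocity U 0 = initVelocity Y := by rw [velocity, waveSnd_zero, hU0, hG₀]
  have hUr : IsRadSol Tm U := hU.isRadSol (hp ▸ isRadial_initPosition X)
    (hv ▸ isRadial_initVelocity Y)
  obtain ⟨S, hS, y, hy0, hy, hylim, -⟩ := isLocLip_duffing.exists_maximal (y₀ := (X, Y))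
    ⟨2 * Real.arctan Tm, fun S hS => by
      obtain ⟨-, y, h2, h3⟩ := hS
      exact hUr.duffing_time_le hTm hUlim hp hv h3 h2⟩
  have hSle := hUr.duffing_time_le hTm hUlim hp hv hy hy0
  obtain ⟨σ, hσ, S₀, hS₀, hlow⟩ := hy.duffing_blowup hS hylim
  have hSpi : S / 2 < Real.pi / 2 := by linarith [Real.arctan_lt_pi_div_two Tm]
  set ts := Real.tan (S / 2) with hts
  have hats : Real.arctan ts = S / 2 := Real.arctan_tan (by linarith [Real.pi_pos]) hSpi
  have hts0 : 0 < ts := Real.tan_pos_of_pos_of_lt_pi_div_two (by linarith) hSpi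
  have htsle : ts ≤ Tm := Real.arctan_strictMono.le_iff_le.1 (by linarith)
  set c₀ := 1 / (1 + (ts + 1) ^ 2) with hc₀
  have hc₀0 : 0 < c₀ := by positivity
  obtain ⟨κ, hκ0, hκ⟩ : ∃ κ, 0 < κ ∧ κ ≤ 1 / 4 ∧ κ ≤ η / 2 ∧ κ ≤ c₀ / 40 ∧ κ ≤ ts ∧
      κ ≤ (S - S₀) / 6 := by
    have h1 : 0 < (S - S₀) / 6 := by linarith [hS₀.2]
    exact ⟨min (1 / 4) (min (η / 2) (min (c₀ / 40) (min ts ((S - S₀) / 6)))), by positivity,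
      by simp, by simp, by simp, by simp, by simp⟩
  obtain ⟨hκ1, hκη, hκc, hκts, hκS⟩ := hκ
  have hκ2 : κ ^ 2 ≤ κ := by nlinarith
  set t₁ := ts - κ ^ 2 with ht₁
  have ht₁0 : 0 ≤ t₁ := by linarith
  have ht₁ts : t₁ < ts := by linarith [pow_pos hκ0 2]
  have ht₁T : t₁ < Tm := ht₁ts.trans_le htsle
  have h2S : 2 * Real.arctan t₁ < S := by linarith [Real.arctan_strictMono ht₁ts]
  have hexp : ∀ r, 0 ≤ r → radW U t₁ r = r * cylSol y t₁ r ∧ radP U t₁ r = cylSolP y t₁ r :=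
    fun r hr => hUr.eq_cylSol hp hv hy hy0 ht₁T h2S ⟨ht₁0, le_rfl⟩ hr
  have hbig : ∀ r, 0 ≤ r → r ≤ 2 * κ → c₀ / (6 * κ ^ 2) ≤ σ * cylSol y t₁ r ∧
      c₀ / (6 * κ ^ 2) ≤ σ * cylSolP y t₁ r := fun r hr hrκ =>
    cylSol_lower_bound (by linarith) hlow hκ0 hκ1 (by linarith) ht₁0 ht₁ hr hrκ
  have hnum : 3 * √2 / κ + 1 ≤ c₀ / (6 * κ ^ 2) := by
    have h2 : √2 ≤ 3 / 2 := Real.sqrt_le_iff.2 ⟨by norm_num, by norm_num⟩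
    rw [le_div_iff₀ (by positivity)]
    have e : (3 * √2 / κ + 1) * (6 * κ ^ 2) = 18 * √2 * κ + 6 * κ ^ 2 := by
      field_simp
      ring
    rw [e]
    nlinarith
  obtain ⟨δ, hδ, C, hC, hdep⟩ := isLocLip_waveField.continuous_dependence hU ht₁T ht₁0
  have hsob := sobConst_nonneg
  set K := sobConst * ((3 + t₁) * C) with hK
  have hK0 : 0 ≤ K := by positivity
  refine ⟨min δ (1 / (K + 1)), by positivity, fun v₀ v₁ hv₀ hv₁ hε => ?_⟩
  obtain ⟨F, G, hF, hG⟩ := exists_of_pairNorm_lt_top (hε.trans ENNReal.ofReal_lt_top)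
  have hZp : mult (ji ^ 3) (F₀ + F) = v₀ := by rw [map_add, hF₀, hF, add_sub_cancel]
  have hZv : mult (ji ^ 2) (G₀ + G) = v₁ := by rw [map_add, hG₀, hG, add_sub_cancel]
  have hFG : ‖F‖ + ‖G‖ < min δ (1 / (K + 1)) := by
    rw [← hF, ← hG, pairNorm_mult, ← ofReal_norm, ← ofReal_norm,
      ← ENNReal.ofReal_add (norm_nonneg _) (norm_nonneg _)] at hε
    exact (ENNReal.ofReal_lt_ofReal_iff (by positivity)).1 hε
  have key : ∀ T > 0, ∀ z : ℝ → L2R3 × L2R3, z 0 = (F₀ + F, G₀ + G) → IsSol waveField T z →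
      T ≤ t₁ + κ := by
    intro T hT z hz0 hz
    have hzr : IsRadSol T z := hz.isRadSol
      (by rwa [position, waveFst_zero, hz0, hZp]) (by rwa [velocity, waveSnd_zero, hz0, hZv])
    refine hUr.le_of_close hzr ht₁0 ht₁T hκ0 hκ1 hσ hnum (fun r hr hrκ => ?_)
      (fun r hr hrκ => ?_) fun htT => ?_
    · rw [(hexp r hr).1, mul_left_comm]
      exact mul_le_mul_of_nonneg_left (hbig r hr hrκ).1 hr
    · rw [(hexp r hr).2]
      exact (hbig r hr hrκ).2
    · have hd : ‖z 0 - U 0‖ ≤ ‖F‖ + ‖G‖ := by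
        rw [hz0, hU0, Prod.mk_sub_mk, add_sub_cancel_left, add_sub_cancel_left]
        exact max_le_add_of_nonneg (norm_nonneg _) (norm_nonneg _)
      have h1 := hdep T z htT hz (hd.trans (hFG.le.trans (min_le_left _ _))) t₁ ⟨ht₁0, le_rfl⟩
      have h2 : ‖z 0 - U 0‖ ≤ 1 / (K + 1) := hd.trans (hFG.le.trans (min_le_right _ _))
      calc sobConst * ((3 + t₁) * ‖z t₁ - U t₁‖)
          ≤ sobConst * ((3 + t₁) * (C * (1 / (K + 1)))) := by
            have := h1.trans (mul_le_mul_of_nonneg_left h2 hC)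
            gcongr
        _ = K / (K + 1) := by rw [hK]; ring
        _ ≤ 1 := (div_le_one (by positivity)).2 (by linarith)
  obtain ⟨T, hT, hTle, hblow⟩ := exists_blowsUpAt (F₀ + F, G₀ + G) key
  refine ⟨T, hT, by linarith, ?_⟩
  rwa [hZp, hZv] at hblow
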